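/- Let \[ \mathbb{T}(2,3,7)=\langle c_1,c_2,c_3 \mid c_1^2,\ c_2^3,\ c_3^7,\ c_1c_2c_3\rangle . \] There is no finite quotient of $\mathbb{T}(2,3,7)$ of order $2520$, $2688$ or $6048$; that is, if $G$ is a finite group and $\varphi\colon \mathbb{T}(2,3,7)\to G$ is a surjective homomorphism, then $|G|\notin\{2520,2688,6048\}$. -/

import Mathlib

/-- The relators `c_1 ^ m_1, …, c_r ^ m_r` and `c_1 ⋯ c_r` (the product taken in this order), as
words in the free group on `c_1, …, c_r`. -/
def polygonalRels {r : ℕ} (m : Fin r → ℕ) : Set (FreeGroup (Fin r)) :=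
  Set.range (fun i : Fin r => FreeGroup.of i ^ m i) ∪
    {(List.ofFn fun i : Fin r => FreeGroup.of i).prod}

/-- The polygonal group `𝕋(m_1, …, m_r) = ⟨c_1, …, c_r | c_1 ^ m_1, …, c_r ^ m_r, c_1 ⋯ c_r⟩`. -/
abbrev PolygonalGroup {r : ℕ} (m : Fin r → ℕ) : Type :=
  PresentedGroup (polygonalRels m)

/-! Such a quotient `G` is generated by `x`, `y` with `x ^ 2 = y ^ 3 = (y * x) ^ 7 = 1`. Since 2, 3
and 7 are pairwise coprime, `G` is perfect, acts trivially on fewer than seven points, and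
centralizes any normal subgroup that `y * x` centralizes, for instance one whose order leaves no
room for a nontrivial action of order seven (`le_center_of_card`). By transfer, an abelian Sylow
subgroup contains no nontrivial central element (`eq_bot_of_le_center`) and is not its own
normalizer unless it is trivial (`ne_normalizer`).

Possible indices of subgroups are controlled by the action on cosets. The genus inequality
`fixedBy_bound` excludes some degrees at once. For other small degrees all coset tables are
enumerated (`search_sound`): each complete table contradicts the order of `G` or gives an image of
order 168 or 504, the orders of PSL(2,7) and PSL(2,8).

Orders 2520 and 6048: images of order 168 or 504 are impossible, because a Sylow subgroup of the
kernel would be central in `G` and lie in an abelian Sylow subgroup. So few indices are left for the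
subgroups containing a Sylow 3-subgroup. If the number of Sylow 3-subgroups is 1 modulo 9, these are
normal or abelian and self-normalizing, against transfer. Otherwise two of them meet in a subgroup
`D` of index three in both. The remaining indices force the normalizer of `D` to be an extension of
`D` by the alternating group of degree four; it has a normal subgroup of order four
(`Sylow.exists_normal_card_four`), whose normalizer in `G` has an index that was excluded.

Order 2688: a Sylow 2-subgroup has index 21, and its core `K` has order 16 and index 168. Over the
normalizer of a Sylow 7-subgroup of `G ⧸ K`, a subgroup of order eight of `K` can be divided out,
and Schur–Zassenhaus gives a subgroup of index 16. The enumeration in degree 16 excludes it. -/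

/-! ### Enumeration of coset tables, as functions on natural numbers -/

namespace CosetTable

/-- Evaluate `a` before passing it on; this keeps kernel evaluation strict. -/
noncomputable def force {α : Type} (a : ℕ) (f : ℕ → α) : α :=
  Nat.rec (f 0) (fun m _ => f (Nat.succ m)) a

/-- `f m` holds for all `m < k`, evaluated from `k - 1` downwards. -/
noncomputable def allBelow (k : ℕ) (f : ℕ → Bool) : Bool :=
  Nat.rec true (fun m ih => cond (f m) ih false) k

/-- The entry number `i` of a table of six-bit digits. -/
def get (t i : ℕ) : ℕ := Nat.land (Nat.shiftRight t (Nat.mul 6 i)) 63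

/-- Write the digit `v` into the empty entry number `i`. -/
def put (t i v : ℕ) : ℕ := Nat.lor t (Nat.shiftLeft v (Nat.mul 6 i))

/-- Follow `u⁻¹` from `r`, at most `i` times. The result is `64 * j + s` if it stops at `s` with `j` steps
to go. -/
noncomputable def back (xt yt : ℕ) (i : ℕ) : ℕ → ℕ :=
  Nat.rec (fun r => r)
    (fun i ih r => force (get xt (get yt (get yt r))) fun v =>
      Nat.rec (Nat.add (Nat.mul 64 (Nat.succ i)) r) (fun w _ => ih w) v) i

/-- Following `u` from `r`, with `i` steps to go out of seven, meets `p` only when it may. -/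
noncomputable def forth (xt yt : ℕ) (allow : Bool) (p : ℕ) (i : ℕ) : ℕ → Bool :=
  Nat.rec (fun _ => false)
    (fun i ih r => force (get xt r) fun v =>
      Nat.rec true (fun w _ => force (get yt w) fun s =>
        cond (Nat.beq s p) (cond (Nat.beq i 0) true (cond (Nat.beq i 6) allow false)) (ih s)) v) i

/-- An open label whose backward `u`-path is longest, with the end of this path. -/
noncomputable def pick (xt yt k : ℕ) : ℕ :=
  Nat.rec (fun best => best)
    (fun p ih best => force (get xt p) fun v =>
      cond (Nat.beq v 0)
        (force (Nat.add (Nat.mul 64 (back xt yt 6 p)) p) fun c => cond (Nat.ble c best) (ih c) (ih best))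
        -- The steps to go are the leading base-64 digit, so the minimum is the longest path. The
        -- initial value exceeds every candidate and survives only if no label is open.
        (ih best)) k 1000000

noncomputable def joined (xt p q : ℕ) : ℕ :=
  cond (Nat.beq p q) (put xt p (Nat.succ p)) (put (put xt p (Nat.succ q)) q (Nat.succ p))

/-- Depth-first completion of the tables. The value `true` means that every completion is
contradictory or passes `leaf`; too many labels or too high a cost closes a branch with `true`, lack
of fuel with `false`. If `u⁻¹` can be followed six times from the open label `p`, where `u = y * x`,
then `u ^ 7 = 1` forces the image of `p` under `x`. Otherwise this image is an open label or a new
one, in a new 3-cycle of `y` or fixed by `y`. The prices 21 and 28 of fixed points of `x` and `y`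
are the weights in `fixedBy_bound`. -/
noncomputable def search (n : ℕ) (leaf : ℕ → ℕ → Bool) (allow : Bool) (budget : ℕ) (fuel : ℕ) :
    ℕ → ℕ → ℕ → ℕ → Bool :=
  Nat.rec (fun _ _ _ _ => false)
    (fun _ ih k xt yt cost =>
      cond (Nat.ble k n) 
      (cond (Nat.ble cost budget) 
      (force (pick xt yt k) fun b =>
        cond (Nat.beq b 1000000)
          (cond (allBelow k fun p => cond (Nat.beq (get xt p) 0) false true)
            (cond (Nat.beq k n) (leaf xt yt) true) false)
          (force (Nat.land b 63) fun p => force (back xt yt 6 p) fun r =>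
            cond (cond (Nat.beq (get xt p) 0) (Nat.ble (Nat.succ p) k) false)
            (let branch : ℕ → Bool := fun q =>
              cond (Nat.beq (get xt q) 0)
                (force (joined xt p q) fun xt' =>
                  cond (forth xt' yt allow p 7 p)
                    (cond (forth xt' yt allow q 7 q)
                      (force (cond (Nat.beq p q) (Nat.add cost 21) cost) fun cost' =>
                        ih k xt' yt cost') true) true) true
            cond (Nat.ble 64 r)
              (cond (allBelow k branch)
                (cond
                  (force (put (put xt p (Nat.succ k)) k (Nat.succ p)) fun xt' =>
                    force (put (put (put yt k (Nat.add k 1)) (Nat.add k 1) (Nat.add k 2)) (Nat.add k 2) k) fun yt' =>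
                      force (Nat.add k 3) fun k' => ih k' xt' yt' cost)
                  (force (put (put xt p (Nat.succ k)) k (Nat.succ p)) fun xt' =>
                    force (put yt k k) fun yt' => 
                      cond (forth xt' yt' allow p 7 p)
                        (force (Nat.add k 1) fun k' => force (Nat.add cost 28) fun c' => ih k' xt' yt' c') true)
                  false) false)
              (branch (get yt (get yt r)))) false))
          true) true) fuel

/-- The label reached from `p` by the letters of `w`: `true` is `y * x`, `false` is `y⁻¹ * x`. -/
def walk (xt yt : ℕ) : List Bool → ℕ → ℕ
  | [], p => p
  | true :: w, p => walk xt yt w (get yt (Nat.pred (get xt p)))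
  | false :: w, p => walk xt yt w (get yt (get yt (Nat.pred (get xt p))))

/-- The first return of `p` under the word `w`, if there is one after `j + 1, …, j + i` steps from
`r`, takes a number of steps that does not divide `N`. -/
noncomputable def badReturn (N xt yt : ℕ) (w : List Bool) (p : ℕ) (i : ℕ) : ℕ → ℕ → Bool :=
  Nat.rec (fun _ _ => false)
    (fun _ ih j r => force (walk xt yt w r) fun s =>
      cond (Nat.beq s p) (cond (Nat.beq (Nat.mod N (Nat.succ j)) 0) false true) (ih (Nat.succ j) s)) i

noncomputable def badWord (N n xt yt : ℕ) (w : List Bool) : Bool :=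
  cond (allBelow n fun p => cond (badReturn N xt yt w p n 0 p) false true) false true

/-- Apply `f` to the lowest `m` digits of `t` in base `n`. -/
noncomputable def mapDigits (n : ℕ) (f : ℕ → ℕ) (m : ℕ) : ℕ → ℕ :=
  Nat.rec (fun _ => 0)
    (fun _ ih t => Nat.add (f (Nat.mod t n)) (Nat.mul n (ih (Nat.div t n)))) m

/-- Sets of codes, with membership and with insertion in continuation-passing style. -/
structure CodeSet (V : Type) where
  mem : V → ℕ → Bool
  insert : {α : Type} → V → ℕ → (V → α) → α

noncomputable def bitSet : CodeSet ℕ where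
  mem v t := Nat.beq (Nat.land (Nat.shiftRight v t) 1) 1
  insert v t f := force (Nat.lor v (Nat.shiftLeft 1 t)) f

noncomputable def listMem (v : List ℕ) (t : ℕ) : Bool :=
  List.rec false (fun a _ ih => cond (Nat.beq a t) true ih) v

/-- Codes of full tuples range up to `n ^ n`, too far for the bits of a number; `bitSet` serves for
triples. -/
noncomputable def listSet : CodeSet (List ℕ) where
  mem := listMem
  insert v t f := f (t :: v)

noncomputable def visit {V : Type} (S : CodeSet V) (t : ℕ) (st : List ℕ) (v : V) (c : ℕ)
    (k : List ℕ → V → ℕ → ℕ) : ℕ :=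
  cond (S.mem v t) (k st v c) (S.insert v t fun v' => force (Nat.succ c) fun c' => k (t :: st) v' c')

/-- Search the orbit by depth first. The result is `0` if more than `limit` codes are found, and `c + 2` if the orbit
has `c` codes. -/
noncomputable def orbitCount {V : Type} (S : CodeSet V) (s₁ s₂ : ℕ → ℕ) (limit : ℕ) (fuel : ℕ) :
    List ℕ → V → ℕ → ℕ :=
  Nat.rec (fun _ _ _ => 1)
    (fun _ ih st v c => cond (Nat.ble c limit)
      (List.rec (Nat.add c 2) (fun t st' _ =>
        force (s₁ t) fun t₁ => force (s₂ t) fun t₂ =>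
          visit S t₁ st' v c fun st₁ v₁ c₁ => visit S t₂ st₁ v₁ c₁ fun st₂ v₂ c₂ => ih st₂ v₂ c₂) st) 0) fuel

noncomputable def tupleCount {V : Type} (S : CodeSet V) (v : V) (n xt yt limit m t : ℕ) : ℕ :=
  S.insert v t fun v' =>
    orbitCount S (mapDigits n (fun p => Nat.pred (get xt p)) m) (mapDigits n (get yt) m) limit
      (Nat.add limit 2) [t] v' 1

/-- Orbit sizes divide the group order. The count `0` means more than `N` codes, a contradiction;
`1` means that the fuel ran out and proves nothing; `c + 2` asks whether `c` divides `N`. -/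
noncomputable def badTuple (N n xt yt t : ℕ) : Bool :=
  force (tupleCount bitSet 0 n xt yt N 3 t) fun r =>
    Nat.rec true (fun r' _ => Nat.rec false
      (fun c _ => cond (Nat.beq (Nat.mod N c) 0) false true) r') r

/-- The code of the tuple of all labels. -/
noncomputable def fullCode (n : ℕ) (m : ℕ) : ℕ → ℕ :=
  Nat.rec (fun _ => 0) (fun _ ih i => Nat.add i (Nat.mul n (ih (Nat.succ i)))) m

/-- The tuple of all points has trivial stabilizer in the image, so its orbit has the order of the
image. Counts are shifted by two: 170 and 506 stand for 168 and 504. In the second case the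
commutator `y⁻¹ x y x` must have order nine in the image. -/
noncomputable def smallImage (n xt yt : ℕ) : Bool :=
  force (fullCode n n 0) fun t => force (tupleCount listSet [] n xt yt 504 n t) fun r =>
    cond (Nat.beq r 170) true (cond (Nat.beq r 506)
      (cond (allBelow n fun p => Nat.beq (walk xt yt [true, false, true, false, true, false] p) p) false
        (allBelow n fun p => Nat.beq (walk xt yt
          [true, false, true, false, true, false, true, false, true, false, true, false,
            true, false, true, false, true, false] p) p)) false)

/-- The cheap tests on cycle lengths come first. In base `n` the codes `n + n ^ 2` and `n + 2 * n ^
2` are the triples `(0, 1, 1)`, in effect a pair, and `(0, 1, 2)`. -/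
noncomputable def leaf (N n xt yt : ℕ) : Bool :=
  cond (badWord N n xt yt [true, false]) true
    (cond (badWord N n xt yt [true, true, false, false]) true
      (cond (badWord N n xt yt [true, true, false, true, false]) true
        (cond (force (Nat.add n (Nat.mul n n)) fun t => badTuple N n xt yt t) true
          (cond (force (Nat.add n (Nat.mul 2 (Nat.mul n n))) fun t => badTuple N n xt yt t) true
            (smallImage n xt yt)))))

/-- Start from a fixed label of `y`. -/
noncomputable def searchFromY (N n : ℕ) (allow : Bool) : Bool :=
  -- The budget is what `fixedBy_bound` leaves for `x` and `y`, since `y * x` has at least `n % 7`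
  -- fixed points. The first label already costs 28.
  search n (leaf N n) allow (n + 84 - 36 * (n % 7)) (2 * n) 1 0 0 28

/-- Start from a fixed label of `x`. -/
noncomputable def searchFromX (N n : ℕ) (allow : Bool) : Bool :=
  -- Initially `x` fixes 0, at the price 21, and `y` permutes 0, 1, 2 cyclically.
  search n (leaf N n) allow (n + 84 - 36 * (n % 7)) (2 * n) 3 1 0b000000000010000001 21

end CosetTable

/-! ### Partial tables that describe an action, and soundness of the search -/

namespace CosetTable

theorem force_eq {α : Type} (a : ℕ) (f : ℕ → α) : force a f = f a := by cases a <;> rfl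

theorem allBelow_iff {k : ℕ} {f : ℕ → Bool} : allBelow k f = true ↔ ∀ m < k, f m = true := by
  induction k with
  | zero => simp [allBelow]
  | succ k ih =>
    have h : allBelow (k + 1) f = cond (f k) (allBelow k f) false := rfl
    rw [h]
    cases hk : f k with
    | false => simpa using ⟨k, le_rfl, hk⟩
    | true =>
      rw [cond_true, ih]
      refine ⟨fun h m hm => ?_, fun h m hm => h m (by omega)⟩
      rcases Nat.lt_succ_iff_lt_or_eq.mp hm with hm | rfl
      exacts [h m hm, hk]

theorem testBit_get (t i b : ℕ) : (get t i).testBit b = (decide (b < 6) && t.testBit (6 * i + b)) := by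
  have h : get t i = (t >>> (6 * i)) &&& (2 ^ 6 - 1) := rfl
  rw [h, Nat.testBit_and, Nat.testBit_shiftRight, Nat.testBit_two_pow_sub_one, Bool.and_comm]

theorem get_put (t i v j : ℕ) (hv : v < 64) :
    get (put t i v) j = if j = i then get t i ||| v else get t j := by
  have h : put t i v = t ||| (v <<< (6 * i)) := rfl
  apply Nat.eq_of_testBit_eq
  intro b
  rw [testBit_get, h, Nat.testBit_or, Nat.testBit_shiftLeft]
  by_cases hb : b < 6
  · split_ifs with hj
    · subst hj
      rw [Nat.testBit_or, testBit_get]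
      simp [hb]
    · rw [testBit_get]
      rcases lt_or_gt_of_ne hj with hlt | hgt
      · have : ¬ (6 * j + b ≥ 6 * i) := by omega
        simp [hb, this]
      · have : v.testBit (6 * j + b - 6 * i) = false :=
          Nat.testBit_lt_two_pow (lt_of_lt_of_le hv (Nat.pow_le_pow_right (n := 2) (by norm_num)
            (show 6 ≤ 6 * j + b - 6 * i by omega)))
        simp [hb, this]
  · split_ifs with hj
    · have hvb : v.testBit b = false :=
        Nat.testBit_lt_two_pow (lt_of_lt_of_le hv (Nat.pow_le_pow_right (n := 2) (by norm_num) (not_lt.mp hb)))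
      rw [Nat.testBit_or, testBit_get]
      simp [hb, hvb]
    · rw [testBit_get]; simp [hb]

/-- Writing is a bitwise or, hence correct only on an empty entry. -/
theorem get_put_of_empty {t i v j : ℕ} (hv : v < 64) (h : get t i = 0) :
    get (put t i v) j = if j = i then v else get t j := by
  rw [get_put t i v j hv, h, Nat.zero_or]

variable {G X : Type*} [Group G] [MulAction G X] {x y : G}

/-- The tables describe the action of `x` and `y` on the `k` distinct points `e 0, …, e (k - 1)`: the points are closed
under `y`, and the entry `q + 1` in place `p` of `xt` says that `x` exchanges `e p` and `e q`. -/
structure Labelled (x y : G) (e : ℕ → X) (k xt yt : ℕ) : Prop where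
  inj : ∀ i < k, ∀ j < k, e i = e j → i = j
  y_lt : ∀ p < k, get yt p < k
  y_eq : ∀ p < k, y • e p = e (get yt p)
  x_lt : ∀ p < k, ∀ q, get xt p = q + 1 → q < k
  x_eq : ∀ p < k, ∀ q, get xt p = q + 1 → x • e p = e q
  x_symm : ∀ p < k, ∀ q, get xt p = q + 1 → get xt q = p + 1
  x_empty : ∀ p, k ≤ p → get xt p = 0
  y_empty : ∀ p, k ≤ p → get yt p = 0

namespace Labelled

variable {e : ℕ → X} {k xt yt : ℕ}

theorem y_sq (h : Labelled x y e k xt yt) {p : ℕ} (hp : p < k) :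
    y • y • e p = e (get yt (get yt p)) := by
  rw [h.y_eq p hp, h.y_eq _ (h.y_lt p hp)]

theorem y_sq_lt (h : Labelled x y e k xt yt) {p : ℕ} (hp : p < k) : get yt (get yt p) < k :=
  h.y_lt _ (h.y_lt p hp)

/-- A value below 64 means that all steps were made. One step is `u⁻¹ = x * y ^ 2`, by the
relations. -/
theorem back_spec (h : Labelled x y e k xt yt) (hx : x ^ 2 = 1) (hy : y ^ 3 = 1) (i : ℕ) :
    ∀ r < k, back xt yt i r < 64 →
      back xt yt i r < k ∧ (y * x) ^ i • e (back xt yt i r) = e r := by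
  induction i with
  | zero => intro r hr _; exact ⟨hr, by simp [back]⟩
  | succ i ih =>
    intro r hr hlt
    have hs : back xt yt (i + 1) r = force (get xt (get yt (get yt r))) fun v =>
      Nat.rec (Nat.add (Nat.mul 64 (Nat.succ i)) r) (fun w _ => back xt yt i w) v := rfl
    rw [force_eq] at hs
    cases hv : get xt (get yt (get yt r)) with
    | zero =>
      rw [hv] at hs
      have hs' : back xt yt (i + 1) r = 64 * (i + 1) + r := hs
      omega
    | succ w =>
      rw [hv] at hs
      have hs' : back xt yt (i + 1) r = back xt yt i w := hs
      rw [hs'] at hlt ⊢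
      have hY := h.y_sq_lt hr
      obtain ⟨h1, h2⟩ := ih w (h.x_lt _ hY w hv) hlt
      refine ⟨h1, ?_⟩
      rw [pow_succ', mul_smul, h2, ← h.x_eq _ hY w hv, ← h.y_sq hr, ← mul_smul, ← mul_smul, ← mul_smul]
      have : y * x * x * y * y = 1 := by
        rw [mul_assoc y x x, ← pow_two, hx, mul_one, mul_assoc, ← pow_two, ← pow_succ', hy]
      rw [this, one_smul]

end Labelled

theorem smul_eq_of_pow_smul_eq {u : G} (hu : u ^ 7 = 1) {a : ℕ} (b : ℕ) (hab : a * b % 7 = 1) {p : X}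
    (h : u ^ a • p = p) : u • p = p := by
  have h1 : u ^ a ∈ MulAction.stabilizer G p := h
  have h2 := pow_mem h1 b
  rw [← pow_mul, ← Nat.div_add_mod (a * b) 7, hab, pow_add, pow_mul, hu, one_pow, one_mul, pow_one] at h2
  exact h2

namespace Labelled

variable {e : ℕ → X} {k xt yt : ℕ}

/-- As 7 is prime, a cycle of `u = y * x` has length 1 or 7. A return after one step is a fixed
point, possible only under `allow`; a return after two to six steps would make the point fixed, and
that would have shown at the first step. -/
theorem forth_spec (h : Labelled x y e k xt yt) (hu : (y * x) ^ 7 = 1) {allow : Bool}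
    (hallow : allow = false → ∀ p : X, (y * x) • p ≠ p) {p : ℕ} (hp : p < k) (i : ℕ) :
    ∀ r < k, i ≤ 7 → (y * x) ^ (7 - i) • e p = e r → (i < 7 → r ≠ p ∧ (y * x) • e p ≠ e p) →
      forth xt yt allow p i r = true := by
  induction i with
  | zero =>
    intro r hr _ h1 h2
    rw [hu, one_smul] at h1
    exact absurd (h.inj _ hp _ hr h1).symm (h2 (by norm_num)).1
  | succ i ih =>
    intro r hr hi h1 h2
    have hs : forth xt yt allow p (i + 1) r = force (get xt r) fun v =>
      Nat.rec true (fun w _ => force (get yt w) fun s =>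
        cond (Nat.beq s p) (cond (Nat.beq i 0) true (cond (Nat.beq i 6) allow false))
          (forth xt yt allow p i s)) v := rfl
    rw [force_eq] at hs
    cases hv : get xt r with
    | zero => rw [hv] at hs; exact hs
    | succ w =>
      rw [hv] at hs
      simp only [force_eq] at hs
      rw [hs]
      have hw := h.x_lt r hr w hv
      have hstep : (y * x) ^ (7 - i) • e p = e (get yt w) := by
        rw [show 7 - i = (7 - (i + 1)) + 1 by omega, pow_succ', mul_smul, h1, mul_smul,
          h.x_eq r hr w hv, h.y_eq w hw]
      cases hb : Nat.beq (get yt w) p with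
      | true =>
        have hb' : get yt w = p := Nat.eq_of_beq_eq_true hb
        rw [hb'] at hstep
        by_cases hi0 : i = 0
        · subst hi0; rfl
        by_cases hi6 : i = 6
        · subst hi6
          cases ha : allow with
          | true => rfl
          | false =>
            exact absurd (by simpa using hstep) (hallow ha (e p))
        · exfalso
          refine (h2 (by omega)).2 ?_
          have hi' : i ≤ 6 := by omega
          interval_cases i
          · exact absurd rfl hi0
          -- The numeral is the inverse of `7 - i` modulo 7.
          · exact smul_eq_of_pow_smul_eq hu 6 (by norm_num) hstep
          · exact smul_eq_of_pow_smul_eq hu 3 (by norm_num) hstep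
          · exact smul_eq_of_pow_smul_eq hu 2 (by norm_num) hstep
          · exact smul_eq_of_pow_smul_eq hu 5 (by norm_num) hstep
          · exact smul_eq_of_pow_smul_eq hu 4 (by norm_num) hstep
          · exact absurd rfl hi6
      | false =>
        have hb' : get yt w ≠ p := Nat.ne_of_beq_eq_false hb
        rw [cond_false]
        refine ih _ (h.y_lt w hw) (by omega) hstep fun hi7 => ⟨hb', ?_⟩
        by_cases hi6 : i = 6
        · subst hi6
          intro hc
          rw [show 7 - 6 = 1 from rfl, pow_one, hc] at hstep
          exact hb' (h.inj _ hp _ (h.y_lt w hw) hstep).symm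
        · exact (h2 (by omega)).2

/-- Entering the pair `p`, `q` of labels that `x` exchanges. -/
theorem join (h : Labelled x y e k xt yt) (hx : x ^ 2 = 1) (hk : k ≤ 60) {p q : ℕ} (hp : p < k) (hq : q < k)
    (hp0 : get xt p = 0) (hq0 : get xt q = 0) (hpq : x • e p = e q) :
    Labelled x y e k (joined xt p q) yt ∧ ∀ j, get (joined xt p q) j =
      if j = p then q + 1 else if j = q then p + 1 else get xt j := by
  have hqp : x • e q = e p := by rw [← hpq, ← mul_smul, ← pow_two, hx, one_smul]
  have hget : ∀ j, get (joined xt p q) j =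
      if j = p then q + 1 else if j = q then p + 1 else get xt j := by
    intro j
    have hj : joined xt p q = cond (Nat.beq p q) (put xt p (p + 1)) (put (put xt p (q + 1)) q (p + 1)) := rfl
    by_cases hpq' : p = q
    · subst hpq'
      rw [hj, Nat.beq_refl, cond_true, get_put_of_empty (by omega) hp0]
      split_ifs <;> rfl
    · have : Nat.beq p q = false := by
        rw [Bool.eq_false_iff]; exact fun hc => hpq' (Nat.eq_of_beq_eq_true hc)
      have hq0' : get (put xt p (q + 1)) q = 0 := by
        rw [get_put_of_empty (by omega) hp0, if_neg (Ne.symm hpq'), hq0]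
      rw [hj, this, cond_false, get_put_of_empty (by omega) hq0', get_put_of_empty (by omega) hp0]
      split_ifs <;> first | rfl | omega
  refine ⟨⟨h.inj, h.y_lt, h.y_eq, ?_, ?_, ?_, ?_, h.y_empty⟩, hget⟩
  · intro j hj r hr
    rw [hget] at hr
    split_ifs at hr
    · omega
    · omega
    · exact h.x_lt j hj r hr
  · intro j hj r hr
    rw [hget] at hr
    split_ifs at hr with h1 h2
    · rw [h1, hpq]; congr 1; omega
    · rw [h2, hqp]; congr 1; omega
    · exact h.x_eq j hj r hr
  · intro j hj r hr
    rw [hget] at hr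
    split_ifs at hr with h1 h2
    · have : r = q := by omega
      subst this
      rw [hget]; split_ifs <;> omega
    · have : r = p := by omega
      subst this
      rw [hget]; split_ifs <;> omega
    · have h3 := h.x_symm j hj r hr
      rw [hget, if_neg, if_neg, h3]
      · rintro rfl; omega
      · rintro rfl; omega
  · intro j hj
    rw [hget, if_neg (by omega), if_neg (by omega), h.x_empty j hj]

end Labelled

end CosetTable

namespace CosetTable

variable {G X : Type*} [Group G] [MulAction G X] {x y : G}

namespace Labelled

variable {e : ℕ → X} {k xt yt : ℕ}

theorem not_mem_y (h : Labelled x y e k xt yt) (hy : y ^ 3 = 1) {z : X} (hz : ∀ q < k, z ≠ e q) :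
    ∀ q < k, y • z ≠ e q := by
  intro q hq hc
  refine hz _ (h.y_sq_lt hq) ?_
  rw [← h.y_sq hq, ← hc, ← mul_smul, ← mul_smul, mul_assoc, ← pow_two, ← pow_succ', hy, one_smul]

/-- A new point that is fixed by `y`. -/
theorem extend_fixed (h : Labelled x y e k xt yt) (hx : x ^ 2 = 1) (hk : k ≤ 60) {p : ℕ} (hp : p < k)
    (hp0 : get xt p = 0) {z : X} (hpz : x • e p = z) (hz : ∀ q < k, z ≠ e q) (hyz : y • z = z) :
    Labelled x y (fun j => if j < k then e j else z) (k + 1)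
        (put (put xt p (k + 1)) k (p + 1)) (put yt k k) ∧
      ∀ j, get (put (put xt p (k + 1)) k (p + 1)) j =
        if j = k then p + 1 else if j = p then k + 1 else get xt j := by
  have hzp : x • z = e p := by rw [← hpz, ← mul_smul, ← pow_two, hx, one_smul]
  have hgy : ∀ j, get (put yt k k) j = if j = k then k else get yt j := fun j =>
    get_put_of_empty (by omega) (h.y_empty k le_rfl)
  have hgx : ∀ j, get (put (put xt p (k + 1)) k (p + 1)) j =
        if j = k then p + 1 else if j = p then k + 1 else get xt j := by
    intro j
    have : get (put xt p (k + 1)) k = 0 := by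
      rw [get_put_of_empty (by omega) hp0, if_neg (by omega), h.x_empty k le_rfl]
    rw [get_put_of_empty (by omega) this, get_put_of_empty (by omega) hp0]
  refine ⟨⟨?_, ?_, ?_, ?_, ?_, ?_, ?_, ?_⟩, hgx⟩
  · intro i hi j hj hij
    split_ifs at hij with h1 h2 h2
    · exact h.inj i h1 j h2 hij
    · exact absurd hij.symm (hz i h1)
    · exact absurd hij (hz j h2)
    · omega
  · intro j hj
    rw [hgy]
    split_ifs with h1
    · omega
    · have := h.y_lt j (by omega); omega
  · intro j hj
    rcases Nat.lt_succ_iff_lt_or_eq.mp hj with h1 | h1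
    · have hg := (hgy j).trans (if_neg (by omega))
      simp only [hg, h1, if_true, h.y_lt j h1, h.y_eq j h1]
    · have hg := (hgy j).trans (if_pos h1)
      simp only [hg]; simp [h1, hyz]
  · intro j hj q hq
    rw [hgx] at hq
    split_ifs at hq with h1 h2
    · omega
    · omega
    · have := h.x_lt j (by omega) q hq; omega
  · intro j hj q hq
    rw [hgx] at hq
    split_ifs at hq with h1 h2
    · have : q = p := by omega
      subst this
      simp [h1, hp, hzp]
    · have : q = k := by omega
      subst this
      simp [h2, hp, hpz]
    · have hj' : j < k := by omega
      simp only [hj', if_true, h.x_lt j hj' q hq, h.x_eq j hj' q hq]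
  · intro j hj q hq
    rw [hgx] at hq ⊢
    split_ifs at hq with h1 h2
    · rw [if_neg (by omega), if_pos (by omega)]; omega
    · rw [if_pos (by omega)]; omega
    · have h3 := h.x_symm j (by omega) q hq
      have := h.x_lt j (by omega) q hq
      rw [if_neg (by omega), if_neg, h3]
      rintro rfl; omega
  · intro j hj
    rw [hgx, if_neg (by omega), if_neg (by omega), h.x_empty j (by omega)]
  · intro j hj
    rw [hgy, if_neg (by omega), h.y_empty j (by omega)]

/-- Three new points that `y` permutes cyclically. -/
theorem extend_cycle (h : Labelled x y e k xt yt) (hx : x ^ 2 = 1) (hy : y ^ 3 = 1) (hk : k ≤ 60) {p : ℕ}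
    (hp : p < k) (hp0 : get xt p = 0) {z : X} (hpz : x • e p = z) (hz : ∀ q < k, z ≠ e q)
    (hyz : y • z ≠ z) :
    Labelled x y (fun j => if j < k then e j else if j = k then z else if j = k + 1 then y • z else
          y • y • z) (k + 3)
        (put (put xt p (k + 1)) k (p + 1))
        (put (put (put yt k (k + 1)) (k + 1) (k + 2)) (k + 2) k) ∧
      ∀ j, get (put (put xt p (k + 1)) k (p + 1)) j =
        if j = k then p + 1 else if j = p then k + 1 else get xt j := by
  have hzp : x • z = e p := by rw [← hpz, ← mul_smul, ← pow_two, hx, one_smul]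
  have hy3 : y • y • y • z = z := by
    rw [← mul_smul, ← mul_smul, ← pow_two, ← pow_succ, hy, one_smul]
  have hgy : ∀ j, get (put (put (put yt k (k + 1)) (k + 1) (k + 2)) (k + 2) k) j =
      if j = k + 2 then k else if j = k + 1 then k + 2 else if j = k then k + 1 else get yt j := by
    intro j
    have h0 := h.y_empty k le_rfl
    have h1 : get (put yt k (k + 1)) (k + 1) = 0 := by
      rw [get_put_of_empty (by omega) h0, if_neg (by omega), h.y_empty _ (by omega)]
    have h2 : get (put (put yt k (k + 1)) (k + 1) (k + 2)) (k + 2) = 0 := by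
      rw [get_put_of_empty (by omega) h1, if_neg (by omega), get_put_of_empty (by omega) h0,
        if_neg (by omega), h.y_empty _ (by omega)]
    rw [get_put_of_empty (by omega) h2, get_put_of_empty (by omega) h1, get_put_of_empty (by omega) h0]
  have hgx : ∀ j, get (put (put xt p (k + 1)) k (p + 1)) j =
        if j = k then p + 1 else if j = p then k + 1 else get xt j := by
    intro j
    have : get (put xt p (k + 1)) k = 0 := by
      rw [get_put_of_empty (by omega) hp0, if_neg (by omega), h.x_empty k le_rfl]
    rw [get_put_of_empty (by omega) this, get_put_of_empty (by omega) hp0]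
  have hz1 := h.not_mem_y hy hz
  have hz2 := h.not_mem_y hy hz1
  have hn1 : y • y • z ≠ z := fun hc => hyz (by rw [hc] at hy3; exact hy3)
  have hn2 : y • y • z ≠ y • z := fun hc => hyz (smul_left_cancel y hc)
  refine ⟨⟨?_, ?_, ?_, ?_, ?_, ?_, ?_, ?_⟩, hgx⟩
  · intro i hi j hj hij
    by_cases hik : i < k <;> by_cases hjk : j < k
    · simp only [hik, hjk, if_true] at hij
      exact h.inj i hik j hjk hij
    · exfalso
      simp only [hik, hjk, if_true, if_false] at hij
      split_ifs at hij
      exacts [hz i hik hij.symm, hz1 i hik hij.symm, hz2 i hik hij.symm]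
    · exfalso
      simp only [hik, hjk, if_true, if_false] at hij
      split_ifs at hij
      exacts [hz j hjk hij, hz1 j hjk hij, hz2 j hjk hij]
    · simp only [hik, hjk, if_false] at hij
      split_ifs at hij <;> first | omega | (exfalso; first | exact hyz hij | exact hyz hij.symm | exact hn1 hij | exact hn1 hij.symm | exact hn2 hij | exact hn2 hij.symm)
  · intro j hj
    rw [hgy]
    split_ifs with h1
    · omega
    · omega
    · omega
    · have := h.y_lt j (by omega); omega
  · intro j hj
    obtain h1 | h1 | h1 | h1 : j < k ∨ j = k ∨ j = k + 1 ∨ j = k + 2 := by omega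
    · have hg : get (put (put (put yt k (k + 1)) (k + 1) (k + 2)) (k + 2) k) j = get yt j := by
        rw [hgy, if_neg (by omega), if_neg (by omega), if_neg (by omega)]
      simp only [hg, h1, if_true, h.y_lt j h1, h.y_eq j h1]
    · have hg : get (put (put (put yt k (k + 1)) (k + 1) (k + 2)) (k + 2) k) j = k + 1 := by
        rw [hgy, if_neg (by omega), if_neg (by omega), if_pos h1]
      simp only [hg]; simp [h1]
    · have hg : get (put (put (put yt k (k + 1)) (k + 1) (k + 2)) (k + 2) k) j = k + 2 := by
        rw [hgy, if_neg (by omega), if_pos h1]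
      simp only [hg]; simp [h1]
    · have hg := (hgy j).trans (if_pos h1)
      simp only [hg]; simp [h1, hy3]
  · intro j hj q hq
    rw [hgx] at hq
    split_ifs at hq with h1 h2
    · omega
    · omega
    · have := h.x_lt j (by_contra fun hc => by rw [h.x_empty j (by omega)] at hq; omega) q hq; omega
  · intro j hj q hq
    rw [hgx] at hq
    split_ifs at hq with h1 h2
    · have : q = p := by omega
      subst this
      simp [h1, hp, hzp]
    · have : q = k := by omega
      subst this
      simp [h2, hp, hpz]
    · have hj' : j < k := by_contra fun hc => by rw [h.x_empty j (by omega)] at hq; omega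
      simp only [hj', if_true, h.x_lt j hj' q hq, h.x_eq j hj' q hq]
  · intro j hj q hq
    rw [hgx] at hq ⊢
    split_ifs at hq with h1 h2
    · rw [if_neg (by omega), if_pos (by omega)]; omega
    · rw [if_pos (by omega)]; omega
    · have hj' : j < k := by_contra fun hc => by rw [h.x_empty j (by omega)] at hq; omega
      have h3 := h.x_symm j hj' q hq
      have := h.x_lt j hj' q hq
      rw [if_neg (by omega), if_neg, h3]
      rintro rfl; omega
  · intro j hj
    rw [hgx, if_neg (by omega), if_neg (by omega), h.x_empty j (by omega)]
  · intro j hj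
    rw [hgy, if_neg (by omega), if_neg (by omega), if_neg (by omega), h.y_empty j (by omega)]

theorem le_card [Finite X] (h : Labelled x y e k xt yt) : k ≤ Nat.card X := by
  have : Function.Injective fun i : Fin k => e i := fun i j hij => Fin.ext (h.inj i i.2 j j.2 hij)
  simpa using Nat.card_le_card_of_injective _ this

end Labelled

/-- `cost` is the price of the fixed points of `x` and `y` found so far. -/
def Cost (x y : G) (e : ℕ → X) (k xt cost : ℕ) : Prop :=
  ∃ A B : Finset X, cost = 21 * A.card + 28 * B.card ∧
    (∀ a ∈ A, x • a = a ∧ ∃ p < k, get xt p ≠ 0 ∧ e p = a) ∧ ∀ b ∈ B, y • b = b ∧ ∃ p < k, e p = b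

theorem search_succ (n : ℕ) (leaf : ℕ → ℕ → Bool) (allow : Bool) (budget fuel k xt yt cost : ℕ) :
    search n leaf allow budget (fuel + 1) k xt yt cost =
      let branch : ℕ → ℕ → Bool := fun p q =>
        cond (Nat.beq (get xt q) 0)
          (cond (forth (joined xt p q) yt allow p 7 p)
            (cond (forth (joined xt p q) yt allow q 7 q)
              (search n leaf allow budget fuel k (joined xt p q) yt (cond (Nat.beq p q) (cost + 21) cost))
                true) true) true
      cond (Nat.ble k n) (cond (Nat.ble cost budget)
        (cond (Nat.beq (pick xt yt k) 1000000)
          (cond (allBelow k fun p => cond (Nat.beq (get xt p) 0) false true)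
            (cond (Nat.beq k n) (leaf xt yt) true) false)
          (let p := Nat.land (pick xt yt k) 63;
            cond (cond (Nat.beq (get xt p) 0) (Nat.ble (p + 1) k) false)
              (cond (Nat.ble 64 (back xt yt 6 p))
                (cond (allBelow k (branch p))
                  (cond
                    (search n leaf allow budget fuel (k + 3) (put (put xt p (k + 1)) k (p + 1))
                      (put (put (put yt k (k + 1)) (k + 1) (k + 2)) (k + 2) k) cost)
                    (cond (forth (put (put xt p (k + 1)) k (p + 1)) (put yt k k) allow p 7 p)
                      (search n leaf allow budget fuel (k + 1) (put (put xt p (k + 1)) k (p + 1))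
                        (put yt k k) (cost + 28)) true) false) false)
                (branch p (get yt (get yt (back xt yt 6 p))))) false)) true) true := by
  simp only [search, force_eq]

/-- Induction along the branch that agrees with the given action: at each node exactly the true
image of the chosen label under `x` is followed, the consistency checks cannot reject it, and the
labels stay distinct points, so neither `n` nor the budget is exceeded. -/
theorem search_sound [Finite X] {n budget : ℕ} {leaf : ℕ → ℕ → Bool} {allow : Bool} (hn : n ≤ 60)
    (hcard : Nat.card X = n) (hx : x ^ 2 = 1) (hy : y ^ 3 = 1) (hu : (y * x) ^ 7 = 1)
    (hconn : ∀ S : Set X, S.Nonempty → (∀ p ∈ S, x • p ∈ S ∧ y • p ∈ S) → S = Set.univ)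
    (hbudget : ∀ A B : Finset X, (∀ a ∈ A, x • a = a) → (∀ b ∈ B, y • b = b) →
      21 * A.card + 28 * B.card ≤ budget)
    (hallow : allow = false → ∀ p : X, (y * x) • p ≠ p) {P : Prop}
    (hleaf : ∀ (e : ℕ → X) (xt yt : ℕ), Labelled x y e n xt yt → (∀ p < n, get xt p ≠ 0) →
      leaf xt yt = true → P) (fuel : ℕ) :
    ∀ (k xt yt cost : ℕ) (e : ℕ → X), Labelled x y e k xt yt → 0 < k → Cost x y e k xt cost →
      search n leaf allow budget fuel k xt yt cost = true → P := by
  induction fuel with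
  | zero => intro k xt yt cost e _ _ _ hs; exact absurd hs Bool.false_ne_true
  | succ fuel ih =>
    intro k xt yt cost e h hk0 hcost hs
    obtain ⟨A, B, rfl, hA, hB⟩ := hcost
    have hkn : k ≤ n := hcard ▸ h.le_card
    have hb := hbudget A B (fun a ha => (hA a ha).1) (fun b hb => (hB b hb).1)
    rw [search_succ] at hs
    simp only [Nat.ble_eq_true_of_le hkn, Nat.ble_eq_true_of_le hb, cond_true] at hs
    cases hpick : Nat.beq (pick xt yt k) 1000000 with
    | true =>
      rw [hpick, cond_true] at hs
      cases hall : allBelow k fun p => cond (Nat.beq (get xt p) 0) false true with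
      | false => rw [hall, cond_false] at hs; exact absurd hs Bool.false_ne_true
      | true =>
        rw [hall, cond_true] at hs
        have hdef : ∀ p < k, get xt p ≠ 0 := by
          intro p hp hc
          have := allBelow_iff.mp hall p hp
          simp [hc] at this
        -- Without open labels the labelled points are closed under `x` and `y`; transitivity makes
        -- them everything.
        have huniv := hconn (e '' Set.Iio k) ⟨e 0, 0, hk0, rfl⟩ (by
          rintro _ ⟨p, hp, rfl⟩
          obtain ⟨q, hq⟩ := Nat.exists_eq_succ_of_ne_zero (hdef p hp)
          exact ⟨⟨q, h.x_lt p hp q hq, (h.x_eq p hp q hq).symm⟩,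
            ⟨_, h.y_lt p hp, (h.y_eq p hp).symm⟩⟩)
        have hkn' : k = n := by
          refine le_antisymm hkn ?_
          rw [← hcard, ← Set.ncard_univ, ← huniv]
          calc (e '' Set.Iio k).ncard ≤ (Set.Iio k).ncard := Set.ncard_image_le (Set.finite_Iio k)
            _ = k := by rw [← Finset.coe_Iio, Set.ncard_coe_finset]; simp
        subst hkn'
        rw [Nat.beq_refl, cond_true] at hs
        exact hleaf e xt yt h hdef hs
    | false =>
      rw [hpick, cond_false] at hs
      -- How the label is picked affects only the size of the search: that it is open and below `k`
      -- is checked afterwards.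
      generalize Nat.land (pick xt yt k) 63 = p at hs
      cases hp0 : Nat.beq (get xt p) 0 with
      | false => simp [hp0] at hs
      | true =>
      cases hpk : Nat.ble (p + 1) k with
      | false => simp [hp0, hpk] at hs
      | true =>
      simp only [hp0, hpk, cond_true] at hs
      replace hp0 : get xt p = 0 := Nat.eq_of_beq_eq_true hp0
      replace hpk : p < k := Nat.le_of_ble_eq_true hpk
      have hk60 : k ≤ 60 := hkn.trans hn
      have key : ∀ q < k, x • e p = e q →
          cond (Nat.beq (get xt q) 0)
            (cond (forth (joined xt p q) yt allow p 7 p)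
              (cond (forth (joined xt p q) yt allow q 7 q)
                (search n leaf allow budget fuel k (joined xt p q) yt
                  (cond (Nat.beq p q) (21 * A.card + 28 * B.card + 21) (21 * A.card + 28 * B.card)))
                true) true) true = true → P := by
        intro q hq hpq hbr
        have hq0 : get xt q = 0 := by
          by_contra hc
          obtain ⟨r, hr⟩ := Nat.exists_eq_succ_of_ne_zero hc
          have h1 := h.x_eq q hq r hr
          rw [← hpq, ← mul_smul, ← pow_two, hx, one_smul] at h1
          have h2 := h.inj _ hpk _ (h.x_lt q hq r hr) h1
          have h3 := h.x_symm q hq r hr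
          rw [← h2, hp0] at h3
          omega
        obtain ⟨hj, hget⟩ := h.join hx hk60 hpk hq hp0 hq0 hpq
        rw [hq0, hj.forth_spec hu hallow hpk 7 p hpk le_rfl (by simp) (by simp),
          hj.forth_spec hu hallow hq 7 q hq le_rfl (by simp) (by simp)] at hbr
        simp only [Nat.beq_refl, cond_true] at hbr
        refine ih _ _ _ _ e hj hk0 ?_ hbr
        have hA' : ∀ a ∈ A, x • a = a ∧ ∃ p' < k, get (joined xt p q) p' ≠ 0 ∧ e p' = a := by
          intro a ha
          obtain ⟨h1, p', h2, h3, h4⟩ := hA a ha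
          refine ⟨h1, p', h2, ?_, h4⟩
          rw [hget]; split_ifs <;> omega
        cases hpq' : Nat.beq p q with
        | false => exact ⟨A, B, rfl, hA', hB⟩
        | true =>
          have hpq'' : p = q := Nat.eq_of_beq_eq_true hpq'
          have hnot : e p ∉ A := by
            intro hc
            obtain ⟨-, p', h2, h3, h4⟩ := hA _ hc
            exact h3 (h.inj _ h2 _ hpk h4 ▸ hp0)
          refine ⟨A.cons (e p) hnot, B, by rw [cond_true, Finset.card_cons]; ring, ?_, hB⟩
          intro a ha
          rcases Finset.mem_cons.mp ha with rfl | ha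
          · refine ⟨by rw [hpq, hpq''], p, hpk, ?_, rfl⟩
            rw [hget, if_pos rfl]; omega
          · exact hA' a ha
      cases hr : Nat.ble 64 (back xt yt 6 p) with
      | false =>
        rw [hr, cond_false] at hs
        have hr' : back xt yt 6 p < 64 := by
          by_contra hc
          rw [Nat.ble_eq_true_of_le (not_lt.mp hc)] at hr
          exact absurd hr (by simp)
        obtain ⟨h1, h2⟩ := h.back_spec hx hy 6 p hpk hr'
        refine key _ (h.y_sq_lt h1) ?_ hs
        -- From `u ^ 6 • e r = e p` and `u ^ 7 = 1` one gets `u • e p = e r`, and so the image of `e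
        -- p` under `x` is `y⁻¹ • e r`.
        have h3 : (y * x) • e p = e (back xt yt 6 p) := by
          rw [← h2, ← mul_smul, ← pow_succ', hu, one_smul]
        rw [← h.y_sq h1, ← h3, mul_smul, ← mul_smul y y, ← mul_smul, ← pow_two, ← pow_succ, hy, one_smul]
      | true =>
        rw [hr, cond_true] at hs
        cases hall : allBelow k fun q => cond (Nat.beq (get xt q) 0)
            (cond (forth (joined xt p q) yt allow p 7 p)
              (cond (forth (joined xt p q) yt allow q 7 q)
                (search n leaf allow budget fuel k (joined xt p q) yt
                  (cond (Nat.beq p q) (21 * A.card + 28 * B.card + 21) (21 * A.card + 28 * B.card)))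
                true) true) true with
        | false => rw [hall, cond_false] at hs; exact absurd hs Bool.false_ne_true
        | true =>
        rw [hall, cond_true] at hs
        by_cases hz : ∃ q < k, x • e p = e q
        · obtain ⟨q, hq, hpq⟩ := hz
          exact key q hq hpq (allBelow_iff.mp hall q hq)
        push Not at hz
        by_cases hyz : y • x • e p = x • e p
        · obtain ⟨hj, hget⟩ := h.extend_fixed hx hk60 hpk hp0 rfl hz hyz
          cases hfirst : search n leaf allow budget fuel (k + 3) (put (put xt p (k + 1)) k (p + 1))
                      (put (put (put yt k (k + 1)) (k + 1) (k + 2)) (k + 2) k) (21 * A.card + 28 * B.card) with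
          | false => rw [hfirst, cond_false] at hs; exact absurd hs Bool.false_ne_true
          | true =>
          rw [hfirst, cond_true, hj.forth_spec hu hallow (by omega) 7 p (by omega) le_rfl (by simp) (by simp),
            cond_true] at hs
          refine ih _ _ _ _ _ hj (by omega) ?_ hs
          have hnot : x • e p ∉ B := by
            intro hc
            obtain ⟨-, p', h2, h3⟩ := hB _ hc
            exact hz p' h2 h3.symm
          refine ⟨A, B.cons _ hnot, by rw [Finset.card_cons]; ring, ?_, ?_⟩
          · intro a ha
            obtain ⟨h1, p', h2, h3, h4⟩ := hA a ha
            refine ⟨h1, p', by omega, ?_, by simp [h2, h4]⟩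
            rw [hget]; split_ifs <;> omega
          · intro b hb
            rcases Finset.mem_cons.mp hb with rfl | hb
            · exact ⟨hyz, k, by omega, by simp⟩
            · obtain ⟨h1, p', h2, h4⟩ := hB b hb
              exact ⟨h1, p', by omega, by simp [h2, h4]⟩
        · obtain ⟨hj, hget⟩ := h.extend_cycle hx hy hk60 hpk hp0 rfl hz hyz
          cases hfirst : search n leaf allow budget fuel (k + 3) (put (put xt p (k + 1)) k (p + 1))
                      (put (put (put yt k (k + 1)) (k + 1) (k + 2)) (k + 2) k) (21 * A.card + 28 * B.card) with
          | false => rw [hfirst, cond_false] at hs; exact absurd hs Bool.false_ne_true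
          | true =>
          refine ih _ _ _ _ _ hj (by omega) ⟨A, B, rfl, ?_, ?_⟩ hfirst
          · intro a ha
            obtain ⟨h1, p', h2, h3, h4⟩ := hA a ha
            refine ⟨h1, p', by omega, ?_, by simp [h2, h4]⟩
            rw [hget]; split_ifs <;> omega
          · intro b hb
            obtain ⟨h1, p', h2, h4⟩ := hB b hb
            exact ⟨h1, p', by omega, by simp [h2, h4]⟩

end CosetTable

/-! ### Soundness of the tests on complete tables -/

namespace CosetTable

variable {G X : Type*} [Group G] [MulAction G X] {x y : G}

theorem smul_mem_of_closure (hgen : Subgroup.closure {x, y} = (⊤ : Subgroup G)) (hx : x ^ 2 = 1)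
    (hy : y ^ 3 = 1) {S : Set X} (hS : ∀ p ∈ S, x • p ∈ S ∧ y • p ∈ S) (g : G) {p : X} (hp : p ∈ S) :
    g • p ∈ S := by
  have hg : g ∈ Subgroup.closure {x, y} := hgen ▸ Subgroup.mem_top g
  induction hg using Subgroup.closure_induction'' generalizing p with
  | mem g hg =>
    rcases hg with rfl | rfl
    exacts [(hS p hp).1, (hS p hp).2]
  | inv_mem g hg =>
    rcases hg with rfl | rfl
    · rw [show g⁻¹ = g by rw [inv_eq_iff_mul_eq_one, ← pow_two, hx]]
      exact (hS p hp).1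
    · rw [show g⁻¹ = g * g by rw [inv_eq_iff_mul_eq_one, ← pow_two, ← pow_succ', hy], mul_smul]
      exact (hS _ (hS p hp).2).2
  | one => rwa [one_smul]
  | mul g g' _ _ h1 h2 => rw [mul_smul]; exact h1 (h2 hp)

/-- The group element that a word stands for. -/
def wordElement (x y : G) : List Bool → G
  | [] => 1
  | true :: w => wordElement x y w * (y * x)
  | false :: w => wordElement x y w * (y⁻¹ * x)

namespace Labelled

variable {e : ℕ → X} {n xt yt : ℕ}

theorem x_smul (h : Labelled x y e n xt yt) (hdef : ∀ p < n, get xt p ≠ 0) {p : ℕ} (hp : p < n) :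
    Nat.pred (get xt p) < n ∧ x • e p = e (Nat.pred (get xt p)) := by
  obtain ⟨q, hq⟩ := Nat.exists_eq_succ_of_ne_zero (hdef p hp)
  rw [hq]
  exact ⟨h.x_lt p hp q hq, h.x_eq p hp q hq⟩

theorem walk_spec (h : Labelled x y e n xt yt) (hy : y ^ 3 = 1) (hdef : ∀ p < n, get xt p ≠ 0)
    (w : List Bool) : ∀ p < n, walk xt yt w p < n ∧ wordElement x y w • e p = e (walk xt yt w p) := by
  induction w with
  | nil => intro p hp; exact ⟨hp, one_smul _ _⟩
  | cons b w ih =>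
    intro p hp
    obtain ⟨h1, h2⟩ := h.x_smul hdef hp
    cases b with
    | true =>
      obtain ⟨h3, h4⟩ := ih _ (h.y_lt _ h1)
      refine ⟨h3, ?_⟩
      rw [wordElement, mul_smul, mul_smul, h2, h.y_eq _ h1, h4, walk]
    | false =>
      obtain ⟨h3, h4⟩ := ih _ (h.y_sq_lt h1)
      refine ⟨h3, ?_⟩
      have : y⁻¹ = y * y := by
        rw [inv_eq_iff_mul_eq_one, ← pow_two, ← pow_succ', hy]
      rw [wordElement, mul_smul, mul_smul, h2, this, mul_smul, h.y_sq h1, h4, walk]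

/-- The first return time `d` divides `N`: the power `N % d` of the word also fixes the point, and
it is less than `d`. -/
theorem badReturn_spec (h : Labelled x y e n xt yt) (hy : y ^ 3 = 1) (hdef : ∀ p < n, get xt p ≠ 0)
    {N : ℕ} {w : List Bool} (hN : wordElement x y w ^ N = 1) {p : ℕ} (hp : p < n) (i : ℕ) :
    ∀ j, ∀ r < n, wordElement x y w ^ j • e p = e r →
      (∀ m, 0 < m → m ≤ j → wordElement x y w ^ m • e p ≠ e p) →
      badReturn N xt yt w p i j r = false := by
  induction i with
  | zero => intros; rfl
  | succ i ih =>
    intro j r hr h1 h2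
    have hs : badReturn N xt yt w p (i + 1) j r = force (walk xt yt w r) fun s =>
      cond (Nat.beq s p) (cond (Nat.beq (Nat.mod N (Nat.succ j)) 0) false true)
        (badReturn N xt yt w p i (Nat.succ j) s) := rfl
    rw [hs, force_eq]
    obtain ⟨h3, h4⟩ := h.walk_spec hy hdef w r hr
    have h5 : wordElement x y w ^ (j + 1) • e p = e (walk xt yt w r) := by
      rw [pow_succ', mul_smul, h1, h4]
    cases hb : Nat.beq (walk xt yt w r) p with
    | true =>
      rw [Nat.eq_of_beq_eq_true hb] at h5
      have h6 : N % (j + 1) = 0 := by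
        by_contra hc
        have hlt := Nat.mod_lt N (Nat.succ_pos j)
        refine h2 _ (Nat.pos_of_ne_zero hc) (Nat.le_of_lt_succ hlt) ?_
        have h7 : (wordElement x y w ^ (j + 1)) ^ (N / (j + 1)) ∈ MulAction.stabilizer G (e p) :=
          pow_mem (show wordElement x y w ^ (j + 1) ∈ MulAction.stabilizer G (e p) from h5) _
        have h8 : wordElement x y w ^ N ∈ MulAction.stabilizer G (e p) := hN ▸ one_mem _
        rw [← pow_mul] at h7
        rw [← Nat.div_add_mod N (j + 1), pow_add] at h8
        exact (Subgroup.mul_mem_cancel_left _ h7).mp h8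
      have h6' : Nat.mod N (Nat.succ j) = 0 := h6
      rw [h6', cond_true, Nat.beq_refl, cond_true]
    | false =>
      rw [cond_false]
      refine ih _ _ h3 h5 fun m hm0 hm => ?_
      rcases Nat.le_succ_iff.mp hm with hm | rfl
      · exact h2 m hm0 hm
      · rw [h5]
        exact fun hc => Nat.ne_of_beq_eq_false hb (h.inj _ h3 _ hp hc)

theorem badWord_spec (h : Labelled x y e n xt yt) (hy : y ^ 3 = 1) (hdef : ∀ p < n, get xt p ≠ 0)
    {N : ℕ} (hN : ∀ g : G, g ^ N = 1) (w : List Bool) : badWord N n xt yt w = false := by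
  have : (allBelow n fun p => cond (badReturn N xt yt w p n 0 p) false true) = true := by
    rw [allBelow_iff]
    intro p hp
    rw [h.badReturn_spec hy hdef (hN _) hp n 0 p hp (by simp) (by omega), cond_false]
  rw [badWord, this, cond_true]

end Labelled

theorem mapDigits_spec {n : ℕ} {f : ℕ → ℕ} (hf : ∀ a < n, f a < n) (hn : 0 < n) (m : ℕ) :
    ∀ t, mapDigits n f m t < n ^ m ∧
      ∀ i < m, mapDigits n f m t / n ^ i % n = f (t / n ^ i % n) := by
  induction m with
  | zero => intro t; exact ⟨by simp [mapDigits], by omega⟩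
  | succ m ih =>
    intro t
    have hs : mapDigits n f (m + 1) t = f (t % n) + n * mapDigits n f m (t / n) := rfl
    obtain ⟨h1, h2⟩ := ih (t / n)
    have h3 := hf _ (Nat.mod_lt t hn)
    rw [hs]
    refine ⟨?_, ?_⟩
    · rw [pow_succ']
      calc f (t % n) + n * mapDigits n f m (t / n) < n + n * mapDigits n f m (t / n) := by omega
        _ = n * (mapDigits n f m (t / n) + 1) := by ring
        _ ≤ n * n ^ m := Nat.mul_le_mul_left _ h1
    · intro i hi
      cases i with
      | zero => simp [Nat.add_mul_mod_self_left, Nat.mod_eq_of_lt h3]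
      | succ i =>
        rw [pow_succ', ← Nat.div_div_eq_div_mul, ← Nat.div_div_eq_div_mul, Nat.add_mul_div_left _ _ hn,
          Nat.div_eq_of_lt h3, zero_add]
        exact h2 i (by omega)

theorem eq_of_digits_eq {n : ℕ} (m : ℕ) : ∀ t s, t < n ^ m → s < n ^ m →
    (∀ i < m, t / n ^ i % n = s / n ^ i % n) → t = s := by
  induction m with
  | zero => intro t s ht hs _; simp at ht hs; omega
  | succ m ih =>
    intro t s ht hs h
    have h0 := h 0 (by omega)
    simp only [pow_zero, Nat.div_one] at h0
    have h1 : t / n = s / n := by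
      refine ih _ _ (Nat.div_lt_of_lt_mul (by rwa [← pow_succ'])) (Nat.div_lt_of_lt_mul (by rwa [← pow_succ'])) ?_
      intro i hi
      have := h (i + 1) (by omega)
      rwa [pow_succ', ← Nat.div_div_eq_div_mul, ← Nat.div_div_eq_div_mul] at this
    rw [← Nat.div_add_mod t n, ← Nat.div_add_mod s n, h0, h1]

/-- Insertion adds one element. -/
def CodeSet.Lawful {V : Type} (S : CodeSet V) : Prop :=
  ∀ v t, ∃ v', (∀ s, S.mem v' s = true ↔ s = t ∨ S.mem v s = true) ∧
    ∀ {α : Type} (f : V → α), S.insert v t f = f v'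

theorem bitSet_mem (v t : ℕ) : bitSet.mem v t = v.testBit t := by
  have : bitSet.mem v t = Nat.beq ((v >>> t) &&& 1) 1 := rfl
  rw [this, Nat.testBit, Nat.and_comm, Nat.one_and_eq_mod_two]
  rcases Nat.mod_two_eq_zero_or_one (v >>> t) with h | h <;> rw [h] <;> rfl

theorem bitSet_lawful : bitSet.Lawful := by
  intro v t
  refine ⟨v ||| (1 <<< t), fun s => ?_, fun f => force_eq _ _⟩
  rw [bitSet_mem, bitSet_mem, Nat.testBit_or, Nat.one_shiftLeft, Nat.testBit_two_pow]
  rw [Bool.or_eq_true, decide_eq_true_iff, or_comm, eq_comm]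

theorem listSet_lawful : listSet.Lawful := by
  intro v t
  refine ⟨t :: v, fun s => ?_, fun f => rfl⟩
  have : listSet.mem (t :: v) s = cond (Nat.beq t s) true (listSet.mem v s) := rfl
  rw [this]
  cases h : Nat.beq t s with
  | true => simp [(Nat.eq_of_beq_eq_true h).symm]
  | false =>
    have h' : s ≠ t := fun hc => Nat.ne_of_beq_eq_false h hc.symm
    simp [h']

theorem visit_spec {V : Type} {S : CodeSet V} (hS : S.Lawful) {t : ℕ} {st : List ℕ} {v : V} {F : Finset ℕ}
    (hF : ∀ s, S.mem v s = true ↔ s ∈ F) :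
    ∃ (st' : List ℕ) (v' : V), (∀ k, visit S t st v F.card k = k st' v' (insert t F).card) ∧
      (∀ s, S.mem v' s = true ↔ s ∈ insert t F) ∧ ∀ s, s ∈ st' ↔ s ∈ st ∨ (s = t ∧ t ∉ F) := by
  by_cases ht : t ∈ F
  · refine ⟨st, v, fun k => ?_, by simpa [Finset.insert_eq_of_mem ht] using hF, by simp [ht]⟩
    rw [visit, (hF t).mpr ht, cond_true, Finset.insert_eq_of_mem ht]
  · obtain ⟨v', h1, h2⟩ := hS v t
    refine ⟨t :: st, v', fun k => ?_, fun s => by rw [h1, hF, Finset.mem_insert], by simp [ht, or_comm]⟩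
    have : S.mem v t = false := by
      rw [Bool.eq_false_iff, Ne, hF]; exact ht
    rw [visit, this, cond_false, h2, force_eq, Finset.card_insert_of_notMem ht]

/-- Invariant: `F` is the set of codes found, all in the orbit, and each of them off the stack has
both its images in `F`. When the stack is empty, `F` is closed under the generators and so is the
whole orbit. -/
theorem orbitCount_spec {T : Type*} {V : Type} [MulAction G T] [Finite T] (hgen : Subgroup.closure {x, y} = (⊤ : Subgroup G))
    (hx : x ^ 2 = 1) (hy : y ^ 3 = 1) {S : CodeSet V} (hS : S.Lawful) {d : ℕ → T} {M : ℕ}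
    (hd : ∀ s < M, ∀ t < M, d s = d t → s = t) {s₁ s₂ : ℕ → ℕ}
    (h₁ : ∀ t < M, s₁ t < M ∧ d (s₁ t) = x • d t) (h₂ : ∀ t < M, s₂ t < M ∧ d (s₂ t) = y • d t)
    {t₀ limit : ℕ} (fuel : ℕ) :
    ∀ (st : List ℕ) (v : V) (F : Finset ℕ), (∀ s, S.mem v s = true ↔ s ∈ F) →
      (∀ t ∈ F, t < M ∧ d t ∈ MulAction.orbit G (d t₀)) → (∀ t ∈ st, t ∈ F) →
      (∀ t ∈ F, t ∉ st → s₁ t ∈ F ∧ s₂ t ∈ F) → t₀ ∈ F →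
      (orbitCount S s₁ s₂ limit fuel st v F.card = 0 → limit < (MulAction.orbit G (d t₀)).ncard) ∧
      ∀ c, orbitCount S s₁ s₂ limit fuel st v F.card = c + 2 → (MulAction.orbit G (d t₀)).ncard = c := by
  induction fuel with
  | zero =>
    intro st v F _ _ _ _ _
    have : orbitCount S s₁ s₂ limit 0 st v F.card = 1 := rfl
    rw [this]
    exact ⟨fun h => absurd h one_ne_zero, fun c hc => by omega⟩
  | succ fuel ih =>
    intro st v F hF hval hst hcl h0
    have hs : orbitCount S s₁ s₂ limit (fuel + 1) st v F.card = cond (Nat.ble F.card limit)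
      (List.rec (Nat.add F.card 2) (fun t st' _ =>
        force (s₁ t) fun t₁ => force (s₂ t) fun t₂ =>
          visit S t₁ st' v F.card fun st₁ v₁ c₁ => visit S t₂ st₁ v₁ c₁ fun st₂ v₂ c₂ =>
            orbitCount S s₁ s₂ limit fuel st₂ v₂ c₂) st) 0 := rfl
    have hinj : Set.InjOn d F := fun a ha b hb hab => hd a (hval a ha).1 b (hval b hb).1 hab
    have hsub : d '' F ⊆ MulAction.orbit G (d t₀) := by
      rintro _ ⟨t, ht, rfl⟩; exact (hval t ht).2
    have hcard : (d '' (F : Set ℕ)).ncard = F.card := by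
      rw [hinj.ncard_image, Set.ncard_coe_finset]
    rw [hs]
    cases hb : Nat.ble F.card limit with
    | false =>
      have : limit < F.card := by
        by_contra hc
        rw [Nat.ble_eq_true_of_le (not_lt.mp hc)] at hb
        exact absurd hb (by simp)
      rw [cond_false]
      refine ⟨fun _ => this.trans_le ?_, fun c hc => by omega⟩
      rw [← hcard]
      exact Set.ncard_le_ncard hsub (Set.toFinite _)
    | true =>
      rw [cond_true]
      cases st with
      | nil =>
        change (F.card + 2 = 0 → _) ∧ ∀ c, F.card + 2 = c + 2 → _
        refine ⟨fun h => by omega, fun c hc => ?_⟩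
        have hc' : c = F.card := by omega
        rw [hc', ← hcard]
        congr 1
        refine Set.Subset.antisymm ?_ hsub
        have hxc : ∀ p ∈ d '' (F : Set ℕ), x • p ∈ d '' (F : Set ℕ) := by
          rintro _ ⟨t, ht, rfl⟩
          exact ⟨s₁ t, (hcl t ht (by simp)).1, (h₁ t (hval t ht).1).2⟩
        have hyc : ∀ p ∈ d '' (F : Set ℕ), y • p ∈ d '' (F : Set ℕ) := by
          rintro _ ⟨t, ht, rfl⟩
          exact ⟨s₂ t, (hcl t ht (by simp)).2, (h₂ t (hval t ht).1).2⟩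
        rintro _ ⟨g, rfl⟩
        exact smul_mem_of_closure hgen hx hy (S := d '' (F : Set ℕ)) (fun p hp => ⟨hxc p hp, hyc p hp⟩) g
          ⟨t₀, h0, rfl⟩
      | cons t st =>
        have hres : (List.rec (Nat.add F.card 2) (fun t st' _ =>
          force (s₁ t) fun t₁ => force (s₂ t) fun t₂ =>
            visit S t₁ st' v F.card fun st₁ v₁ c₁ => visit S t₂ st₁ v₁ c₁ fun st₂ v₂ c₂ =>
              orbitCount S s₁ s₂ limit fuel st₂ v₂ c₂) (t :: st) : ℕ) =
          force (s₁ t) fun t₁ => force (s₂ t) fun t₂ =>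
            visit S t₁ st v F.card fun st₁ v₁ c₁ => visit S t₂ st₁ v₁ c₁ fun st₂ v₂ c₂ =>
              orbitCount S s₁ s₂ limit fuel st₂ v₂ c₂ := rfl
        rw [hres, force_eq, force_eq]
        have htF := hst t (by simp)
        obtain ⟨hvt, hot⟩ := hval t htF
        obtain ⟨st₁, v₁, hv1, hF1, hst1⟩ := visit_spec hS (t := s₁ t) (st := st) hF
        obtain ⟨st₂, v₂, hv2, hF2, hst2⟩ := visit_spec hS (t := s₂ t) (st := st₁) hF1
        rw [hv1, hv2]
        refine ih st₂ v₂ _ hF2 ?_ ?_ ?_ ?_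
        · intro s hs
          rcases Finset.mem_insert.mp hs with rfl | hs
          · refine ⟨(h₂ t hvt).1, ?_⟩
            rw [(h₂ t hvt).2]
            exact MulAction.mem_orbit_of_mem_orbit y hot
          rcases Finset.mem_insert.mp hs with rfl | hs
          · refine ⟨(h₁ t hvt).1, ?_⟩
            rw [(h₁ t hvt).2]
            exact MulAction.mem_orbit_of_mem_orbit x hot
          · exact hval s hs
        · intro s hs
          rw [hst2, hst1] at hs
          rcases hs with (hs | ⟨rfl, -⟩) | ⟨rfl, -⟩
          · exact Finset.mem_insert_of_mem (Finset.mem_insert_of_mem (hst s (by simp [hs])))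
          · exact Finset.mem_insert_of_mem (Finset.mem_insert_self _ _)
          · exact Finset.mem_insert_self _ _
        · intro s hs hnot
          rw [hst2, hst1] at hnot
          by_cases hst' : s = t
          · subst hst'
            exact ⟨Finset.mem_insert_of_mem (Finset.mem_insert_self _ _), Finset.mem_insert_self _ _⟩
          have hsF : s ∈ F := by
            by_contra hc
            apply hnot
            rcases Finset.mem_insert.mp hs with h3 | h3
            · by_cases h4 : s₂ t ∈ insert (s₁ t) F
              · rw [← h3] at h4
                rcases Finset.mem_insert.mp h4 with h5 | h5
                · exact Or.inl (Or.inr ⟨h5, h5 ▸ hc⟩)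
                · exact absurd h5 hc
              · exact Or.inr ⟨h3, h4⟩
            · rcases Finset.mem_insert.mp h3 with h5 | h5
              · exact Or.inl (Or.inr ⟨h5, h5 ▸ hc⟩)
              · exact absurd h5 hc
          have := hcl s hsF (by
            intro hc
            rcases List.mem_cons.mp hc with hc | hc
            · exact hst' hc
            · exact hnot (Or.inl (Or.inl hc)))
          exact ⟨Finset.mem_insert_of_mem (Finset.mem_insert_of_mem this.1),
            Finset.mem_insert_of_mem (Finset.mem_insert_of_mem this.2)⟩
        · exact Finset.mem_insert_of_mem (Finset.mem_insert_of_mem h0)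

/-- The tuple of points with code `t`. -/
def tuple (e : ℕ → X) (n m t : ℕ) : Fin m → X := fun i => e (t / n ^ (i : ℕ) % n)

theorem fullCode_spec (n m : ℕ) : ∀ i, i + m ≤ n →
    fullCode n m i < n ^ m ∧ ∀ j < m, fullCode n m i / n ^ j % n = i + j := by
  induction m with
  | zero => intro i _; exact ⟨by simp [fullCode], by omega⟩
  | succ m ih =>
    intro i hi
    have hs : fullCode n (m + 1) i = i + n * fullCode n m (i + 1) := rfl
    obtain ⟨h1, h2⟩ := ih (i + 1) (by omega)
    have hin : i < n := by omega
    rw [hs]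
    refine ⟨?_, ?_⟩
    · rw [pow_succ']
      calc i + n * fullCode n m (i + 1) < n + n * fullCode n m (i + 1) := by omega
        _ = n * (fullCode n m (i + 1) + 1) := by ring
        _ ≤ n * n ^ m := Nat.mul_le_mul_left _ h1
    · intro j hj
      cases j with
      | zero => simp [Nat.add_mul_mod_self_left, Nat.mod_eq_of_lt hin]
      | succ j =>
        rw [pow_succ', ← Nat.div_div_eq_div_mul, Nat.add_mul_div_left _ _ (by omega),
          Nat.div_eq_of_lt hin, zero_add, h2 j (by omega)]
        omega

namespace Labelled

variable {e : ℕ → X} {n xt yt : ℕ}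

theorem tupleCount_spec [Finite X] (h : Labelled x y e n xt yt) (hn : 0 < n)
    (hgen : Subgroup.closure {x, y} = (⊤ : Subgroup G)) (hx : x ^ 2 = 1) (hy : y ^ 3 = 1)
    (hdef : ∀ p < n, get xt p ≠ 0) {V : Type} {S : CodeSet V} (hS : S.Lawful) {v : V}
    (hv : ∀ s, S.mem v s = false) {limit m t : ℕ} (ht : t < n ^ m) :
    (tupleCount S v n xt yt limit m t = 0 → limit < (MulAction.orbit G (tuple e n m t)).ncard) ∧
      ∀ c, tupleCount S v n xt yt limit m t = c + 2 →
        (MulAction.orbit G (tuple e n m t)).ncard = c := by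
  obtain ⟨v', hv1, hv2⟩ := hS v t
  have hs : tupleCount S v n xt yt limit m t =
      orbitCount S (mapDigits n (fun p => Nat.pred (get xt p)) m) (mapDigits n (get yt) m) limit
      (limit + 2) [t] v' ({t} : Finset ℕ).card := hv2 _
  rw [hs]
  have hmap : ∀ (g : G) (f : ℕ → ℕ), (∀ a < n, f a < n ∧ g • e a = e (f a)) → ∀ t < n ^ m,
      mapDigits n f m t < n ^ m ∧ tuple e n m (mapDigits n f m t) = g • tuple e n m t := by
    intro g f hf t _
    obtain ⟨h1, h2⟩ := mapDigits_spec (fun a ha => (hf a ha).1) hn m t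
    refine ⟨h1, funext fun i => ?_⟩
    rw [tuple, h2 i i.2, Pi.smul_apply, tuple, (hf _ (Nat.mod_lt _ hn)).2]
  refine orbitCount_spec hgen hx hy hS (d := tuple e n m) (M := n ^ m) ?_
    (hmap x _ fun a ha => h.x_smul hdef ha)
    (hmap y _ fun a ha => ⟨h.y_lt a ha, h.y_eq a ha⟩) _ _ _ _ ?_ ?_ ?_ ?_ (by simp)
  · intro s hs t ht hst
    refine eq_of_digits_eq m s t hs ht fun i hi => ?_
    exact h.inj _ (Nat.mod_lt _ hn) _ (Nat.mod_lt _ hn) (congrFun hst ⟨i, hi⟩)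
  · intro s; rw [hv1]; simp [hv]
  · intro s hs
    rw [Finset.mem_singleton.mp hs]
    exact ⟨ht, MulAction.mem_orbit_self _⟩
  · simp
  · simp

theorem badTuple_spec [Finite X] (h : Labelled x y e n xt yt) (hn : 0 < n)
    (hgen : Subgroup.closure {x, y} = (⊤ : Subgroup G)) (hx : x ^ 2 = 1) (hy : y ^ 3 = 1)
    (hdef : ∀ p < n, get xt p ≠ 0) {N : ℕ} (hN : Nat.card G = N) (hN0 : 0 < N) {t : ℕ} (ht : t < n ^ 3) :
    badTuple N n xt yt t = false := by
  have hbit : ∀ s, bitSet.mem 0 s = false := fun s => by rw [bitSet_mem]; simp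
  obtain ⟨h1, h2⟩ := h.tupleCount_spec hn hgen hx hy hdef bitSet_lawful hbit (limit := N) ht
  have hdvd : (MulAction.orbit G (tuple e n 3 t)).ncard ∣ N := by
    rw [← MulAction.index_stabilizer, ← hN]
    exact Subgroup.index_dvd_card _
  rw [badTuple, force_eq]
  generalize tupleCount bitSet 0 n xt yt N 3 t = r at h1 h2
  match r, h1, h2 with
  | 0, h1, _ => exact absurd (Nat.le_of_dvd hN0 hdvd) (not_le.mpr (h1 rfl))
  | 1, _, _ => rfl
  | c + 2, _, h2 =>
    have h3 : N % c = 0 := Nat.mod_eq_zero_of_dvd (h2 c rfl ▸ hdvd)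
    change cond (Nat.beq (N % c) 0) false true = false
    rw [h3, Nat.beq_refl, cond_true]

theorem smallImage_spec [Finite X] (h : Labelled x y e n xt yt) (hn : 0 < n) (hcard : Nat.card X = n)
    (hgen : Subgroup.closure {x, y} = (⊤ : Subgroup G)) (hx : x ^ 2 = 1) (hy : y ^ 3 = 1)
    (hdef : ∀ p < n, get xt p ≠ 0) (hs : smallImage n xt yt = true) :
    (MulAction.toPermHom G X).ker.index = 168 ∨ ((MulAction.toPermHom G X).ker.index = 504 ∧
      (y⁻¹ * x * (y * x)) ^ 9 ∈ (MulAction.toPermHom G X).ker ∧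
      (y⁻¹ * x * (y * x)) ^ 3 ∉ (MulAction.toPermHom G X).ker) := by
  obtain ⟨ht, hd⟩ := fullCode_spec n n 0 (by omega)
  obtain ⟨-, h2⟩ := h.tupleCount_spec hn hgen hx hy hdef listSet_lawful (v := [])
    (fun _ => rfl) (limit := 504) ht
  have hbij : Function.Bijective fun i : Fin n => e i := by
    rw [Nat.bijective_iff_injective_and_card, hcard, Nat.card_fin]
    exact ⟨fun i j hij => Fin.ext (h.inj _ i.2 _ j.2 hij), rfl⟩
  have htup : tuple e n n (fullCode n n 0) = fun i : Fin n => e i := by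
    funext i
    rw [tuple, hd i i.2, zero_add]
  -- The labels exhaust the points, so fixing the full tuple means acting trivially.
  have hker : MulAction.stabilizer G (tuple e n n (fullCode n n 0)) = (MulAction.toPermHom G X).ker := by
    ext g
    rw [MulAction.mem_stabilizer_iff, htup, MonoidHom.mem_ker, Equiv.ext_iff]
    refine ⟨fun hg p => ?_, fun hg => funext fun i => hg (e i)⟩
    obtain ⟨i, rfl⟩ := hbij.2 p
    exact congrFun hg i
  rw [← MulAction.index_stabilizer, hker] at h2
  rw [smallImage, force_eq, force_eq] at hs
  cases h170 : Nat.beq (tupleCount listSet [] n xt yt 504 n (fullCode n n 0)) 170 with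
  | true => exact Or.inl (h2 168 (Nat.eq_of_beq_eq_true h170))
  | false =>
  cases h506 : Nat.beq (tupleCount listSet [] n xt yt 504 n (fullCode n n 0)) 506 with
  | false => simp [h170, h506] at hs
  | true =>
  refine Or.inr ⟨h2 504 (Nat.eq_of_beq_eq_true h506), ?_⟩
  simp only [h170, h506, cond_true, cond_false] at hs
  cases h3 : allBelow n fun p => Nat.beq (walk xt yt [true, false, true, false, true, false] p) p with
  | true => simp [h3] at hs
  | false =>
  rw [h3, cond_false, allBelow_iff] at hs
  refine ⟨?_, fun hc => ?_⟩
  · rw [MonoidHom.mem_ker, Equiv.ext_iff]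
    intro p
    obtain ⟨i, rfl⟩ := hbij.2 p
    have h4 := (h.walk_spec hy hdef [true, false, true, false, true, false, true, false, true, false, true, false,
            true, false, true, false, true, false] i i.2).2
    rw [Nat.eq_of_beq_eq_true (hs i i.2)] at h4
    simpa [wordElement, pow_succ, mul_assoc] using h4
  · rw [Bool.eq_false_iff, Ne, allBelow_iff] at h3
    refine h3 fun p hp => ?_
    obtain ⟨h5, h4⟩ := h.walk_spec hy hdef [true, false, true, false, true, false] p hp
    have h6 : wordElement x y [true, false, true, false, true, false] = (y⁻¹ * x * (y * x)) ^ 3 := by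
      simp [wordElement, pow_succ, mul_assoc]
    rw [MonoidHom.mem_ker, Equiv.ext_iff] at hc
    rw [h6] at h4
    have h7 : e p = e (walk xt yt [true, false, true, false, true, false] p) := (hc (e p)).symm.trans h4
    rw [← h.inj _ hp _ h5 h7, Nat.beq_refl]

theorem leaf_spec [Finite X] (h : Labelled x y e n xt yt) (hn : 2 < n) (hcard : Nat.card X = n)
    (hgen : Subgroup.closure {x, y} = (⊤ : Subgroup G)) (hx : x ^ 2 = 1) (hy : y ^ 3 = 1)
    (hdef : ∀ p < n, get xt p ≠ 0) {N : ℕ} (hN : Nat.card G = N) (hN0 : 0 < N)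
    (hs : leaf N n xt yt = true) :
    (MulAction.toPermHom G X).ker.index = 168 ∨ ((MulAction.toPermHom G X).ker.index = 504 ∧
      (y⁻¹ * x * (y * x)) ^ 9 ∈ (MulAction.toPermHom G X).ker ∧
      (y⁻¹ * x * (y * x)) ^ 3 ∉ (MulAction.toPermHom G X).ker) := by
  have hpow : ∀ g : G, g ^ N = 1 := fun g => hN ▸ pow_card_eq_one'
  have h3 : n ^ 3 = n * n * n := by ring
  have hnn : 3 * (n * n) ≤ n * n * n := by nlinarith
  have hlt : 3 * n ≤ n * n := by nlinarith
  refine h.smallImage_spec (by omega) hcard hgen hx hy hdef ?_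
  rw [leaf, h.badWord_spec hy hdef hpow, h.badWord_spec hy hdef hpow, h.badWord_spec hy hdef hpow,
    force_eq, force_eq, h.badTuple_spec (by omega) hgen hx hy hdef hN hN0,
    h.badTuple_spec (by omega) hgen hx hy hdef hN hN0] at hs
  · exact hs
  · change n + 2 * (n * n) < n ^ 3; omega
  · change n + n * n < n ^ 3; omega

end Labelled

end CosetTable

/-! ### Hurwitz pairs and coprimality of 2, 3 and 7 -/

/-- A pair of elements satisfying the relations of the triangle group `(2,3,7)` and generating the
group. -/
structure IsHurwitzPair {G : Type*} [Group G] (x y : G) : Prop where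
  x_sq : x ^ 2 = 1
  y_cube : y ^ 3 = 1
  u_pow : (y * x) ^ 7 = 1
  gen : Subgroup.closure {x, y} = (⊤ : Subgroup G)

theorem eq_one_of_pow_eq_one_of_coprime {G : Type*} [Group G] {g : G} {m n : ℕ} (hm : g ^ m = 1)
    (hn : g ^ n = 1) (h : Nat.Coprime m n) : g = 1 := by
  rw [← orderOf_eq_one_iff, ← Nat.dvd_one, ← h]
  exact Nat.dvd_gcd (orderOf_dvd_of_pow_eq_one hm) (orderOf_dvd_of_pow_eq_one hn)

namespace IsHurwitzPair

variable {G H : Type*} [Group G] [Group H] {x y : G}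

theorem map (h : IsHurwitzPair x y) (f : G →* H) (hf : Function.Surjective f) :
    IsHurwitzPair (f x) (f y) where
  x_sq := by rw [← map_pow, h.x_sq, map_one]
  y_cube := by rw [← map_pow, h.y_cube, map_one]
  u_pow := by rw [← map_mul, ← map_pow, h.u_pow, map_one]
  gen := by
    rw [← Set.image_pair, ← MonoidHom.map_closure, h.gen, ← MonoidHom.range_eq_map,
      MonoidHom.range_eq_top.mpr hf]

theorem hom_ext_one (h : IsHurwitzPair x y) (f : G →* H) (hx : f x = 1) (hy : f y = 1) (g : G) :
    f g = 1 := by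
  have : Subgroup.closure {x, y} ≤ f.ker := by
    rw [Subgroup.closure_le]
    rintro g (rfl | rfl)
    exacts [hx, hy]
  exact this (h.gen ▸ Subgroup.mem_top g)

/-- Once one of `x`, `y`, `y * x` becomes trivial, the other two agree up to inversion and have
coprime orders. The same reason serves for `y` and for `y * x` below. -/
theorem hom_eq_one_of_x (h : IsHurwitzPair x y) (f : G →* H) (hx : f x = 1) (g : G) : f g = 1 := by
  refine h.hom_ext_one f hx (eq_one_of_pow_eq_one_of_coprime (m := 3) (n := 7) ?_ ?_ (by norm_num)) g
  · rw [← map_pow, h.y_cube, map_one]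
  · have := congrArg f h.u_pow
    rwa [map_pow, map_mul, hx, mul_one, map_one] at this

theorem hom_eq_one_of_y (h : IsHurwitzPair x y) (f : G →* H) (hy : f y = 1) (g : G) : f g = 1 := by
  refine h.hom_ext_one f (eq_one_of_pow_eq_one_of_coprime (m := 2) (n := 7) ?_ ?_ (by norm_num)) hy g
  · rw [← map_pow, h.x_sq, map_one]
  · have := congrArg f h.u_pow
    rwa [map_pow, map_mul, hy, one_mul, map_one] at this

theorem hom_eq_one_of_u (h : IsHurwitzPair x y) (f : G →* H) (hu : f (y * x) = 1) (g : G) :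
    f g = 1 := by
  refine h.hom_eq_one_of_y f (eq_one_of_pow_eq_one_of_coprime (m := 2) (n := 3) ?_ ?_ (by norm_num)) g
  · rw [map_mul, mul_eq_one_iff_eq_inv] at hu
    rw [hu, inv_pow, ← map_pow, h.x_sq, map_one, inv_one]
  · rw [← map_pow, h.y_cube, map_one]

theorem hom_eq_one_of_not_dvd [Finite H] (h : IsHurwitzPair x y) (f : G →* H)
    (h7 : ¬ 7 ∣ Nat.card H) (g : G) : f g = 1 := by
  refine h.hom_eq_one_of_u f (eq_one_of_pow_eq_one_of_coprime (m := 7) (n := Nat.card H) ?_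
    pow_card_eq_one' ((Nat.Prime.coprime_iff_not_dvd (by norm_num)).mpr h7)) g
  rw [← map_pow, h.u_pow, map_one]

/-- In a commutative group `(y * x) ^ 6 = 1`, besides `(y * x) ^ 7 = 1`. Hence `G` is perfect. -/
theorem hom_eq_one_of_comm (h : IsHurwitzPair x y) (f : G →* H) (hcomm : ∀ a b : H, a * b = b * a)
    (g : G) : f g = 1 := by
  refine h.hom_eq_one_of_u f (eq_one_of_pow_eq_one_of_coprime (m := 7) (n := 6) ?_ ?_ (by norm_num)) g
  · rw [← map_pow, h.u_pow, map_one]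
  · have hx := congrArg f h.x_sq
    have hy := congrArg f h.y_cube
    rw [map_pow, map_one] at hx hy
    rw [map_mul, (show Commute (f y) (f x) from hcomm _ _).mul_pow,
      show f y ^ 6 = (f y ^ 3) ^ 2 by rw [← pow_mul],
      show f x ^ 6 = (f x ^ 2) ^ 3 by rw [← pow_mul], hx, hy, one_pow, one_pow, one_mul]

theorem eq_top_of_mem (h : IsHurwitzPair x y) (K : Subgroup G) [K.Normal]
    (hK : x ∈ K ∨ y ∈ K ∨ y * x ∈ K) : K = ⊤ := by
  rw [eq_top_iff]
  intro g _
  rw [← QuotientGroup.eq_one_iff]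
  rcases hK with hK | hK | hK
  · exact h.hom_eq_one_of_x (QuotientGroup.mk' K) ((QuotientGroup.eq_one_iff _).mpr hK) g
  · exact h.hom_eq_one_of_y (QuotientGroup.mk' K) ((QuotientGroup.eq_one_iff _).mpr hK) g
  · exact h.hom_eq_one_of_u (QuotientGroup.mk' K) ((QuotientGroup.eq_one_iff _).mpr hK) g

/-- The centralizer of a normal subgroup is normal, and the only normal subgroup containing `y * x`
is the whole group. -/
theorem le_center_of_commute (h : IsHurwitzPair x y) (K : Subgroup G) [K.Normal]
    (hK : ∀ k ∈ K, Commute (y * x) k) : K ≤ Subgroup.center G := by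
  have : Subgroup.centralizer (K : Set G) = ⊤ := by
    refine h.eq_top_of_mem _ (Or.inr (Or.inr ?_))
    rw [Subgroup.mem_centralizer_iff]
    exact fun k hk => (hK k hk).symm
  exact Subgroup.centralizer_eq_top_iff_subset.mp this

section Action

variable {X : Type*} [MulAction G X]

theorem smul_eq_of_card_lt [Finite X] (h : IsHurwitzPair x y) (hX : Nat.card X < 7) (g : G) (p : X) :
    g • p = p := by
  have := h.hom_eq_one_of_not_dvd (MulAction.toPermHom G X) (by
    rw [Nat.card_perm, Nat.Prime.dvd_factorial (by norm_num)]; omega) g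
  exact Equiv.congr_fun this p

end Action

end IsHurwitzPair

/-! ### Orbit counts and the genus inequality -/

section Orbits

variable {G X : Type*} [Group G] [MulAction G X] [Finite X]

/-- Orbit counting for the cyclic group of `g`, of order 1 or `p`: every power of `g` fixes at least
the points that `g` fixes. -/
theorem card_add_le_mul_card_orbits (g : G) {p : ℕ} [Fact p.Prime] (hg : g ^ p = 1) :
    Nat.card X + (p - 1) * (MulAction.fixedBy X g).ncard ≤
      p * Nat.card (MulAction.orbitRel.Quotient (Subgroup.zpowers g) X) := by
  classical
  have := Fintype.ofFinite X
  have hfin : Finite (Subgroup.zpowers g) := by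
    refine Set.Finite.to_subtype (finite_zpowers.mpr ?_)
    exact isOfFinOrder_iff_pow_eq_one.mpr ⟨p, (Fact.out : p.Prime).pos, hg⟩
  have := Fintype.ofFinite (Subgroup.zpowers g)
  have := Fintype.ofFinite (MulAction.orbitRel.Quotient (Subgroup.zpowers g) X)
  have hb := MulAction.sum_card_fixedBy_eq_card_orbits_mul_card_group (Subgroup.zpowers g) X
  have hp : 1 ≤ p := (Fact.out : p.Prime).one_le
  have hfix : ∀ a : Subgroup.zpowers g,
      (MulAction.fixedBy X g).ncard ≤ Fintype.card (MulAction.fixedBy X a) := by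
    intro a
    rw [← Nat.card_eq_fintype_card, Nat.card_coe_set_eq]
    refine Set.ncard_le_ncard (fun q hq => ?_) (Set.toFinite _)
    have : Subgroup.zpowers g ≤ MulAction.stabilizer G q := by
      rw [Subgroup.zpowers_le]; exact hq
    exact this a.2
  have hone : Fintype.card (MulAction.fixedBy X (1 : Subgroup.zpowers g)) = Nat.card X := by
    rw [← Nat.card_eq_fintype_card, Nat.card_coe_set_eq,
      show MulAction.fixedBy X (1 : Subgroup.zpowers g) = Set.univ from
        Set.eq_univ_of_forall fun q => one_smul _ q, Set.ncard_univ]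
  have hle : (MulAction.fixedBy X g).ncard ≤ Nat.card X := hone ▸ hfix 1
  rw [← Finset.add_sum_erase _ _ (Finset.mem_univ 1), hone] at hb
  have hsum := Finset.card_nsmul_le_sum (Finset.univ.erase (1 : Subgroup.zpowers g))
    (fun a => Fintype.card (MulAction.fixedBy X a)) _ fun a _ => hfix a
  rw [Finset.card_erase_of_mem (Finset.mem_univ _), Finset.card_univ, smul_eq_mul] at hsum
  change _ = Fintype.card (MulAction.orbitRel.Quotient (Subgroup.zpowers g) X) * _ at hb
  rw [Nat.card_eq_fintype_card (α := MulAction.orbitRel.Quotient (Subgroup.zpowers g) X)]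
  have ho : Fintype.card (Subgroup.zpowers g) ∣ p := by
    rw [← Nat.card_eq_fintype_card, Nat.card_zpowers]; exact orderOf_dvd_of_pow_eq_one hg
  rcases (Nat.dvd_prime Fact.out).mp ho with ho | ho
  · rw [ho] at hb hsum
    obtain ⟨q, rfl⟩ := Nat.exists_eq_add_of_le' hp
    have h1 : Nat.card X ≤ Fintype.card (MulAction.orbitRel.Quotient (Subgroup.zpowers g) X) := by omega
    have h2 := Nat.mul_le_mul_left q (hle.trans h1)
    rw [Nat.add_sub_cancel, add_one_mul]
    omega
  · rw [ho] at hb hsum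
    rw [mul_comm p, ← hb]
    omega

end Orbits

section Permutation

open Module

variable {G X : Type*} [Group G] [MulAction G X]

/-- Composition with the action of a group element, on rational functions. -/
def shiftBy (g : G) : (X → ℚ) →ₗ[ℚ] (X → ℚ) := LinearMap.funLeft ℚ ℚ fun p => g • p

theorem shiftBy_apply (g : G) (f : X → ℚ) (p : X) : shiftBy g f p = f (g • p) := rfl

theorem sub_shiftBy_single [DecidableEq X] (g : G) (p : X) :
    (LinearMap.id - shiftBy g : (X → ℚ) →ₗ[ℚ] (X → ℚ)) (Pi.single (g • p) 1) =
      Pi.single (g • p) 1 - Pi.single p 1 := by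
  funext q
  rw [LinearMap.sub_apply, LinearMap.id_apply, Pi.sub_apply, Pi.sub_apply, shiftBy_apply]
  simp [Pi.single_apply]

/-- Functions that are constant on the orbits are invariant under the shift. -/
theorem card_orbits_le_finrank_ker [Finite X] (g : G) :
    Nat.card (MulAction.orbitRel.Quotient (Subgroup.zpowers g) X) ≤
      finrank ℚ (LinearMap.ker (LinearMap.id - shiftBy g : (X → ℚ) →ₗ[ℚ] (X → ℚ))) := by
  have := Fintype.ofFinite X
  have := Fintype.ofFinite (MulAction.orbitRel.Quotient (Subgroup.zpowers g) X)
  rw [Nat.card_eq_fintype_card, ← finrank_fintype_fun_eq_card ℚ]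
  let q : X → MulAction.orbitRel.Quotient (Subgroup.zpowers g) X := Quotient.mk _
  have hinj := LinearMap.funLeft_injective_of_surjective ℚ ℚ q Quotient.mk_surjective
  rw [← LinearMap.finrank_range_of_inj hinj]
  refine Submodule.finrank_mono ?_
  rintro _ ⟨f, rfl⟩
  rw [LinearMap.mem_ker]
  funext p
  have : q (g • p) = q p := Quotient.sound ⟨⟨g, Subgroup.mem_zpowers g⟩, rfl⟩
  simp [shiftBy_apply, LinearMap.funLeft_apply, this]

end Permutation

namespace IsHurwitzPair

open Module

variable {G X : Type*} [Group G] [MulAction G X] {x y : G}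

theorem eq_univ_of_closed (h : IsHurwitzPair x y) [MulAction.IsPretransitive G X] {S : Set X}
    (hne : S.Nonempty) (hS : ∀ p ∈ S, x • p ∈ S ∧ y • p ∈ S) : S = Set.univ := by
  obtain ⟨p, hp⟩ := hne
  refine Set.eq_univ_of_forall fun q => ?_
  obtain ⟨g, rfl⟩ := MulAction.exists_smul_eq G p q
  exact CosetTable.smul_mem_of_closure h.gen h.x_sq h.y_cube hS g hp

/-- The genus is not negative (Ree's inequality), by Scott's rank argument on `X → ℚ`. The images of
`1 - x` and `1 - y` together span at least a hyperplane, by transitivity. The functions invariant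
under `y * x` map to the intersection of these images with only constants in the kernel. The
dimension formula for sum and intersection gives the claim. -/
theorem card_orbits_le [Finite X] [MulAction.IsPretransitive G X] (h : IsHurwitzPair x y) [Nonempty X] :
    Nat.card (MulAction.orbitRel.Quotient (Subgroup.zpowers x) X) +
      Nat.card (MulAction.orbitRel.Quotient (Subgroup.zpowers y) X) +
      Nat.card (MulAction.orbitRel.Quotient (Subgroup.zpowers (y * x)) X) ≤ Nat.card X + 2 := by
  classical
  have := Fintype.ofFinite X
  obtain ⟨p₀⟩ := ‹Nonempty X›
  let V := X → ℚ
  let Tx : V →ₗ[ℚ] V := LinearMap.id - shiftBy x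
  let Ty : V →ₗ[ℚ] V := LinearMap.id - shiftBy y
  let Tu : V →ₗ[ℚ] V := LinearMap.id - shiftBy (y * x)
  have hV : finrank ℚ V = Nat.card X := by
    rw [Nat.card_eq_fintype_card]; exact finrank_fintype_fun_eq_card ℚ
  have h1 := card_orbits_le_finrank_ker (X := X) x
  have h2 := card_orbits_le_finrank_ker (X := X) y
  have h3 := card_orbits_le_finrank_ker (X := X) (y * x)
  have r1 := LinearMap.finrank_range_add_finrank_ker Tx
  have r2 := LinearMap.finrank_range_add_finrank_ker Ty
  have r4 := Submodule.finrank_sup_add_finrank_inf_eq (LinearMap.range Tx) (LinearMap.range Ty)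
  -- the sum of the two images is at most a hyperplane
  have r5 : finrank ℚ V ≤ finrank ℚ ↥(LinearMap.range Tx ⊔ LinearMap.range Ty) + 1 := by
    have htop : (LinearMap.range Tx ⊔ LinearMap.range Ty) ⊔ Submodule.span ℚ {(Pi.single p₀ 1 : V)} = ⊤ := by
      set W := (LinearMap.range Tx ⊔ LinearMap.range Ty) ⊔ Submodule.span ℚ {(Pi.single p₀ 1 : V)} with hW
      have key : {p : X | (Pi.single p 1 : V) ∈ W} = Set.univ := by
        refine h.eq_univ_of_closed ⟨p₀, ?_⟩ fun p hp => ⟨?_, ?_⟩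
        · exact Submodule.mem_sup_right (Submodule.mem_span_singleton_self _)
        · have : Tx (Pi.single (x • p) 1) ∈ W :=
            Submodule.mem_sup_left (Submodule.mem_sup_left ⟨_, rfl⟩)
          rw [show Tx (Pi.single (x • p) 1) = _ from sub_shiftBy_single x p] at this
          exact (Submodule.sub_mem_iff_left _ hp).mp this
        · have : Ty (Pi.single (y • p) 1) ∈ W :=
            Submodule.mem_sup_left (Submodule.mem_sup_right ⟨_, rfl⟩)
          rw [show Ty (Pi.single (y • p) 1) = _ from sub_shiftBy_single y p] at this
          exact (Submodule.sub_mem_iff_left _ hp).mp this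
      rw [eq_top_iff]
      intro f _
      rw [pi_eq_sum_univ' f]
      refine Submodule.sum_mem _ fun p _ => Submodule.smul_mem _ _ ?_
      have hp : p ∈ {p : X | (Pi.single p 1 : V) ∈ W} := key ▸ Set.mem_univ p
      convert (show (Pi.single p 1 : V) ∈ W from hp) using 1
    have := Submodule.finrank_add_le_finrank_add_finrank (LinearMap.range Tx ⊔ LinearMap.range Ty)
      (Submodule.span ℚ {(Pi.single p₀ 1 : V)})
    rw [htop, finrank_top] at this
    have hs : finrank ℚ (Submodule.span ℚ {(Pi.single p₀ 1 : V)}) = 1 :=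
      finrank_span_singleton (Pi.single_ne_zero_iff.mpr one_ne_zero)
    exact this.trans (Nat.add_le_add_left hs.le _)
  -- functions fixed by the product map into the intersection, with constant kernel
  have r6 : finrank ℚ (LinearMap.ker Tu) ≤ finrank ℚ ↥(LinearMap.range Tx ⊓ LinearMap.range Ty) + 1 := by
    have hmem : ∀ w ∈ LinearMap.ker Tu, (Tx ∘ₗ shiftBy y) w ∈ LinearMap.range Tx ⊓ LinearMap.range Ty := by
      intro w hw
      refine ⟨⟨shiftBy y w, rfl⟩, ⟨-w, ?_⟩⟩
      funext p
      have hp : w p - w ((y * x) • p) = 0 := congrFun hw p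
      change -w p - -w (y • p) = w (y • p) - w (y • x • p)
      rw [mul_smul] at hp
      linarith
    let F : LinearMap.ker Tu →ₗ[ℚ] ↥(LinearMap.range Tx ⊓ LinearMap.range Ty) :=
      (Tx ∘ₗ shiftBy y).restrict hmem
    have r7 := LinearMap.finrank_range_add_finrank_ker F
    have r8 : finrank ℚ (LinearMap.range F) ≤ _ := Submodule.finrank_le (LinearMap.range F)
    have r9 : finrank ℚ (LinearMap.ker F) ≤ 1 := by
      refine finrank_le_one (⟨⟨fun _ => 1, ?_⟩, ?_⟩ : LinearMap.ker F) ?_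
      · exact funext fun p => sub_self _
      · exact Subtype.ext (funext fun p => sub_self _)
      · rintro ⟨⟨w, hw⟩, hF⟩
        have hF' : ∀ p, w (y • p) - w (y • x • p) = 0 := fun p => congrFun (congrArg Subtype.val hF) p
        have hw' : ∀ p, w p - w ((y * x) • p) = 0 := fun p => congrFun hw p
        have hy : ∀ p, w (y • p) = w p := fun p => by
          have a := hF' p; have b := hw' p
          rw [mul_smul] at b
          linarith
        have hx : ∀ p, w (x • p) = w p := fun p => by
          have a := hF' p
          rw [hy, hy] at a
          linarith
        have hc : {p | w p = w p₀} = Set.univ := h.eq_univ_of_closed ⟨p₀, rfl⟩ fun p hp =>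
          ⟨(hx p).trans hp, (hy p).trans hp⟩
        refine ⟨w p₀, Subtype.ext (Subtype.ext (funext fun p => ?_))⟩
        have hp : p ∈ {p | w p = w p₀} := hc ▸ Set.mem_univ p
        exact (mul_one _).trans (Eq.symm hp)
    omega
  change _ ≤ finrank ℚ (LinearMap.ker Tx) at h1
  change _ ≤ finrank ℚ (LinearMap.ker Ty) at h2
  change _ ≤ finrank ℚ (LinearMap.ker Tu) at h3
  omega

/-- Multiply `card_orbits_le` by 42 and insert the orbit counts: `21 + 14 + 6 = 41`, so a single
`Nat.card X` remains on the right. -/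
theorem fixedBy_bound [Finite X] [Nonempty X] [MulAction.IsPretransitive G X] (h : IsHurwitzPair x y) :
    21 * (MulAction.fixedBy X x).ncard + 28 * (MulAction.fixedBy X y).ncard +
      36 * (MulAction.fixedBy X (y * x)).ncard ≤ Nat.card X + 84 := by
  have : Fact (Nat.Prime 3) := ⟨by norm_num⟩
  have : Fact (Nat.Prime 7) := ⟨by norm_num⟩
  have h1 := card_add_le_mul_card_orbits (X := X) x (p := 2) h.x_sq
  have h2 := card_add_le_mul_card_orbits (X := X) y (p := 3) h.y_cube
  have h3 := card_add_le_mul_card_orbits (X := X) (y * x) (p := 7) h.u_pow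
  have h4 := h.card_orbits_le (X := X)
  omega

end IsHurwitzPair

theorem card_modEq_fixedBy {G X : Type*} [Group G] [MulAction G X] [Finite X] (g : G) {p : ℕ}
    [Fact p.Prime] (hg : g ^ p = 1) : Nat.card X ≡ (MulAction.fixedBy X g).ncard [MOD p] := by
  have hp : IsPGroup p (Subgroup.zpowers g) := by
    rintro ⟨a, ha⟩
    obtain ⟨k, rfl⟩ := ha
    refine ⟨1, Subtype.ext ?_⟩
    simp only [pow_one, Subgroup.coe_pow, Subgroup.coe_one]
    rw [← zpow_natCast, ← zpow_mul, mul_comm, zpow_mul, zpow_natCast, hg, one_zpow]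
  have := hp.card_modEq_card_fixedPoints X
  convert this using 1
  rw [← Nat.card_coe_set_eq]
  congr 2
  ext q
  refine ⟨fun hq a => ?_, fun hq => hq ⟨g, Subgroup.mem_zpowers g⟩⟩
  have : Subgroup.zpowers g ≤ MulAction.stabilizer G q := by
    rw [Subgroup.zpowers_le]; exact hq
  exact this a.2

/-- The index of `K` is 168, or it is 504 and the image of `y⁻¹ x y x` modulo `K` has order nine. -/
def HasSmallIndex {G : Type*} [Group G] (x y : G) (K : Subgroup G) : Prop :=
  K.index = 168 ∨ (K.index = 504 ∧ (y⁻¹ * x * (y * x)) ^ 9 ∈ K ∧ (y⁻¹ * x * (y * x)) ^ 3 ∉ K)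

/-! ### Starting the search at a fixed point -/

namespace CosetTable

variable {G X : Type*} [Group G] [MulAction G X] {x y : G}

theorem get_zero (p : ℕ) : get 0 p = 0 := by
  have h : get 0 p = (0 >>> (6 * p)) &&& 63 := rfl
  rw [h, Nat.zero_shiftRight, Nat.zero_and]

theorem labelled_of_y_fixed {p₀ : X} (hp : y • p₀ = p₀) : Labelled x y (fun _ => p₀) 1 0 0 where
  inj i hi j hj _ := by omega
  y_lt p _ := by rw [get_zero]; exact one_pos
  y_eq _ _ := hp
  x_lt p _ q hq := by rw [get_zero] at hq; omega
  x_eq p _ q hq := by rw [get_zero] at hq; omega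
  x_symm p _ q hq := by rw [get_zero] at hq; omega
  x_empty p _ := get_zero p
  y_empty p _ := get_zero p

theorem get_eq_zero_of_lt {t i : ℕ} (h : t < 2 ^ (6 * i)) : get t i = 0 := by
  have hs : get t i = (t >>> (6 * i)) &&& 63 := rfl
  rw [hs, Nat.shiftRight_eq_div_pow, Nat.div_eq_of_lt h, Nat.zero_and]

theorem labelled_of_x_fixed {e : ℕ → X} (h0 : x • e 0 = e 0) (h1 : y • e 0 = e 1) (h2 : y • e 1 = e 2)
    (h3 : y • e 2 = e 0) (h01 : e 0 ≠ e 1) : Labelled x y e 3 1 129 := by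
  have h12 : e 1 ≠ e 2 := by rw [← h1, ← h2]; exact fun h => h01 (smul_left_cancel y h)
  have h20 : e 2 ≠ e 0 := fun h => h12 (smul_left_cancel y (h2.trans (h.trans h3.symm)))
  have hx : ∀ p q, get 1 p = q + 1 → p = 0 ∧ q = 0 := by
    intro p q hq
    rcases Nat.eq_zero_or_pos p with rfl | hp
    · have : get 1 0 = 1 := rfl
      omega
    · rw [get_eq_zero_of_lt (Nat.one_lt_two_pow (by omega))] at hq
      omega
  refine ⟨?_, ?_, ?_, ?_, ?_, ?_, ?_, ?_⟩
  · intro i hi j hj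
    interval_cases i <;> interval_cases j <;> simp [h01, h12, h20, h01.symm, h12.symm, h20.symm]
  · intro p hp
    interval_cases p <;> decide
  · intro p hp
    interval_cases p
    exacts [h1, h2, h3]
  · intro p hp q hq
    obtain ⟨rfl, rfl⟩ := hx p q hq
    norm_num
  · intro p hp q hq
    obtain ⟨rfl, rfl⟩ := hx p q hq
    exact h0
  · intro p hp q hq
    obtain ⟨rfl, rfl⟩ := hx p q hq
    rfl
  · intro p hp
    exact get_eq_zero_of_lt (Nat.one_lt_two_pow (by omega))
  · intro p hp
    exact get_eq_zero_of_lt (lt_of_lt_of_le (show 129 < 2 ^ 18 by norm_num)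
      (Nat.pow_le_pow_right (by norm_num) (by omega)))

end CosetTable

namespace IsHurwitzPair

open CosetTable

variable {G X : Type*} [Group G] [MulAction G X] {x y : G}

theorem mod_seven_le (h : IsHurwitzPair x y) [Finite X] :
    Nat.card X % 7 ≤ (MulAction.fixedBy X (y * x)).ncard := by
  have : Fact (Nat.Prime 7) := ⟨by norm_num⟩
  have h7 := card_modEq_fixedBy (X := X) (y * x) (p := 7) h.u_pow
  rw [h7]
  exact Nat.mod_le _ _

/-- The number of fixed points of `y * x` is a multiple of seven, and seven of them would weigh `36
* 7 = 252`, more than `60 + 84`. -/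
theorem not_fixed_of_dvd (h : IsHurwitzPair x y) [Finite X] [MulAction.IsPretransitive G X]
    (h7 : 7 ∣ Nat.card X) (hle : Nat.card X ≤ 60) (p : X) : (y * x) • p ≠ p := by
  intro hp
  have : Nonempty X := ⟨p⟩
  have : Fact (Nat.Prime 7) := ⟨by norm_num⟩
  have h1 := card_modEq_fixedBy (X := X) (y * x) (p := 7) h.u_pow
  have h2 := h.fixedBy_bound (X := X)
  have h3 : 0 < (MulAction.fixedBy X (y * x)).ncard := (Set.ncard_pos (Set.toFinite _)).mpr ⟨p, hp⟩
  have h4 : 7 ∣ (MulAction.fixedBy X (y * x)).ncard := (h1.dvd_iff dvd_rfl).mp h7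
  have h5 := Nat.le_of_dvd h3 h4
  omega

theorem budget (h : IsHurwitzPair x y) [Finite X] [Nonempty X] [MulAction.IsPretransitive G X] {n : ℕ}
    (hcard : Nat.card X = n) (A B : Finset X) (hA : ∀ a ∈ A, x • a = a) (hB : ∀ b ∈ B, y • b = b) :
    21 * A.card + 28 * B.card ≤ n + 84 - 36 * (n % 7) := by
  have h1 := h.fixedBy_bound (X := X)
  have h2 := h.mod_seven_le (X := X)
  have h3 : A.card ≤ (MulAction.fixedBy X x).ncard := by
    rw [← Set.ncard_coe_finset]
    exact Set.ncard_le_ncard hA (Set.toFinite _)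
  have h4 : B.card ≤ (MulAction.fixedBy X y).ncard := by
    rw [← Set.ncard_coe_finset]
    exact Set.ncard_le_ncard hB (Set.toFinite _)
  rw [hcard] at h1 h2
  omega

theorem hasSmallIndex_ker_of_search [Finite G] (h : IsHurwitzPair x y) [Finite X] [Nonempty X]
    [MulAction.IsPretransitive G X] {N n : ℕ} {allow : Bool} (hG : Nat.card G = N)
    (hcard : Nat.card X = n) (hn : 2 < n) (hn' : n ≤ 60) (h7 : allow = false → 7 ∣ n)
    {k xt yt cost : ℕ} {e : ℕ → X} (hl : Labelled x y e k xt yt) (hk : 0 < k)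
    (hc : Cost x y e k xt cost)
    (hs : search n (leaf N n) allow (n + 84 - 36 * (n % 7)) (2 * n) k xt yt cost = true) :
    HasSmallIndex x y (MulAction.toPermHom G X).ker :=
  search_sound hn' hcard h.x_sq h.y_cube h.u_pow (fun _ hne hS => h.eq_univ_of_closed hne hS)
    (h.budget hcard) (fun ha => h.not_fixed_of_dvd (hcard ▸ h7 ha) (hcard ▸ hn'))
    (fun _ _ _ hl hdef hleaf => hl.leaf_spec hn hcard h.gen h.x_sq h.y_cube hdef hG
      (hG ▸ Nat.card_pos) hleaf) _ _ _ _ _ _ hl hk hc hs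

theorem hasSmallIndex_normalCore_of_searchFromY [Finite G] (h : IsHurwitzPair x y) {N n : ℕ}
    {allow : Bool} (hG : Nat.card G = N) (H : Subgroup G) (hH : H.index = n) (hn : 2 < n) (hn' : n ≤ 60)
    (h7 : allow = false → 7 ∣ n) (h3 : ¬ 3 ∣ n) (hs : searchFromY N n allow = true) :
    HasSmallIndex x y H.normalCore := by
  have hcard : Nat.card (G ⧸ H) = n := hH
  have : Fact (Nat.Prime 3) := ⟨by norm_num⟩
  have hmod := card_modEq_fixedBy (X := G ⧸ H) y (p := 3) h.y_cube
  -- The degree is prime to 3, so `y` has a fixed point.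
  have hpos : (MulAction.fixedBy (G ⧸ H) y).ncard ≠ 0 := by
    intro h0
    rw [h0, hcard] at hmod
    exact h3 (Nat.modEq_zero_iff_dvd.mp hmod)
  obtain ⟨p, hp⟩ := Set.nonempty_of_ncard_ne_zero hpos
  rw [Subgroup.normalCore_eq_ker]
  exact h.hasSmallIndex_ker_of_search hG hcard hn hn' h7 (labelled_of_y_fixed (x := x) hp) one_pos
    ⟨∅, {p}, rfl, by simp, by simpa using hp⟩ hs

theorem hasSmallIndex_normalCore_of_searchFromX [Finite G] (h : IsHurwitzPair x y) {N n : ℕ}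
    {allow : Bool} (hG : Nat.card G = N) (H : Subgroup G) (hH : H.index = n) (hn : 2 < n) (hn' : n ≤ 60)
    (h7 : allow = false → 7 ∣ n) (h2 : ¬ 2 ∣ n) (hs : searchFromX N n allow = true) :
    HasSmallIndex x y H.normalCore := by
  have hcard : Nat.card (G ⧸ H) = n := hH
  have : Fact (Nat.Prime 2) := ⟨by norm_num⟩
  have hmod := card_modEq_fixedBy (X := G ⧸ H) x (p := 2) h.x_sq
  have hpos : (MulAction.fixedBy (G ⧸ H) x).ncard ≠ 0 := by
    intro h0
    rw [h0, hcard] at hmod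
    exact h2 (Nat.modEq_zero_iff_dvd.mp hmod)
  obtain ⟨p, hp⟩ := Set.nonempty_of_ncard_ne_zero hpos
  -- A point fixed by both generators would be the whole set.
  have hyp : p ≠ y • p := by
    intro hy
    have huniv : {p} = Set.univ := h.eq_univ_of_closed (S := {p}) ⟨p, rfl⟩ (by
      rintro _ rfl
      exact ⟨hp, hy.symm⟩)
    have : Nat.card (G ⧸ H) = 1 := by
      rw [← Set.ncard_univ, ← huniv, Set.ncard_singleton]
    omega
  rw [Subgroup.normalCore_eq_ker]
  refine h.hasSmallIndex_ker_of_search hG hcard hn hn' h7 (e := fun i => y ^ i • p)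
    (labelled_of_x_fixed ?_ ?_ ?_ ?_ ?_) (by norm_num) ⟨{p}, ∅, rfl, ?_, by simp⟩ hs
  · rw [pow_zero, one_smul]; exact hp
  · rw [pow_zero, pow_one, one_smul]
  · rw [pow_one, smul_smul, pow_two]
  · rw [smul_smul, ← pow_succ', h.y_cube, pow_zero]
  · rw [pow_zero, pow_one, one_smul]; exact hyp
  · intro a ha
    rw [Finset.mem_singleton.mp ha]
    exact ⟨hp, 0, by norm_num, by decide, by simp⟩

/-- The number of points of a transitive action is bounded by its fixed points. -/
theorem index_bound (h : IsHurwitzPair x y) [Finite G] (H : Subgroup G) :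
    21 * (H.index % 2) + 28 * (H.index % 3) + 36 * (H.index % 7) ≤ H.index + 84 := by
  have h1 := h.fixedBy_bound (X := G ⧸ H)
  have h2 := h.mod_seven_le (X := G ⧸ H)
  have : Fact (Nat.Prime 2) := ⟨by norm_num⟩
  have : Fact (Nat.Prime 3) := ⟨by norm_num⟩
  have h3 : Nat.card (G ⧸ H) % 2 = _ := card_modEq_fixedBy (X := G ⧸ H) x (p := 2) h.x_sq
  have h4 : Nat.card (G ⧸ H) % 3 = _ := card_modEq_fixedBy (X := G ⧸ H) y (p := 3) h.y_cube
  rw [show Nat.card (G ⧸ H) = H.index from rfl] at h1 h2 h3 h4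
  omega

end IsHurwitzPair


/-! ### Evaluation of the searches -/

namespace CosetTable

set_option maxRecDepth 100000

/-- The degrees in this list are those needed later that `index_bound` does not exclude. The flag is
`false` where 7 divides the degree, since `y * x` then has no fixed points. -/
theorem searchFromY_2520_7 : searchFromY 2520 7 false = true := by decide +kernel
theorem searchFromY_2520_8 : searchFromY 2520 8 true = true := by decide +kernel
theorem searchFromY_2520_14 : searchFromY 2520 14 false = true := by decide +kernel
theorem searchFromY_2520_28 : searchFromY 2520 28 false = true := by decide +kernel
theorem searchFromY_2520_35 : searchFromY 2520 35 false = true := by decide +kernel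
theorem searchFromY_6048_7 : searchFromY 6048 7 false = true := by decide +kernel
theorem searchFromY_6048_8 : searchFromY 6048 8 true = true := by decide +kernel
theorem searchFromY_6048_14 : searchFromY 6048 14 false = true := by decide +kernel
theorem searchFromY_6048_16 : searchFromY 6048 16 true = true := by decide +kernel
theorem searchFromY_6048_28 : searchFromY 6048 28 false = true := by decide +kernel
theorem searchFromY_2688_16 : searchFromY 2688 16 true = true := by decide +kernel
theorem searchFromX_2688_21 : searchFromX 2688 21 false = true := by decide +kernel

end CosetTable

/-! ### Central subgroups, transfer and Sylow subgroups -/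

section

open scoped Pointwise

namespace IsHurwitzPair

variable {G : Type*} [Group G] {x y : G}

variable [Finite G]

/-- A normal subgroup is central when the action of `y * x` can only fix a proper subgroup trivially. -/
theorem le_center_of_card (h : IsHurwitzPair x y) (R : Subgroup G) [R.Normal]
    (hR : ∀ d ∈ (Nat.card R).divisors, d % 7 = Nat.card R % 7 → d = Nat.card R) :
    R ≤ Subgroup.center G := by
  have : Fact (Nat.Prime 7) := ⟨by norm_num⟩
  refine h.le_center_of_commute R ?_
  let f : G →* MulAut R := MulAut.conjNormal
  have h1 := card_modEq_fixedBy (X := R) (f (y * x)) (p := 7) (by rw [← map_pow, h.u_pow, map_one])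
  -- The elements of `R` that commute with `y * x` form a subgroup; its order divides that of `R`
  -- and is congruent to it modulo 7.
  let C : Subgroup R := (Subgroup.centralizer {y * x}).subgroupOf R
  have hC : MulAction.fixedBy R (f (y * x)) = C := by
    ext r
    rw [MulAction.mem_fixedBy, SetLike.mem_coe, Subgroup.mem_subgroupOf, Subgroup.mem_centralizer_singleton_iff,
      Subtype.ext_iff, MulAut.smul_def, MulAut.conjNormal_apply, mul_inv_eq_iff_eq_mul]
    exact eq_comm
  have h2 : (MulAction.fixedBy R (f (y * x))).ncard = Nat.card C := by
    rw [hC, ← Nat.card_coe_set_eq]; rfl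
  rw [h2] at h1
  have h3 := hR _ (Nat.mem_divisors.mpr ⟨Subgroup.card_subgroup_dvd_card C, Nat.card_pos.ne'⟩) h1.symm
  have h4 : C = ⊤ := Subgroup.eq_top_of_card_eq _ h3
  intro k hk
  have h5 : (⟨k, hk⟩ : R) ∈ C := h4 ▸ Subgroup.mem_top _
  rw [Subgroup.mem_subgroupOf, Subgroup.mem_centralizer_singleton_iff] at h5
  exact h5.symm

variable {p : ℕ}

/-- A perfect group has no central elements in an abelian Sylow subgroup. -/
theorem eq_bot_of_le_center [Fact p.Prime] (h : IsHurwitzPair x y) (P : Sylow p G) (hP : ∀ a ∈ P, ∀ b ∈ P, a * b = b * a)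
    {D : Subgroup G} (hDP : D ≤ P) (hD : D ≤ Subgroup.center G) : D = ⊥ := by
  let _ : CommGroup P := { mul_comm := fun a b => Subtype.ext (hP a a.2 b b.2) }
  rw [eq_bot_iff]
  intro d hd
  -- The transfer into `P` is trivial because `G` is perfect, but on a central `d` it is the power
  -- with exponent the index of `P`, which is prime to `p`.
  let f : G →* P := MonoidHom.transfer (MonoidHom.id P)
  have h1 : f d = 1 := h.hom_eq_one_of_comm f mul_comm d
  have hcomm : ∀ g : G, g⁻¹ * d * g = d := fun g => by
    rw [mul_assoc, ← Subgroup.mem_center_iff.mp (hD hd) g, inv_mul_cancel_left]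
  have hcomm' : ∀ (k : ℕ) (g : G), g⁻¹ * d ^ k * g = d ^ k := fun k g => by
    rw [mul_assoc, ← Subgroup.mem_center_iff.mp (pow_mem (hD hd) k) g, inv_mul_cancel_left]
  have h2 := MonoidHom.transfer_eq_pow (MonoidHom.id P) d fun k g _ => hcomm' k g
  rw [show MonoidHom.transfer (MonoidHom.id P) d = f d from rfl, h1] at h2
  have h3 : d ^ (P : Subgroup G).index = 1 := (congrArg Subtype.val h2).symm
  obtain ⟨k, hk⟩ := P.2 ⟨d, hDP hd⟩
  have h4 : d ^ p ^ k = 1 := congrArg Subtype.val hk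
  exact eq_one_of_pow_eq_one_of_coprime h4 h3
    (Nat.Coprime.pow_left _ ((Nat.Prime.coprime_iff_not_dvd Fact.out).mpr P.not_dvd_index))

/-- A perfect group has no abelian Sylow subgroup that is its own normalizer. -/
theorem ne_normalizer [Fact p.Prime] (h : IsHurwitzPair x y) (P : Sylow p G) (hP : ∀ a ∈ P, ∀ b ∈ P, a * b = b * a)
    (hne : (P : Subgroup G) ≠ ⊥) : Subgroup.normalizer (P : Set G) ≠ P := by
  intro hN
  have hle : Subgroup.normalizer (P : Set G) ≤ Subgroup.centralizer (P : Set G) := by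
    rw [hN]
    intro a ha
    rw [Subgroup.mem_centralizer_iff]
    exact fun b hb => hP b hb a ha
  have : IsMulCommutative P := ⟨⟨fun a b => Subtype.ext (hP a a.2 b b.2)⟩⟩
  -- By Burnside, the kernel of the transfer is a complement of `P`; but this kernel is all of `G`.
  have h1 := MonoidHom.ker_transferSylow_isComplement' P hle
  have h2 : (MonoidHom.transferSylow P hle).ker = ⊤ := by
    rw [eq_top_iff]
    intro g _
    exact h.hom_eq_one_of_comm (MonoidHom.transferSylow P hle)
      (fun a b => Subtype.ext (hP a a.2 b b.2)) g
  rw [h2] at h1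
  exact hne (Subgroup.isComplement'_top_left.mp h1)

/-- A Sylow subgroup of a normal subgroup `K` is normal in the whole group when `K` has at most six of
them. -/
theorem normal_map_sylow (h : IsHurwitzPair x y) (K : Subgroup G) [K.Normal]
    (hK : Nat.card (Sylow p K) < 7) (R : Sylow p K) : ((R : Subgroup K).map K.subtype).Normal := by
  let _ : MulAction G (Sylow p K) := MulAction.compHom _ (MulAut.conjNormal : G →* MulAut K)
  refine ⟨?_⟩
  rintro _ ⟨r, hr, rfl⟩ g
  -- Conjugation is an action of `G` on fewer than seven points.
  have h1 : (MulAut.conjNormal g : MulAut K) • R = R := h.smul_eq_of_card_lt hK g R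
  refine ⟨MulAut.conjNormal g r, ?_, MulAut.conjNormal_apply g r⟩
  have h2 : (MulAut.conjNormal g : MulAut K) • r ∈ (MulAut.conjNormal g : MulAut K) • (R : Subgroup K) :=
    Subgroup.smul_mem_pointwise_smul _ _ _ hr
  rw [← Sylow.pointwise_smul_def, h1] at h2
  exact h2

end IsHurwitzPair

section Sylow

variable {G : Type*} [Group G] {p : ℕ}

theorem Sylow.eq_of_le {P Q : Sylow p G} (h : (P : Subgroup G) ≤ Q) : P = Q :=
  Sylow.ext (P.3 Q.2 h).symm

theorem Sylow.orbit_mul_card_inf (P Q : Sylow p G) :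
    (MulAction.orbit P Q).ncard * Nat.card ((P : Subgroup G) ⊓ (Q : Subgroup G) : Subgroup G) =
      Nat.card P := by
  have hstab : MulAction.stabilizer P Q = ((P : Subgroup G) ⊓ (Q : Subgroup G)).subgroupOf P := by
    ext a
    rw [MulAction.mem_stabilizer_iff, Subgroup.mem_subgroupOf, ← P.2.inf_normalizer_sylow Q]
    change (a : G) • Q = Q ↔ _
    rw [Sylow.smul_eq_iff_mem_normalizer, Subgroup.mem_inf]
    exact ⟨fun h => ⟨a.2, h⟩, fun h => h.2⟩
  rw [← MulAction.index_stabilizer, hstab, mul_comm,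
    ← Nat.card_congr (Subgroup.subgroupOfEquivOfLe (inf_le_left (a := (P : Subgroup G)) (b := Q))).toEquiv]
  exact Subgroup.card_mul_index _

/-- If the number of Sylow `p`-subgroups is not `1` modulo `p ^ 2`, two of them meet in a subgroup of index `p`. -/
theorem Sylow.exists_card_inf [Finite G] [Fact p.Prime] (h : ¬ Nat.card (Sylow p G) ≡ 1 [MOD p ^ 2]) (P : Sylow p G) :
    ∃ Q : Sylow p G, Q ≠ P ∧ p * Nat.card ((P : Subgroup G) ⊓ (Q : Subgroup G) : Subgroup G) =
      Nat.card P := by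
  classical
  by_contra! hc
  apply h
  have := Fintype.ofFinite (MulAction.orbitRel.Quotient P (Sylow p G))
  -- The `P`-orbit of `Q` has size the index of `P ⊓ Q` in `P`, a power of `p`. It is 1 only for `Q
  -- = P`, and `p` is excluded by assumption.
  have hne : ∀ Q : Sylow p G, Q ≠ P → p ^ 2 ∣ (MulAction.orbit P Q).ncard := by
    intro Q hQ
    have h1 := P.orbit_mul_card_inf Q
    obtain ⟨n, hn⟩ := IsPGroup.iff_card.mp P.2
    obtain ⟨k, -, hk⟩ := (Nat.dvd_prime_pow (Fact.out : p.Prime)).mp (hn ▸ Dvd.intro _ h1)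
    rw [hk] at h1 ⊢
    match k, h1 with
    | 0, h1 =>
      rw [pow_zero, one_mul] at h1
      have h2 := Subgroup.eq_of_le_of_card_ge (inf_le_left (a := (P : Subgroup G)) (b := Q)) h1.ge
      exact absurd (Sylow.eq_of_le (inf_eq_left.mp h2)).symm hQ
    | 1, h1 => rw [pow_one] at h1; exact absurd h1 (hc Q hQ)
    | k + 2, _ => exact pow_dvd_pow p (by omega)
  have hself : (MulAction.orbit P P).ncard = 1 := by
    have h1 := P.orbit_mul_card_inf P
    rw [inf_idem] at h1
    exact Nat.eq_of_mul_eq_mul_right Nat.card_pos (h1.trans (one_mul _).symm)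
  have hsum : Nat.card (Sylow p G) =
      ∑ ω : MulAction.orbitRel.Quotient P (Sylow p G), (MulAction.orbit P ω.out).ncard := by
    rw [Nat.card_congr (MulAction.selfEquivSigmaOrbits P (Sylow p G)), Nat.card_sigma]
    rfl
  let ω₀ : MulAction.orbitRel.Quotient P (Sylow p G) := Quotient.mk'' P
  have h0 : MulAction.orbit P ω₀.out = MulAction.orbit P P :=
    MulAction.orbit_eq_iff.mpr (Quotient.mk_out (s := MulAction.orbitRel P (Sylow p G)) P)
  have hout : ∀ ω ∈ Finset.univ.erase ω₀, p ^ 2 ∣ (MulAction.orbit P ω.out).ncard := by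
    intro ω hω
    refine hne _ fun he => Finset.ne_of_mem_erase hω ?_
    rw [← Quotient.out_eq' ω, he]
  rw [hsum, ← Finset.add_sum_erase _ _ (Finset.mem_univ ω₀), h0, hself]
  have := (Nat.modEq_zero_iff_dvd.mpr (Finset.dvd_sum hout)).add_left 1
  rwa [add_zero] at this

end Sylow

end

/-! ### Extensions of a group of order 3 or 9 by the alternating group of degree four -/

section

open Equiv Equiv.Perm

set_option maxRecDepth 10000 in
-- The three double transpositions appear as conjugates of one of them under a 3-cycle, so that what
-- is known of one passes to all.
theorem perm_four_eq_of_sq {g : Perm (Fin 4)} : g ^ 2 = 1 → sign g = 1 →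
    g = 1 ∨ g = swap 0 1 * swap 2 3 ∨
      g = (swap 0 1 * swap 1 2) * (swap 0 1 * swap 2 3) * (swap 0 1 * swap 1 2)⁻¹ ∨
      g = (swap 0 1 * swap 1 2) ^ 2 * (swap 0 1 * swap 2 3) * ((swap 0 1 * swap 1 2) ^ 2)⁻¹ := by
  revert g
  decide

/-- An involutory automorphism of an abelian group of order 3 or 9 which is an even permutation is trivial or the
inversion. -/
theorem MulAut.eq_one_or_inv_of_sq {D : Type*} [Group D] [Fintype D] [DecidableEq D]
    (hcomm : ∀ a b : D, a * b = b * a) (hcard : Nat.card D = 3 ∨ Nat.card D = 9) {α : MulAut D}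
    (hα : α ^ 2 = 1) (hsign : sign (MulAut.toPerm D α) = 1) : α = 1 ∨ ∀ d, α d = d⁻¹ := by
  have hαα : ∀ d, α (α d) = d := fun d => by
    have := congrArg (fun β : MulAut D => β d) hα
    rwa [pow_two] at this
  let F : Subgroup D := MonoidHom.eqLocus (α : D →* D) (MonoidHom.id D)
  have hF : ∀ d, d ∈ F ↔ α d = d := fun d => Iff.rfl
  have hbot : Nat.card F = 1 → ∀ d, α d = d⁻¹ := by
    intro h1 d
    -- The product `d * α d` is always fixed by `α`.
    have h2 : d * α d ∈ F := by rw [hF, map_mul, hαα, hcomm]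
    rw [Subgroup.card_eq_one.mp h1, Subgroup.mem_bot] at h2
    exact (inv_eq_of_mul_eq_one_right h2).symm
  have htop : Nat.card F = Nat.card D → α = 1 := by
    intro h1
    have h2 := Subgroup.eq_top_of_card_eq _ h1
    ext d
    exact (hF d).mp (h2 ▸ Subgroup.mem_top d)
  have hdvd := Subgroup.card_subgroup_dvd_card F
  rcases hcard with h3 | h9
  · rw [h3] at hdvd htop
    rcases (Nat.dvd_prime (by norm_num)).mp hdvd with h | h
    exacts [Or.inr (hbot h), Or.inl (htop h)]
  · rw [h9] at hdvd htop
    obtain ⟨k, hk, hFk⟩ := (Nat.dvd_prime_pow (m := 2) Nat.prime_three).mp hdvd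
    interval_cases k
    · exact Or.inr (hbot hFk)
    · exfalso
      -- Three fixed points among nine leave three transpositions, an odd permutation.
      have h1 : (MulAut.toPerm D α) ^ 2 = 1 := by rw [← map_pow, hα, map_one]
      have h2 : Fintype.card (Function.fixedPoints (MulAut.toPerm D α)) = 3 := by
        rw [← Nat.card_eq_fintype_card]
        exact hFk
      rw [sign_of_pow_two_eq_one h1, h2, ← Nat.card_eq_fintype_card, h9] at hsign
      revert hsign
      decide
    · exact Or.inl (htop hFk)

namespace Sylow

variable {M : Type*} [Group M] [Finite M]

theorem normalizer_eq_of_card_eq_index {p : ℕ} [Fact p.Prime] (R : Sylow p M)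
    (h : Nat.card (Sylow p M) = (R : Subgroup M).index) :
    Subgroup.normalizer (R : Set M) = (R : Subgroup M) := by
  rw [R.card_eq_index_normalizer] at h
  refine (Subgroup.eq_of_le_of_card_ge Subgroup.le_normalizer (le_of_eq ?_)).symm
  have h1 := Subgroup.card_mul_index (Subgroup.normalizer (R : Set M))
  have h2 := Subgroup.card_mul_index (R : Subgroup M)
  rw [← h2, h] at h1
  exact Nat.eq_of_mul_eq_mul_right (Nat.pos_of_ne_zero Subgroup.index_ne_zero_of_finite) h1

/-- The kernel contains `R`, as `p` is odd. By the Frattini argument it generates the group together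
with the normalizer of `R`, which is `R` itself. -/
theorem hom_units_eq_one {p : ℕ} [Fact p.Prime] (hp : p ≠ 2) (R : Sylow p M)
    (h : Subgroup.normalizer (R : Set M) = (R : Subgroup M)) (f : M →* ℤˣ) (m : M) : f m = 1 := by
  have hle : (R : Subgroup M) ≤ f.ker := by
    intro r hr
    obtain ⟨k, hk⟩ := R.2 ⟨r, hr⟩
    have h1 : r ^ p ^ k = 1 := congrArg Subtype.val hk
    have h2 : f r ^ p ^ k = 1 := by rw [← map_pow, h1, map_one]
    exact eq_one_of_pow_eq_one_of_coprime h2 (Int.units_sq (f r))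
      (Nat.Coprime.pow_left _ ((Nat.coprime_primes Fact.out Nat.prime_two).mpr hp))
  have h1 := R.normalizer_sup_eq_top' hle
  rw [h, sup_eq_right.mpr hle] at h1
  exact (h1 ▸ Subgroup.mem_top m : m ∈ f.ker)

/-- A group of order `12 c` with two Sylow `3`-subgroups that meet in an abelian normal subgroup of order `c` has
a normal subgroup of order four. -/
theorem exists_normal_card_four (P Q : Sylow 3 M) (hPQ : P ≠ Q) (D : Subgroup M) [D.Normal]
    (hD : D = (P : Subgroup M) ⊓ Q) (hcomm : ∀ a ∈ D, ∀ b ∈ D, a * b = b * a)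
    (hDcard : Nat.card D = 3 ∨ Nat.card D = 9) (hM : Nat.card M = 12 * Nat.card D)
    (hP : Nat.card P = 3 * Nat.card D) :
    ∃ V : Subgroup M, V.Normal ∧ Nat.card V = 4 ∧ ¬ V ≤ Subgroup.center M := by
  classical
  have hcpos : 0 < Nat.card D := Nat.card_pos
  have hind : ∀ R : Sylow 3 M, (R : Subgroup M).index = 4 := by
    intro R
    have h1 := Subgroup.card_mul_index (R : Subgroup M)
    rw [Nat.card_congr (R.equiv P).toEquiv, hP, hM] at h1
    have : 3 * Nat.card D * (R : Subgroup M).index = 3 * Nat.card D * 4 := by omega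
    exact Nat.eq_of_mul_eq_mul_left (by omega) this
  have hn4 : Nat.card (Sylow 3 M) = 4 := by
    have h1 := P.card_dvd_index
    rw [hind P] at h1
    have h2 : Nat.card (Sylow 3 M) % 3 = 1 := card_sylow_modEq_one 3 M
    have h3 : Nat.card (Sylow 3 M) ≠ 1 := fun h =>
      hPQ ((Nat.card_eq_one_iff_unique.mp h).1.elim P Q)
    have h4 := Nat.le_of_dvd (by norm_num) h1
    interval_cases Nat.card (Sylow 3 M) <;> omega
  have hN : ∀ R : Sylow 3 M, Subgroup.normalizer (R : Set M) = (R : Subgroup M) := fun R =>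
    R.normalizer_eq_of_card_eq_index (hn4.trans (hind R).symm)
  have hunits := P.hom_units_eq_one (by norm_num) (hN P)
  have hDR : ∀ R : Sylow 3 M, D ≤ R := by
    have : IsPGroup 3 D := P.2.to_le (hD ▸ inf_le_left)
    exact fun R => this.le_sylow_of_normal R
  -- the action on the four Sylow subgroups identifies the quotient with the alternating group
  let e : Sylow 3 M ≃ Fin 4 := Finite.equivFinOfCardEq hn4
  let ψ : M →* Perm (Fin 4) := (e.permCongrHom : Perm (Sylow 3 M) →* Perm (Fin 4)).comp
    (MulAction.toPermHom M (Sylow 3 M))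
  have hψ : ∀ m, sign (ψ m) = 1 := hunits (sign.comp ψ)
  let φ : M →* alternatingGroup (Fin 4) := ψ.codRestrict _ fun m => Perm.mem_alternatingGroup.mpr (hψ m)
  have hφψ : ∀ m, ((φ m : alternatingGroup (Fin 4)) : Perm (Fin 4)) = ψ m := fun m => rfl
  -- Each Sylow 3-subgroup is its own normalizer, so an element that fixes all of them lies in `P ⊓
  -- Q`.
  have hker : ∀ m, ψ m = 1 ↔ m ∈ D := by
    intro m
    have h1 : ψ m = 1 ↔ ∀ R : Sylow 3 M, m • R = R := by
      rw [show ψ m = e.permCongrHom (MulAction.toPermHom M (Sylow 3 M) m) from rfl,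
        EmbeddingLike.map_eq_one_iff, Equiv.ext_iff]
      rfl
    rw [h1]
    refine ⟨fun h => ?_, fun h R => ?_⟩
    · rw [hD, Subgroup.mem_inf, ← hN P, ← hN Q]
      exact ⟨Sylow.smul_eq_iff_mem_normalizer.mp (h P), Sylow.smul_eq_iff_mem_normalizer.mp (h Q)⟩
    · rw [Sylow.smul_eq_iff_mem_normalizer, hN R]
      exact hDR R h
  have hkerφ : φ.ker = D := by
    ext m
    rw [MonoidHom.mem_ker, ← hker, ← hφψ, OneMemClass.coe_eq_one]
  have hsurj : Function.Surjective φ := by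
    rw [← MonoidHom.range_eq_top]
    refine Subgroup.eq_top_of_card_eq _ ?_
    rw [← Subgroup.index_ker, hkerφ, nat_card_alternatingGroup, Nat.card_fin]
    have h1 := Subgroup.card_mul_index D
    rw [hM, mul_comm 12] at h1
    exact Nat.eq_of_mul_eq_mul_left hcpos h1
  have hlift : ∀ σ : Perm (Fin 4), sign σ = 1 → ∃ m, ψ m = σ := by
    intro σ hσ
    obtain ⟨m, hm⟩ := hsurj ⟨σ, Perm.mem_alternatingGroup.mpr hσ⟩
    exact ⟨m, (hφψ m).symm.trans (congrArg Subtype.val hm)⟩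
  -- the action on `D`
  have := Fintype.ofFinite D
  let ρ : M →* MulAut D := MulAut.conjNormal
  have hρapp : ∀ m (d : D), ((ρ m d : D) : M) = m * d * m⁻¹ := fun m d => MulAut.conjNormal_apply m d
  have hρD : ∀ m ∈ D, ρ m = 1 := by
    intro m hm
    ext d
    rw [hρapp, hcomm m hm d d.2, mul_inv_cancel_right]
    rfl
  have hρψ : ∀ a b : M, ψ a = ψ b → ρ a = ρ b := by
    intro a b hab
    have h1 : a * b⁻¹ ∈ D := by rw [← hker, map_mul, map_inv, hab, mul_inv_cancel]
    have h2 := hρD _ h1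
    rwa [map_mul, map_inv, mul_inv_eq_one] at h2
  have hcD : ∀ a b : D, a * b = b * a := fun a b => Subtype.ext (hcomm a a.2 b b.2)
  obtain ⟨v, hv⟩ := hlift (swap 0 1 * swap 2 3) (by decide)
  obtain ⟨t, ht⟩ := hlift (swap 0 1 * swap 1 2) (by decide)
  have hv2 : ρ v ^ 2 = 1 := by
    rw [← map_pow]
    refine hρD _ ((hker _).mp ?_)
    rw [map_pow, hv]
    decide
  -- In the alternating group the product of two double transpositions is the third. If `ρ v` is the
  -- inversion, it commutes with all automorphisms, all three conjugates coincide, and the relation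
  -- makes it trivial.
  have hvrel : ρ v * (ρ t * ρ v * (ρ t)⁻¹) = ρ t ^ 2 * ρ v * (ρ t ^ 2)⁻¹ := by
    have := hρψ (v * (t * v * t⁻¹)) (t ^ 2 * v * (t ^ 2)⁻¹) (by
      simp only [map_mul, map_inv, map_pow, hv, ht]
      decide)
    simpa only [map_mul, map_inv, map_pow] using this
  have hρv : ρ v = 1 := by
    rcases MulAut.eq_one_or_inv_of_sq hcD hDcard hv2
      (hunits (sign.comp ((MulAut.toPerm D).comp ρ)) v) with h | h
    · exact h
    · have hconj : ∀ β : MulAut D, β * ρ v * β⁻¹ = ρ v := by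
        intro β
        ext d
        rw [MulAut.mul_apply, MulAut.mul_apply, h, h, map_inv, MulAut.apply_inv_self]
      rw [hconj, hconj] at hvrel
      exact mul_eq_left.mp hvrel
  -- The preimage of the Klein four-group acts trivially on `D`. Its Sylow 2-subgroup is therefore
  -- normalized by `D` and by itself, hence normal in `W` by order, hence normal in `M`.
  let W : Subgroup M := (alternatingGroup.kleinFour (Fin 4)).comap φ
  have hfour : Nat.card (Fin 4) = 4 := Nat.card_fin 4
  have hKn : (alternatingGroup.kleinFour (Fin 4)).Normal := alternatingGroup.normal_kleinFour hfour
  have hWn : W.Normal := hKn.comap φ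
  have hDW : D ≤ W := by
    intro d hd
    rw [← hkerφ, MonoidHom.mem_ker] at hd
    rw [Subgroup.mem_comap, hd]
    exact one_mem _
  have hWcard : Nat.card W = 4 * Nat.card D := by
    have h1 := Subgroup.card_mul_index W
    have h2 : W.index = (alternatingGroup.kleinFour (Fin 4)).index :=
      Subgroup.index_comap_of_surjective _ hsurj
    have h3 := Subgroup.card_mul_index (alternatingGroup.kleinFour (Fin 4))
    rw [alternatingGroup.kleinFour_card_of_card_eq_four hfour, nat_card_alternatingGroup, hfour] at h3
    have h4 : W.index = 3 := by
      rw [h2]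
      have : Nat.factorial 4 / 2 = 12 := by decide
      omega
    rw [h4] at h1
    omega
  have hWρ : ∀ w ∈ W, ρ w = 1 := by
    intro w hw
    have h1 : ψ w ^ 2 = 1 := by
      have h2 : (⟨φ w, hw⟩ : alternatingGroup.kleinFour (Fin 4)) ^ 2 = 1 := by
        rw [← alternatingGroup.exponent_kleinFour_of_card_eq_four hfour]
        exact Monoid.pow_exponent_eq_one _
      exact congrArg Subtype.val (congrArg Subtype.val h2)
    rcases perm_four_eq_of_sq h1 (hψ w) with h | h | h | h
    · exact hρD _ ((hker _).mp h)
    · rw [hρψ w v (h.trans hv.symm), hρv]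
    · rw [hρψ w (t * v * t⁻¹) (by rw [h, map_mul, map_mul, map_inv, hv, ht]), map_mul, map_mul, map_inv, hρv,
        mul_one, mul_inv_cancel]
    · rw [hρψ w (t ^ 2 * v * (t ^ 2)⁻¹) (by rw [h, map_mul, map_mul, map_inv, map_pow, hv, ht]), map_mul, map_mul,
        map_inv, hρv, mul_one, mul_inv_cancel]
  obtain ⟨S⟩ : Nonempty (Sylow 2 W) := inferInstance
  have hodd : Nat.Coprime 4 (Nat.card D) := by
    rcases hDcard with h | h <;> rw [h] <;> norm_num
  have hScard : Nat.card S = 4 := by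
    obtain ⟨k, hk⟩ := IsPGroup.iff_card.mp S.2
    have h1 : 2 ^ 2 ∣ Nat.card S := S.pow_dvd_card_of_pow_dvd_card (by rw [hWcard]; exact Dvd.intro _ rfl)
    have h2 : Nat.card S ∣ 4 * Nat.card D := hWcard ▸ Subgroup.card_subgroup_dvd_card (S : Subgroup W)
    refine Nat.dvd_antisymm (Nat.Coprime.dvd_of_dvd_mul_right ?_ h2) h1
    rw [hk]
    exact Nat.Coprime.pow_left k (hodd.coprime_dvd_left (by norm_num))
  have hSn : (S : Subgroup W).Normal := by
    rw [← Subgroup.normalizer_eq_top_iff]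
    refine Subgroup.eq_top_of_card_eq _ (Nat.dvd_antisymm (Subgroup.card_subgroup_dvd_card _) ?_)
    rw [hWcard]
    refine hodd.mul_dvd_of_dvd_of_dvd ?_ ?_
    · rw [← hScard]
      exact Subgroup.card_dvd_of_le Subgroup.le_normalizer
    · rw [← Nat.card_congr (Subgroup.subgroupOfEquivOfLe hDW).toEquiv]
      refine Subgroup.card_dvd_of_le (le_trans ?_ (Subgroup.centralizer_le_normalizer _))
      intro d hd
      rw [Subgroup.mem_centralizer_iff]
      intro s _
      have h1 := congrArg (fun β : MulAut D => ((β ⟨d, hd⟩ : D) : M)) (hWρ s s.2)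
      simp only [hρapp] at h1
      exact Subtype.ext (mul_inv_eq_iff_eq_mul.mp h1)
  have hSc : (S : Subgroup W).Characteristic := S.characteristic_of_normal hSn
  refine ⟨(S : Subgroup W).map W.subtype, ConjAct.normal_of_characteristic_of_normal, ?_, ?_⟩
  · rw [Subgroup.card_subtype]
    exact hScard
  · intro hle
    -- A central subgroup normalizes `P`, so it would lie in `P`, which has odd order.
    have h1 : (S : Subgroup W).map W.subtype ≤ P := by
      rw [← hN P]
      exact hle.trans (Subgroup.center_le_normalizer _)
    have h2 := Subgroup.card_dvd_of_le h1
    rw [Subgroup.card_subtype, hP] at h2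
    change Nat.card S ∣ _ at h2
    rw [hScard] at h2
    rcases hDcard with h | h <;> rw [h] at h2 <;> norm_num at h2

end Sylow

end

/-! ### Commutativity criteria and Sylow subgroups inside a subgroup -/

namespace Subgroup

variable {G : Type*} [Group G]

theorem forall_mul_comm_of_isMulCommutative {P : Subgroup G} (h : IsMulCommutative P) :
    ∀ a ∈ P, ∀ b ∈ P, a * b = b * a := fun a ha b hb =>
  congrArg Subtype.val (h.is_comm.comm (⟨a, ha⟩ : P) ⟨b, hb⟩)

variable {p : ℕ} [Fact p.Prime]

theorem mul_comm_of_card_prime {P : Subgroup G} (h : Nat.card P = p) :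
    ∀ a ∈ P, ∀ b ∈ P, a * b = b * a := by
  have : IsCyclic P := isCyclic_of_prime_card h
  exact forall_mul_comm_of_isMulCommutative IsCyclic.isMulCommutative

theorem mul_comm_of_card_sq {P : Subgroup G} (h : Nat.card P = p ^ 2) :
    ∀ a ∈ P, ∀ b ∈ P, a * b = b * a :=
  forall_mul_comm_of_isMulCommutative (IsPGroup.isMulCommutative_of_card_eq_prime_sq h)

theorem subgroupOf_le_center {P D : Subgroup G} (hD : D ≤ center G) : D.subgroupOf P ≤ center P := by
  intro d hd
  rw [mem_center_iff]
  exact fun g => Subtype.ext (mem_center_iff.mp (hD hd) g)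

theorem normal_of_le_center {D : Subgroup G} (hD : D ≤ center G) : D.Normal where
  conj_mem d hd g := by rwa [mem_center_iff.mp (hD hd) g, mul_inv_cancel_right]

theorem mul_comm_of_le_center [Finite G] {P D : Subgroup G} (hDP : D ≤ P) (hD : D ≤ center G)
    (hcard : Nat.card P = p * Nat.card D) : ∀ a ∈ P, ∀ b ∈ P, a * b = b * a := by
  have hle : D.subgroupOf P ≤ center P := subgroupOf_le_center hD
  have hn : (D.subgroupOf P).Normal := normal_of_le_center hle
  have h1 := card_mul_index (D.subgroupOf P)
  rw [Nat.card_congr (subgroupOfEquivOfLe hDP).toEquiv, hcard, mul_comm] at h1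
  have h2 : Nat.card (P ⧸ D.subgroupOf P) = p := Nat.eq_of_mul_eq_mul_right Nat.card_pos h1
  have : IsCyclic (P ⧸ D.subgroupOf P) := isCyclic_of_prime_card h2
  refine forall_mul_comm_of_isMulCommutative
    (MonoidHom.isMulCommutative_of_isCyclic_of_ker_le_center (QuotientGroup.mk' (D.subgroupOf P)) ?_)
  rwa [QuotientGroup.ker_mk']

end Subgroup

namespace Sylow

variable {G : Type*} [Group G] [Finite G] {p : ℕ} [Fact p.Prime]

theorem card_eq_pow (P : Sylow p G) {k m : ℕ} (hG : Nat.card G = p ^ k * m) (hm : ¬ p ∣ m) :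
    Nat.card P = p ^ k := by
  obtain ⟨j, hj⟩ := IsPGroup.iff_card.mp P.2
  have h1 : p ^ k ∣ Nat.card P := P.pow_dvd_card_of_pow_dvd_card (hG ▸ Dvd.intro _ rfl)
  have h2 : Nat.card P ∣ p ^ k * m := hG ▸ Subgroup.card_subgroup_dvd_card (P : Subgroup G)
  refine Nat.dvd_antisymm (Nat.Coprime.dvd_of_dvd_mul_right ?_ h2) h1
  rw [hj]
  exact Nat.Coprime.pow_left j ((Nat.Prime.coprime_iff_not_dvd Fact.out).mpr hm)

theorem le_normalizer_of_card (P : Sylow p G) {D : Subgroup G} (hD : D ≤ P)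
    (hcard : p * Nat.card D = Nat.card P) : (P : Subgroup G) ≤ Subgroup.normalizer (D : Set G) := by
  rw [← Subgroup.normal_subgroupOf_iff_le_normalizer hD]
  have hp : p.Prime := Fact.out
  obtain ⟨k, hk⟩ := IsPGroup.iff_card.mp P.2
  have hk0 : k ≠ 0 := by
    rintro rfl
    rw [pow_zero, ← hcard] at hk
    exact hp.one_lt.ne' (Nat.eq_one_of_mul_eq_one_right hk)
  refine Subgroup.normal_of_index_eq_minFac_card ?_
  rw [show Nat.card ↥(P : Subgroup G) = p ^ k from hk, hp.pow_minFac hk0]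
  have h1 := Subgroup.card_mul_index (D.subgroupOf P)
  rw [Nat.card_congr (Subgroup.subgroupOfEquivOfLe hD).toEquiv, mul_comm] at h1
  exact Nat.eq_of_mul_eq_mul_right Nat.card_pos (h1.trans hcard.symm)

/-- A subgroup containing two Sylow subgroups contains a number of them that divides its relative index. -/
theorem exists_dvd_relIndex {P Q : Sylow p G} (hPQ : P ≠ Q) {M : Subgroup G} (hP : (P : Subgroup G) ≤ M)
    (hQ : (Q : Subgroup G) ≤ M) : ∃ n, n ∣ (P : Subgroup G).relIndex M ∧ n ≡ 1 [MOD p] ∧ n ≠ 1 := by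
  refine ⟨Nat.card (Sylow p M), (P.subtype hP).card_dvd_index, card_sylow_modEq_one p M, fun h => hPQ ?_⟩
  exact Sylow.subtype_injective ((Nat.card_eq_one_iff_unique.mp h).1.elim (P.subtype hP) (Q.subtype hQ))

end Sylow

/-! ### Two Sylow 3-subgroups with large intersection -/

namespace IsHurwitzPair

variable {G : Type*} [Group G] [Finite G] {x y : G}

/-- No proper divisor of 3, 9 or 27 is congruent to it modulo 7, so `D` is central. As `P` modulo
`D` has order 1 or 3, `P` is abelian, and transfer makes `D` trivial. -/
theorem card_ne_one (h : IsHurwitzPair x y) {D : Subgroup G} {P : Sylow 3 G} (hDP : D ≤ P)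
    (hn : D.Normal) (hcard : Nat.card P = 3 * Nat.card D ∨ Nat.card P = Nat.card D)
    (hD : Nat.card D = 3 ∨ Nat.card D = 9 ∨ Nat.card D = 27) : False := by
  have hc : D ≤ Subgroup.center G := by
    refine h.le_center_of_card D ?_
    rcases hD with hD | hD | hD <;> rw [hD] <;> decide
  have hcomm : ∀ a ∈ P, ∀ b ∈ P, a * b = b * a := by
    rcases hcard with hcard | hcard
    · exact Subgroup.mul_comm_of_le_center hDP hc hcard
    · have := Subgroup.eq_of_le_of_card_ge hDP hcard.le
      intro a _ b hb
      exact Subgroup.mem_center_iff.mp (hc (this ▸ hb)) a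
  have := h.eq_bot_of_le_center P hcomm hDP hc
  rw [this, Subgroup.card_bot] at hD
  omega

/-- Two Sylow `3`-subgroups that generate a group of order `12 c` over their intersection of order `c` lie in
a proper subgroup of order divisible by `8`. -/
theorem exists_subgroup_of_card_normalizer (h : IsHurwitzPair x y) (h8 : 8 ∣ Nat.card G)
    {P Q : Sylow 3 G} (hPQ : P ≠ Q) {D M : Subgroup G} (hD : D = (P : Subgroup G) ⊓ Q)
    (hM : M = Subgroup.normalizer (D : Set G)) (hPM : (P : Subgroup G) ≤ M) (hQM : (Q : Subgroup G) ≤ M)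
    (hcomm : ∀ a ∈ D, ∀ b ∈ D, a * b = b * a) (hDcard : Nat.card D = 3 ∨ Nat.card D = 9)
    (hMcard : Nat.card M = 12 * Nat.card D) (hPcard : Nat.card P = 3 * Nat.card D) :
    ∃ N : Subgroup G, N ≠ ⊤ ∧ 8 * Nat.card P ∣ Nat.card N := by
  have hDM : D ≤ M := hM ▸ Subgroup.le_normalizer
  have hDc : Nat.card (D.subgroupOf M) = Nat.card D :=
    Nat.card_congr (Subgroup.subgroupOfEquivOfLe hDM).toEquiv
  have hPc : Nat.card (P.subtype hPM) = Nat.card P :=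
    Nat.card_congr (Subgroup.subgroupOfEquivOfLe hPM).toEquiv
  have hn : (D.subgroupOf M).Normal := by
    rw [Subgroup.normal_subgroupOf_iff_le_normalizer hDM, hM]
  obtain ⟨V, hV, hV4, hVc⟩ := Sylow.exists_normal_card_four (P.subtype hPM) (Q.subtype hQM)
    (fun he => hPQ (Sylow.subtype_injective he)) (D.subgroupOf M) (by
      rw [hD]; rfl) (fun a ha b hb => Subtype.ext (hcomm a ha b hb)) (hDc.symm ▸ hDcard) (hDc.symm ▸ hMcard)
      (by rw [hPc, hDc, hPcard])
  have hV4' : Nat.card (V.map M.subtype) = 4 := (Subgroup.card_subtype M V).trans hV4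
  have hMN : M ≤ Subgroup.normalizer (V.map M.subtype : Set G) := by
    have hle : V.map M.subtype ≤ M := Subgroup.map_subtype_le V
    rw [← Subgroup.normal_subgroupOf_iff_le_normalizer hle]
    rwa [Subgroup.subgroupOf, Subgroup.comap_map_eq_self_of_injective M.subtype_injective]
  refine ⟨Subgroup.normalizer (V.map M.subtype : Set G), fun htop => hVc ?_, ?_⟩
  · have hVn : (V.map M.subtype).Normal := Subgroup.normalizer_eq_top_iff.mp htop
    -- If the subgroup of order four were normal in `G`, it would be central, which it is not even
    -- in `M`.
    have hc := h.le_center_of_card (V.map M.subtype) (by rw [hV4']; decide)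
    intro v hv
    rw [Subgroup.mem_center_iff]
    exact fun g => Subtype.ext (Subgroup.mem_center_iff.mp (hc ⟨v, hv, rfl⟩) g)
  -- A subgroup of order 4 in a group of order divisible by 8 has a normalizer of order divisible by
  -- 8.
  · have h1 : 2 ^ (2 + 1) ∣ Nat.card (Subgroup.normalizer (V.map M.subtype : Set G)) :=
      Sylow.prime_pow_dvd_card_normalizer (p := 2) h8 hV4'
    have h2 := Subgroup.card_dvd_of_le (hPM.trans hMN)
    refine Nat.Coprime.mul_dvd_of_dvd_of_dvd ?_ h1 h2
    rw [hPcard]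
    rcases hDcard with hDcard | hDcard <;> rw [hDcard] <;> decide

/-- Two Sylow `3`-subgroups whose intersection has index three in both: the normalizer of the
intersection. -/
theorem false_of_card_inf (h : IsHurwitzPair x y) (h8 : 8 ∣ Nat.card G) {m : ℕ}
    {P Q : Sylow 3 G} (hQP : Q ≠ P)
    (hcard : 3 * Nat.card ((P : Subgroup G) ⊓ (Q : Subgroup G) : Subgroup G) = Nat.card P)
    (hP : Nat.card P = 9 ∨ Nat.card P = 27) (hG : Nat.card G = Nat.card P * m)
    (hm : ∀ H : Subgroup G, H.index ∣ m → H = ⊤ ∨ H.index * 1 = m ∨ H.index * 2 = m ∨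
      H.index * 5 = m ∨ H.index * 4 = m) (hm8 : ∀ H : Subgroup G, H.index * 8 ∣ m → H = ⊤) : False := by
  set D := (P : Subgroup G) ⊓ (Q : Subgroup G) with hD
  set M := Subgroup.normalizer (D : Set G) with hM
  have hDcard : Nat.card D = 3 ∨ Nat.card D = 9 := by omega
  have hPM : (P : Subgroup G) ≤ M := P.le_normalizer_of_card inf_le_left hcard
  have hQM : (Q : Subgroup G) ≤ M := Q.le_normalizer_of_card inf_le_right
    (hcard.trans (Nat.card_congr (P.equiv Q).toEquiv))
  have hPpos : 0 < Nat.card P := Nat.card_pos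
  have hPindex : (P : Subgroup G).index = m := by
    have h1 := Subgroup.card_mul_index (P : Subgroup G)
    rw [hG] at h1
    exact Nat.eq_of_mul_eq_mul_left hPpos h1
  have hrel := Subgroup.relIndex_mul_index hPM
  rw [hPindex] at hrel
  obtain ⟨n, hn, hn3, hn1⟩ := Sylow.exists_dvd_relIndex hQP.symm hPM hQM
  have hMpos : 0 < M.index := Nat.pos_of_ne_zero Subgroup.index_ne_zero_of_finite
  have hcases : ∀ r, M.index * r = m → (P : Subgroup G).relIndex M = r := fun r hr =>
    Nat.eq_of_mul_eq_mul_right hMpos (hrel.trans (hr.symm.trans (mul_comm _ _)))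
  -- `M` contains more than one Sylow 3-subgroup, but 1, 2 and 5 have no divisor other than 1 that
  -- is 1 modulo 3. Only index four of `P` in `M` survives.
  have hprime : ∀ r, M.index * r = m → r = 1 ∨ r = 2 ∨ r = 5 → False := by
    intro r hr hr'
    rw [hcases r hr] at hn
    have hle := Nat.le_of_dvd (by omega) hn
    have hn3' : n % 3 = 1 := hn3
    rcases hr' with rfl | rfl | rfl <;> interval_cases n <;> omega
  rcases hm M (Dvd.intro_left _ hrel) with htop | h1 | h2 | h5 | h4
  · exact h.card_ne_one (P := P) inf_le_left (Subgroup.normalizer_eq_top_iff.mp htop) (Or.inl hcard.symm)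
      (hDcard.imp_right Or.inl)
  · exact hprime 1 h1 (by omega)
  · exact hprime 2 h2 (by omega)
  · exact hprime 5 h5 (by omega)
  · have hMcard : Nat.card M = 12 * Nat.card D := by
      have h6 := Subgroup.card_mul_index M
      rw [hG, ← h4, ← hcard, mul_comm M.index, ← mul_assoc] at h6
      rw [Nat.eq_of_mul_eq_mul_right hMpos h6]
      ring
    have hcomm : ∀ a ∈ D, ∀ b ∈ D, a * b = b * a := by
      rcases hDcard with hd | hd
      · exact Subgroup.mul_comm_of_card_prime (p := 3) hd
      · exact Subgroup.mul_comm_of_card_sq (p := 3) hd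
    obtain ⟨N, hN, hNdvd⟩ := h.exists_subgroup_of_card_normalizer h8 hQP.symm hD hM hPM hQM hcomm hDcard hMcard
      hcard.symm
    refine hN (hm8 N ?_)
    obtain ⟨c, hc⟩ := hNdvd
    have h7 := Subgroup.card_mul_index N
    rw [hc, hG, mul_comm 8, mul_assoc, mul_assoc] at h7
    refine ⟨c, (Nat.eq_of_mul_eq_mul_left hPpos h7).symm.trans ?_⟩
    ring

end IsHurwitzPair

/-! ### Orders 2520 and 6048 -/

namespace IsHurwitzPair

variable {G : Type*} [Group G] [Finite G] {x y : G}

open CosetTable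

theorem index_ne_of_bound (h : IsHurwitzPair x y) (H : Subgroup G) {n : ℕ} (hH : H.index = n)
    (hn : n + 84 < 21 * (n % 2) + 28 * (n % 3) + 36 * (n % 7)) : False := by
  have h1 := h.index_bound H
  rw [hH] at h1
  omega

/-- `K` has order 15 or 5. Its Sylow 5-subgroup is normal in `G`, hence central, and lies in a Sylow
5-subgroup of `G`, which has order 5 and is abelian. -/
theorem not_hasSmallIndex_of_card_eq_2520 (h : IsHurwitzPair x y) (hG : Nat.card G = 2520)
    (K : Subgroup G) [K.Normal] : ¬ HasSmallIndex x y K := by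
  intro hK
  have : Fact (Nat.Prime 5) := ⟨by norm_num⟩
  have h1 := Subgroup.card_mul_index K
  rw [hG] at h1
  have hKcard : Nat.card K = 15 ∨ Nat.card K = 5 := by
    rcases hK with hK | ⟨hK, -⟩ <;> rw [hK] at h1 <;> omega
  obtain ⟨R⟩ : Nonempty (Sylow 5 K) := inferInstance
  have hR : Nat.card R = 5 := by
    rcases hKcard with hK | hK
    · exact R.card_eq_pow (k := 1) (m := 3) hK (by norm_num)
    · exact R.card_eq_pow (k := 1) (m := 1) hK (by norm_num)
  have hlt : Nat.card (Sylow 5 K) < 7 := by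
    have h2 := Subgroup.card_mul_index (R : Subgroup K)
    have h3 := Nat.le_of_dvd (Nat.pos_of_ne_zero Subgroup.index_ne_zero_of_finite) R.card_dvd_index
    change Nat.card R * _ = _ at h2
    rw [hR] at h2
    omega
  have hn := h.normal_map_sylow K hlt R
  have hR' : Nat.card ((R : Subgroup K).map K.subtype) = 5 := (Subgroup.card_subtype K _).trans hR
  have hc := h.le_center_of_card ((R : Subgroup K).map K.subtype) (by rw [hR']; decide)
  obtain ⟨P⟩ : Nonempty (Sylow 5 G) := inferInstance
  have hP : Nat.card P = 5 := P.card_eq_pow (k := 1) (m := 504) hG (by norm_num)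
  have hle := (IsPGroup.of_card (p := 5) (n := 1) hR').le_sylow_of_normal P
  have hbot := h.eq_bot_of_le_center P (Subgroup.mul_comm_of_card_prime hP) hle hc
  rw [hbot, Subgroup.card_bot] at hR'
  omega

/-- `K` has order 36 or 12 and at most four Sylow 3-subgroups, so one of these is a central subgroup
`Z` of `G`, of order 9 or 3. A Sylow 3-subgroup `P` of `G` has order 27, and it is abelian if `P`
modulo `Z` is cyclic. This is clear for index 168; for index 504 the element of order nine modulo
`K` is needed. -/
theorem not_hasSmallIndex_of_card_eq_6048 (h : IsHurwitzPair x y) (hG : Nat.card G = 6048)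
    (K : Subgroup G) [K.Normal] : ¬ HasSmallIndex x y K := by
  intro hK
  have : Fact (Nat.Prime 3) := ⟨by norm_num⟩
  have h1 := Subgroup.card_mul_index K
  rw [hG] at h1
  have hKcard : Nat.card K = 36 ∨ Nat.card K = 12 := by
    rcases hK with hK | ⟨hK, -⟩ <;> rw [hK] at h1 <;> omega
  obtain ⟨R⟩ : Nonempty (Sylow 3 K) := inferInstance
  have hR : Nat.card K = 4 * Nat.card R := by
    rcases hKcard with hK | hK
    · rw [R.card_eq_pow (k := 2) (m := 4) hK (by norm_num), hK]
      norm_num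
    · rw [R.card_eq_pow (k := 1) (m := 4) hK (by norm_num), hK]
      norm_num
  have hlt : Nat.card (Sylow 3 K) < 7 := by
    have h2 := Subgroup.card_mul_index (R : Subgroup K)
    have h3 := Nat.le_of_dvd (Nat.pos_of_ne_zero Subgroup.index_ne_zero_of_finite) R.card_dvd_index
    rw [hR, mul_comm 4] at h2
    have h4 := Nat.eq_of_mul_eq_mul_left Nat.card_pos h2
    omega
  have hn := h.normal_map_sylow K hlt R
  set Z := (R : Subgroup K).map K.subtype with hZ
  have hR' : Nat.card Z = Nat.card R := Subgroup.card_subtype K _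
  have hc : Z ≤ Subgroup.center G := by
    refine h.le_center_of_card Z ?_
    rw [hR']
    rcases hKcard with hK | hK
    · rw [show Nat.card R = 9 by omega]; decide
    · rw [show Nat.card R = 3 by omega]; decide
  have hZK : Z ≤ K := Subgroup.map_subtype_le _
  have hpZ : IsPGroup 3 Z := R.2.map _
  have hPcard : ∀ P : Sylow 3 G, Nat.card P = 27 := fun P =>
    P.card_eq_pow (k := 3) (m := 224) hG (by norm_num)
  suffices ∃ P : Sylow 3 G, ∀ a ∈ P, ∀ b ∈ P, a * b = b * a by
    obtain ⟨P, hP⟩ := this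
    have hbot := h.eq_bot_of_le_center P hP (hpZ.le_sylow_of_normal P) hc
    rw [hbot, Subgroup.card_bot] at hR'
    omega
  rcases hK with hK | ⟨hK, hc9, hc3⟩
  · obtain ⟨P⟩ : Nonempty (Sylow 3 G) := inferInstance
    rw [hK] at h1
    refine ⟨P, Subgroup.mul_comm_of_le_center (p := 3) (hpZ.le_sylow_of_normal P) hc ?_⟩
    have := hPcard P
    change Nat.card P = _
    omega
  · rw [hK] at h1
    have hK12 : Nat.card K = 12 := by omega
    set c := y⁻¹ * x * (y * x) with hcdef
    have hc108 : (c ^ 9) ^ 12 = 1 := by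
      have := pow_card_eq_one' (x := (⟨c ^ 9, hc9⟩ : K))
      rw [hK12] at this
      exact congrArg Subtype.val this
    -- The fourth power removes the 2-part: `c ^ 108 = 1`, and `c ^ 4` still has order nine modulo
    -- `K`.
    have ha : IsPGroup 3 (Subgroup.zpowers (c ^ 4)) := by
      refine IsPGroup.of_card_dvd_pow (n := 3) ?_
      rw [Nat.card_zpowers]
      refine orderOf_dvd_of_pow_eq_one ?_
      rw [← pow_mul] at hc108 ⊢
      exact hc108
    obtain ⟨P, hP⟩ := ha.exists_le_sylow
    refine ⟨P, ?_⟩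
    have haP : c ^ 4 ∈ P := hP (Subgroup.mem_zpowers _)
    have hZP := hpZ.le_sylow_of_normal P
    let f : P →* G ⧸ K := (QuotientGroup.mk' K).comp (P : Subgroup G).subtype
    have hf : ∀ a : P, f a = 1 ↔ (a : G) ∈ K := fun a => QuotientGroup.eq_one_iff _
    have h3 : ∀ n : ℕ, (f ⟨c ^ 4, haP⟩) ^ n = 1 ↔ c ^ (4 * n) ∈ K := by
      intro n
      rw [← map_pow, hf, pow_mul]
      rfl
    have horder : orderOf (f ⟨c ^ 4, haP⟩) = 3 ^ (1 + 1) := by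
      refine orderOf_eq_prime_pow ?_ ?_
      · rw [h3]
        intro h4
        have h5 : c ^ (4 * 3 ^ 1) = c ^ 9 * c ^ 3 := by rw [← pow_add]; norm_num
        rw [h5] at h4
        exact hc3 ((Subgroup.mul_mem_cancel_left K hc9).mp h4)
      · rw [h3]
        have h5 : c ^ (4 * 3 ^ (1 + 1)) = (c ^ 9) ^ 4 := by rw [← pow_mul]; norm_num
        rw [h5]
        exact pow_mem hc9 4
    have hker : (Z.subgroupOf P) ≤ f.ker := fun a ha => (hf a).mpr (hZK ha)
    have hZc : Nat.card (Z.subgroupOf P) = 3 := by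
      rw [Nat.card_congr (Subgroup.subgroupOfEquivOfLe hZP).toEquiv, hR']
      omega
    have h4 := Subgroup.card_mul_index f.ker
    rw [Subgroup.index_ker] at h4
    have h5 : Nat.card ↥(P : Subgroup G) = 27 := hPcard P
    rw [h5] at h4
    have h6 : 9 ∣ Nat.card f.range := by
      have h7 : orderOf (f.rangeRestrict ⟨c ^ 4, haP⟩) = 9 := by
        rw [← Subgroup.orderOf_coe]
        exact horder
      exact h7 ▸ orderOf_dvd_natCard _
    have h7 : 3 ∣ Nat.card f.ker := hZc.symm.dvd.trans (Subgroup.card_dvd_of_le hker)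
    obtain ⟨s, hs⟩ := h6
    obtain ⟨t, ht⟩ := h7
    -- The kernel of `f` has order divisible by 3 and its image order divisible by 9, within a group
    -- of order 27. So the kernel is `Z` and the image is cyclic.
    have hst : t * s = 1 := by
      rw [hs, ht] at h4
      have : 27 * (t * s) = 27 * 1 := by linarith
      omega
    obtain rfl : t = 1 := Nat.eq_one_of_mul_eq_one_right hst
    obtain rfl : s = 1 := by omega
    have heq := Subgroup.eq_of_le_of_card_ge hker (by omega)
    have hcyc : IsCyclic f.range := by
      refine isCyclic_of_orderOf_eq_card (f.rangeRestrict ⟨c ^ 4, haP⟩) ?_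
      rw [← Subgroup.orderOf_coe, hs]
      exact horder
    refine Subgroup.forall_mul_comm_of_isMulCommutative
      (MonoidHom.isMulCommutative_of_isCyclic_of_ker_le_center f.rangeRestrict ?_)
    rw [MonoidHom.ker_rangeRestrict, ← heq]
    exact Subgroup.subgroupOf_le_center hc

/-- The surviving proper indices are 280, 140, 56 and 70. They are listed by the index of a Sylow
3-subgroup, in one form for 280 and 224; the factor 5 does not occur for 224. -/
theorem index_of_card_eq_2520 (h : IsHurwitzPair x y) (hG : Nat.card G = 2520) (H : Subgroup G)
    (hH : H.index ∣ 280) :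
    H = ⊤ ∨ H.index * 1 = 280 ∨ H.index * 2 = 280 ∨ H.index * 5 = 280 ∨ H.index * 4 = 280 := by
  have hno := h.not_hasSmallIndex_of_card_eq_2520 hG H.normalCore
  have hb := fun n hn => h.index_ne_of_bound H (n := n) hn
  have hs := fun n allow hn hn2 hn60 h7 h3 hs =>
    hno (h.hasSmallIndex_normalCore_of_searchFromY (n := n) (allow := allow) hG H hn hn2 hn60 h7 h3 hs)
  have hmem : H.index ∈ Nat.divisors 280 := Nat.mem_divisors.mpr ⟨hH, by norm_num⟩
  rw [show Nat.divisors 280 = {1, 2, 4, 5, 7, 8, 10, 14, 20, 28, 35, 40, 56, 70, 140, 280} by decide +kernel] at hmem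
  simp only [Finset.mem_insert, Finset.mem_singleton] at hmem
  rcases hmem with hn | hn | hn | hn | hn | hn | hn | hn | hn | hn | hn | hn | hn | hn | hn | hn
  · exact Or.inl (Subgroup.index_eq_one.mp hn)
  · exact (hb 2 hn (by norm_num)).elim
  · exact (hb 4 hn (by norm_num)).elim
  · exact (hb 5 hn (by norm_num)).elim
  · exact (hs 7 false hn (by norm_num) (by norm_num) (by norm_num) (by norm_num) searchFromY_2520_7).elim
  · exact (hs 8 true hn (by norm_num) (by norm_num) (by simp) (by norm_num) searchFromY_2520_8).elim
  · exact (hb 10 hn (by norm_num)).elim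
  · exact (hs 14 false hn (by norm_num) (by norm_num) (by norm_num) (by norm_num) searchFromY_2520_14).elim
  · exact (hb 20 hn (by norm_num)).elim
  · exact (hs 28 false hn (by norm_num) (by norm_num) (by norm_num) (by norm_num) searchFromY_2520_28).elim
  · exact (hs 35 false hn (by norm_num) (by norm_num) (by norm_num) (by norm_num) searchFromY_2520_35).elim
  · exact (hb 40 hn (by norm_num)).elim
  all_goals omega

theorem index_of_card_eq_6048 (h : IsHurwitzPair x y) (hG : Nat.card G = 6048) (H : Subgroup G)
    (hH : H.index ∣ 224) :
    H = ⊤ ∨ H.index * 1 = 224 ∨ H.index * 2 = 224 ∨ H.index * 5 = 224 ∨ H.index * 4 = 224 := by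
  have hno := h.not_hasSmallIndex_of_card_eq_6048 hG H.normalCore
  have hb := fun n hn => h.index_ne_of_bound H (n := n) hn
  have hs := fun n allow hn hn2 hn60 h7 h3 hs =>
    hno (h.hasSmallIndex_normalCore_of_searchFromY (n := n) (allow := allow) hG H hn hn2 hn60 h7 h3 hs)
  have hmem : H.index ∈ Nat.divisors 224 := Nat.mem_divisors.mpr ⟨hH, by norm_num⟩
  rw [show Nat.divisors 224 = {1, 2, 4, 7, 8, 14, 16, 28, 32, 56, 112, 224} by decide +kernel] at hmem
  simp only [Finset.mem_insert, Finset.mem_singleton] at hmem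
  rcases hmem with hn | hn | hn | hn | hn | hn | hn | hn | hn | hn | hn | hn
  · exact Or.inl (Subgroup.index_eq_one.mp hn)
  · exact (hb 2 hn (by norm_num)).elim
  · exact (hb 4 hn (by norm_num)).elim
  · exact (hs 7 false hn (by norm_num) (by norm_num) (by norm_num) (by norm_num) searchFromY_6048_7).elim
  · exact (hs 8 true hn (by norm_num) (by norm_num) (by simp) (by norm_num) searchFromY_6048_8).elim
  · exact (hs 14 false hn (by norm_num) (by norm_num) (by norm_num) (by norm_num) searchFromY_6048_14).elim
  · exact (hs 16 true hn (by norm_num) (by norm_num) (by simp) (by norm_num) searchFromY_6048_16).elim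
  · exact (hs 28 false hn (by norm_num) (by norm_num) (by norm_num) (by norm_num) searchFromY_6048_28).elim
  · exact (hb 32 hn (by norm_num)).elim
  all_goals omega

/-- The Sylow `3`-subgroups in a group all of whose subgroups of index dividing `m` are known. -/
theorem false_of_index (h : IsHurwitzPair x y) (h8 : 8 ∣ Nat.card G) {m : ℕ}
    (hm280 : m = 280 ∧ Nat.card G = 9 * m ∨ m = 224 ∧ Nat.card G = 27 * m)
    (hm : ∀ H : Subgroup G, H.index ∣ m → H = ⊤ ∨ H.index * 1 = m ∨ H.index * 2 = m ∨
      H.index * 5 = m ∨ H.index * 4 = m) : False := by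
  have : Fact (Nat.Prime 3) := ⟨by norm_num⟩
  obtain ⟨P⟩ : Nonempty (Sylow 3 G) := inferInstance
  have hP : Nat.card P = 9 ∧ m = 280 ∨ Nat.card P = 27 ∧ m = 224 := by
    rcases hm280 with ⟨rfl, hG⟩ | ⟨rfl, hG⟩
    · exact Or.inl ⟨P.card_eq_pow (k := 2) (m := 280) hG (by norm_num), rfl⟩
    · exact Or.inr ⟨P.card_eq_pow (k := 3) (m := 224) hG (by norm_num), rfl⟩
  have hG : Nat.card G = Nat.card P * m := by
    rcases hm280 with ⟨h1, h2⟩ | ⟨h1, h2⟩ <;> rcases hP with ⟨h3, h4⟩ | ⟨h3, h4⟩ <;> rw [h2, h3] <;> omega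
  have hindex : (P : Subgroup G).index = m := by
    have h1 := Subgroup.card_mul_index (P : Subgroup G)
    rw [hG] at h1
    exact Nat.eq_of_mul_eq_mul_left Nat.card_pos h1
  have hdvd := P.card_dvd_index
  have hmod : Nat.card (Sylow 3 G) % 3 = 1 := card_sylow_modEq_one 3 G
  have hsyl := P.card_eq_index_normalizer
  rw [hindex] at hdvd
  -- Among the admissible indices other than 1, only 280, 70 and 112 are 1 modulo 3. Of these 280 is
  -- 1 modulo 9, while 70 and 112 are 7 and 4.
  have hcard : Nat.card (Sylow 3 G) * 1 = 280 ∧ m = 280 ∨ ¬ Nat.card (Sylow 3 G) ≡ 1 [MOD 3 ^ 2] := by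
    rcases hm (Subgroup.normalizer (P : Set G)) (hsyl ▸ hdvd) with h1 | h1 | h1 | h1 | h1
    · exfalso
      exact h.card_ne_one (P := P) le_rfl (Subgroup.normalizer_eq_top_iff.mp h1) (Or.inr rfl)
        (by rcases hP with ⟨hP, -⟩ | ⟨hP, -⟩; exacts [Or.inr (Or.inl hP), Or.inr (Or.inr hP)])
    all_goals
      rw [← hsyl] at h1
      unfold Nat.ModEq
      rcases hP with ⟨-, hm⟩ | ⟨-, hm⟩ <;> omega
  rcases hcard with ⟨h1, h2⟩ | h1
  · have hP9 : Nat.card P = 3 ^ 2 := by omega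
    refine h.ne_normalizer P (Subgroup.mul_comm_of_card_sq hP9) (fun hbot => ?_)
      (P.normalizer_eq_of_card_eq_index (by omega))
    have : Nat.card ↥(P : Subgroup G) = 3 ^ 2 := hP9
    rw [hbot, Subgroup.card_bot] at this
    omega
  · obtain ⟨Q, hQ, hPQ⟩ := Sylow.exists_card_inf h1 P
    refine h.false_of_card_inf h8 hQ hPQ (by omega) hG hm fun H hH => ?_
    rcases hm H (Dvd.dvd.trans (Dvd.intro _ rfl) hH) with h2 | h2 | h2 | h2 | h2
    · exact h2
    all_goals
      exfalso
      obtain ⟨c, hc⟩ := hH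
      have hpos : 0 < H.index := Nat.pos_of_ne_zero Subgroup.index_ne_zero_of_finite
      rw [← h2, mul_assoc] at hc
      have := Nat.eq_of_mul_eq_mul_left hpos hc
      omega

theorem card_ne_2520 (h : IsHurwitzPair x y) : Nat.card G ≠ 2520 := fun hG =>
  h.false_of_index (by rw [hG]; norm_num) (Or.inl ⟨rfl, hG⟩) (h.index_of_card_eq_2520 hG)

theorem card_ne_6048 (h : IsHurwitzPair x y) : Nat.card G ≠ 6048 := fun hG =>
  h.false_of_index (by rw [hG]; norm_num) (Or.inr ⟨rfl, hG⟩) (h.index_of_card_eq_6048 hG)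

end IsHurwitzPair

theorem Equiv.Perm.ncard_modEq {X : Type*} [Finite X] (f : Equiv.Perm X) {p : ℕ} [Fact p.Prime]
    (hf : f ^ p = 1) {S : Set X} (hS : ∀ s ∈ S, f s ∈ S) : S.ncard ≡ {s ∈ S | f s = s}.ncard [MOD p] := by
  have hinv : ∀ s, f s ∈ S ↔ s ∈ S := by
    intro s
    refine ⟨fun h => ?_, hS s⟩
    have hpow : ∀ n : ℕ, ∀ r ∈ S, (f ^ n) r ∈ S := by
      intro n
      induction n with
      | zero => exact fun r hr => hr
      | succ n ih => exact fun r hr => ih _ (hS r hr)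
    have h1 := hpow (p - 1) _ h
    rwa [← Equiv.Perm.mul_apply, ← pow_succ, Nat.sub_add_cancel (Fact.out : p.Prime).one_le, hf] at h1
  let g : Equiv.Perm S := f.subtypePerm hinv
  have hg : g ^ p = 1 := by
    ext s
    rw [Equiv.Perm.subtypePerm_pow]
    exact congrArg (fun q : Equiv.Perm X => q s) hf
  have h1 := card_modEq_fixedBy (X := S) g (p := p) hg
  rw [Nat.card_coe_set_eq] at h1
  convert h1 using 1
  rw [← Set.ncard_image_of_injective _ Subtype.val_injective]
  congr 1
  ext s
  constructor
  · rintro ⟨hs, hfs⟩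
    exact ⟨⟨s, hs⟩, Subtype.ext hfs, rfl⟩
  · rintro ⟨r, hr, rfl⟩
    exact ⟨r.2, congrArg Subtype.val hr⟩

/-! ### Groups of order 16 with an automorphism of order seven -/

section OrderSixteen

variable {K : Type*} [Group K] [Finite K]

/-- No group of order 16 has a central involution that is the square of all elements other than itself
and `1`. -/
theorem false_of_sq_eq (hK : Nat.card K = 16) {t : K} (ht1 : t ≠ 1) (ht2 : t * t = 1)
    (ht : ∀ g, t * g = g * t) (hsq : ∀ a : K, a = 1 ∨ a = t ∨ a * a = t) : False := by
  classical
  -- With `t` in the role of `-1`, elements of square `t` anticommute: expand `(a * b) ^ 2 = t`.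
  -- Here `a⁻¹ = a * t`, so the exceptions are `b = a` and `b = a * t`.
  have hanti : ∀ a b : K, a * a = t → b * b = t → b ≠ a → b ≠ a * t → b * a = a * b * t := by
    intro a b ha hb h1 h2
    have hainv : a * (a * t) = 1 := by rw [← mul_assoc, ha, ht2]
    rcases hsq (a * b) with h3 | h3 | h3
    · exact absurd (mul_left_cancel (h3.trans hainv.symm)) h2
    · exact absurd (mul_left_cancel (h3.trans ha.symm)) h1
    · have h4 : a * a * (b * a) * (b * b) = a * (a * b * (a * b)) * b := by group
      rw [ha, hb, h3, mul_assoc, ← ht, ← mul_assoc, ht2, one_mul, mul_assoc, ht, ← mul_assoc] at h4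
      exact h4
  have hex : ∀ s : Finset K, s.card < 16 → ∃ a, a ∉ s := by
    intro s hs
    by_contra! hc
    have := Fintype.ofFinite K
    have h1 : s = Finset.univ := Finset.eq_univ_of_forall hc
    rw [h1, Finset.card_univ, ← Nat.card_eq_fintype_card, hK] at hs
    omega
  obtain ⟨a, ha⟩ := hex {1, t} (Finset.card_le_two.trans_lt (by norm_num))
  obtain ⟨b, hb⟩ := hex {1, t, a, a * t} (Finset.card_le_four.trans_lt (by norm_num))
  obtain ⟨c, hc⟩ := hex ({1, t, a, a * t} ∪ {b, b * t, a * b, a * b * t})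
    ((Finset.card_union_le _ _).trans_lt ((Nat.add_le_add Finset.card_le_four Finset.card_le_four).trans_lt
      (by norm_num)))
  simp only [Finset.mem_union, Finset.mem_insert, Finset.mem_singleton, not_or] at ha hb hc
  obtain ⟨⟨c1, ct, ca, cat⟩, cb, cbt, cab, cabt⟩ := hc
  have ha2 := ((hsq a).resolve_left ha.1).resolve_left ha.2
  have hb2 := ((hsq b).resolve_left hb.1).resolve_left hb.2.1
  have hc2 := ((hsq c).resolve_left c1).resolve_left ct
  have hab : a * b * (a * b) = t := by
    have h1 := hanti a b ha2 hb2 hb.2.2.1 hb.2.2.2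
    rw [mul_assoc a b, ← mul_assoc b a b, h1, mul_assoc (a * b), ht b, ← mul_assoc (a * b), mul_assoc a b b, hb2,
      ← mul_assoc, ← mul_assoc, ha2, ht2, one_mul]
  have h1 := hanti a c ha2 hc2 ca cat
  have h2 := hanti b c hb2 hc2 cb cbt
  have h3 := hanti (a * b) c hab hc2 cab cabt
  -- Anticommuting with `a` and with `b`, the element `c` commutes with `a * b`; but it anticommutes
  -- with `a * b` too.
  rw [← mul_assoc, h1, mul_assoc (a * c), ht b, ← mul_assoc, mul_assoc a c b, h2, mul_assoc a, mul_assoc _ t t, ht2, mul_one,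
    ← mul_assoc] at h3
  exact ht1 (mul_eq_left.mp h3.symm)

/-- Count the solutions of `k * k = 1` and of `k * k = t` modulo 7 by `σ` and modulo 2 by inversion.
Either all 16 elements satisfy the first, or `t` is the only involution and the other 14 elements
satisfy the second, which `false_of_sq_eq` excludes. -/
theorem sq_eq_one_of_automorphism (hK : Nat.card K = 16) (σ : MulAut K) (hσ : σ ^ 7 = 1) {t : K}
    (ht1 : t ≠ 1) (hfix : ∀ a, σ a = a ↔ a = 1 ∨ a = t) (ht2 : t * t = 1) (a : K) : a * a = 1 := by
  classical
  have : Fact (Nat.Prime 2) := ⟨by norm_num⟩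
  have : Fact (Nat.Prime 7) := ⟨by norm_num⟩
  have hσt : σ t = t := (hfix t).mpr (Or.inr rfl)
  have hσ7 : (MulAut.toPerm K σ) ^ 7 = 1 := by rw [← map_pow, hσ, map_one]
  have hinv2 : (Equiv.inv K) ^ 2 = 1 := by ext k; simp [pow_two]
  have htinv : t⁻¹ = t := inv_eq_of_mul_eq_one_right ht2
  let I : Set K := {k | k * k = 1}
  have hI7 := (MulAut.toPerm K σ).ncard_modEq hσ7 (S := I) (fun k hk => by
    change σ k * σ k = 1
    rw [← map_mul, show k * k = 1 from hk, map_one])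
  have hI7' : {k ∈ I | MulAut.toPerm K σ k = k} = {1, t} := by
    ext k
    change (k * k = 1 ∧ σ k = k) ↔ k = 1 ∨ k = t
    rw [hfix]
    refine ⟨fun h => h.2, fun h => ⟨?_, h⟩⟩
    rcases h with rfl | rfl
    exacts [mul_one 1, ht2]
  rw [hI7', Set.ncard_pair ht1.symm] at hI7
  have hI2 := (Equiv.inv K).ncard_modEq hinv2 (S := Set.univ) (fun _ _ => Set.mem_univ _)
  have hI2' : {k ∈ (Set.univ : Set K) | Equiv.inv K k = k} = I := by
    ext k
    change (True ∧ k⁻¹ = k) ↔ k * k = 1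
    rw [true_and, inv_eq_iff_mul_eq_one]
  rw [hI2', Set.ncard_univ, hK] at hI2
  have hIle : I.ncard ≤ 16 := by
    rw [← hK, ← Set.ncard_univ]
    exact Set.ncard_le_ncard (Set.subset_univ _) (Set.toFinite _)
  have hIcases : I.ncard = 16 ∨ I.ncard = 2 := by
    unfold Nat.ModEq at hI7 hI2
    omega
  rcases hIcases with h16 | h2
  · have : I = Set.univ := by
      refine Set.eq_of_subset_of_ncard_le (Set.subset_univ _) ?_ (Set.toFinite _)
      rw [h16, Set.ncard_univ, hK]
    exact (this ▸ Set.mem_univ a : a ∈ I)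
  exfalso
  have hIeq : I = {1, t} := by
    refine (Set.eq_of_subset_of_ncard_le ?_ ?_ (Set.toFinite _)).symm
    · rintro k (rfl | rfl)
      exacts [mul_one 1, ht2]
    · rw [h2, Set.ncard_pair ht1.symm]
  have hsq1 : ∀ k, k * k = 1 → k = 1 ∨ k = t := fun k hk => (hIeq ▸ hk : k ∈ ({1, t} : Set K))
  have htc : ∀ g, t * g = g * t := by
    intro g
    have h3 : g⁻¹ * t * g * (g⁻¹ * t * g) = 1 := by
      rw [show g⁻¹ * t * g * (g⁻¹ * t * g) = g⁻¹ * (t * t) * g by group, ht2, mul_one, inv_mul_cancel]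
    rcases hsq1 _ h3 with h4 | h4
    · rw [mul_assoc, inv_mul_eq_one] at h4
      exact absurd (mul_eq_right.mp h4.symm) ht1
    · rwa [mul_assoc, inv_mul_eq_iff_eq_mul] at h4
  let F : Set K := {k | k * k = t}
  have hF7 := (MulAut.toPerm K σ).ncard_modEq hσ7 (S := F) (fun k hk => by
    change σ k * σ k = t
    rw [← map_mul, show k * k = t from hk, hσt])
  have hF7' : {k ∈ F | MulAut.toPerm K σ k = k} = ∅ := by
    refine Set.eq_empty_of_forall_notMem ?_
    rintro k ⟨h3, h4⟩
    rcases (hfix k).mp h4 with rfl | rfl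
    · exact ht1 ((mul_one 1).symm.trans h3).symm
    · exact ht1 ((show k * k = k from h3).symm.trans ht2)
  rw [hF7', Set.ncard_empty] at hF7
  have hF2 := (Equiv.inv K).ncard_modEq hinv2 (S := F) (fun k hk => by
    change k⁻¹ * k⁻¹ = t
    rw [← mul_inv_rev, show k * k = t from hk, htinv])
  have hF2' : {k ∈ F | Equiv.inv K k = k} = ∅ := by
    refine Set.eq_empty_of_forall_notMem ?_
    rintro k ⟨h3, h4⟩
    exact ht1 ((show k * k = t from h3).symm.trans (inv_eq_iff_mul_eq_one.mp h4))
  rw [hF2', Set.ncard_empty] at hF2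
  have hdisj : Disjoint F {1, t} := by
    rw [← hIeq, Set.disjoint_left]
    exact fun k h3 h4 => ht1 ((show k * k = t from h3).symm.trans h4)
  have hun := Set.ncard_union_eq hdisj (Set.toFinite _) (Set.toFinite _)
  rw [Set.ncard_pair ht1.symm] at hun
  have hle : (F ∪ {1, t}).ncard ≤ 16 := by
    rw [← hK, ← Set.ncard_univ]
    exact Set.ncard_le_ncard (Set.subset_univ _) (Set.toFinite _)
  have hFne : F.Nonempty := by
    obtain ⟨k, hk⟩ : ∃ k, k ∉ I := by
      by_contra! hc
      rw [Set.eq_univ_of_forall hc, Set.ncard_univ, hK] at h2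
      omega
    have h16 : k ^ 2 ^ 4 = 1 := by
      have := pow_card_eq_one' (x := k)
      rwa [hK] at this
    -- the last power that is not an involution
    have hstep : ∀ n : ℕ, ∀ r : K, r ∉ I → r ^ 2 ^ n = 1 → F.Nonempty := by
      intro n
      induction n with
      | zero =>
        intro r hr h3
        rw [pow_zero, pow_one] at h3
        exact absurd (show r * r = 1 by rw [h3, mul_one]) hr
      | succ n ih =>
        intro r hr h3
        by_cases h4 : r * r ∈ I
        · exact ⟨r, (hsq1 _ h4).resolve_left hr⟩
        · refine ih _ h4 ?_
          rw [← pow_two, ← pow_mul, ← pow_succ']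
          exact h3
    exact hstep 4 k hk h16
  have hFpos := (Set.ncard_pos (Set.toFinite F)).mpr hFne
  -- `F` is nonempty, and its size is a multiple of 14.
  have hall : F ∪ {1, t} = Set.univ := by
    refine Set.eq_of_subset_of_ncard_le (Set.subset_univ _) ?_ (Set.toFinite _)
    rw [Set.ncard_univ, hK]
    unfold Nat.ModEq at hF7 hF2
    omega
  refine false_of_sq_eq hK ht1 ht2 htc fun k => ?_
  rcases (hall ▸ Set.mem_univ k : k ∈ F ∪ {1, t}) with h3 | h3 | h3
  exacts [Or.inr (Or.inr h3), Or.inl h3, Or.inr (Or.inl h3)]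

end OrderSixteen

/-- The subgroup of all `σ k * k⁻¹`, for an automorphism `σ` of a commutative group. -/
def MulAut.displacement {K : Type*} [Group K] (hcomm : ∀ a b : K, a * b = b * a) (σ : MulAut K) : K →* K where
  toFun k := σ k * k⁻¹
  map_one' := by rw [map_one, inv_one, mul_one]
  map_mul' a b := by
    rw [map_mul, mul_inv_rev, hcomm b⁻¹]
    exact (show Commute (σ b) a⁻¹ from hcomm _ _).mul_mul_mul_comm _ _

/-! ### Order 2688 -/

namespace IsHurwitzPair

variable {G : Type*} [Group G] [Finite G] {x y : G}

open CosetTable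

/-- The core of a Sylow 2-subgroup, of index 21. Its index is not 504, which does not divide 2688.
-/
theorem exists_normal_card_sixteen (h : IsHurwitzPair x y) (hG : Nat.card G = 2688) :
    ∃ K : Subgroup G, K.Normal ∧ Nat.card K = 16 := by
  have : Fact (Nat.Prime 2) := ⟨by norm_num⟩
  obtain ⟨S⟩ : Nonempty (Sylow 2 G) := inferInstance
  have hS : Nat.card ↥(S : Subgroup G) = 2 ^ 7 := S.card_eq_pow (k := 7) (m := 21) hG (by norm_num)
  have hindex : (S : Subgroup G).index = 21 := by
    have h1 := Subgroup.card_mul_index (S : Subgroup G)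
    rw [hG, hS] at h1
    omega
  have h1 := h.hasSmallIndex_normalCore_of_searchFromX hG (S : Subgroup G) hindex (by norm_num) (by norm_num)
    (by norm_num) (by norm_num) searchFromX_2688_21
  refine ⟨(S : Subgroup G).normalCore, inferInstance, ?_⟩
  have h2 := Subgroup.card_mul_index (S : Subgroup G).normalCore
  rw [hG] at h2
  rcases h1 with h1 | ⟨h1, -⟩ <;> rw [h1] at h2 <;> omega

/-- The index of the core would be a multiple of 16, unlike 168 and 504. -/
theorem index_ne_sixteen (h : IsHurwitzPair x y) (hG : Nat.card G = 2688) (H : Subgroup G) :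
    H.index ≠ 16 := by
  intro hH
  have h1 := h.hasSmallIndex_normalCore_of_searchFromY hG H hH (by norm_num) (by norm_num) (by simp)
    (by norm_num) searchFromY_2688_16
  have h2 := Subgroup.index_dvd_of_le H.normalCore_le
  rw [hH] at h2
  rcases h1 with h1 | ⟨h1, -⟩ <;> rw [h1] at h2 <;> omega

/-- A subgroup of index eight in which `y * x` generates a normal subgroup modulo `K`. -/
theorem exists_index_eight (h : IsHurwitzPair x y) {K : Subgroup G} [K.Normal] (hK : K.index = 168) :
    ∃ H : Subgroup G, K ≤ H ∧ H.index = 8 ∧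
      ∀ g ∈ H, ∃ (i : ℕ), ∃ k ∈ K, g * (y * x) * g⁻¹ = (y * x) ^ i * k := by
  have : Fact (Nat.Prime 7) := ⟨by norm_num⟩
  have hq := h.map (QuotientGroup.mk' K) (QuotientGroup.mk'_surjective K)
  have hcard : Nat.card (G ⧸ K) = 168 := hK
  set u : G ⧸ K := QuotientGroup.mk' K (y * x) with hu
  have hu' : u = QuotientGroup.mk' K y * QuotientGroup.mk' K x := map_mul _ _ _
  have hZ : IsPGroup 7 (Subgroup.zpowers u) := by
    refine IsPGroup.of_card_dvd_pow (n := 1) ?_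
    rw [Nat.card_zpowers, pow_one]
    exact orderOf_dvd_of_pow_eq_one (by rw [hu']; exact hq.u_pow)
  obtain ⟨R, hR⟩ := hZ.exists_le_sylow
  have hRcard : Nat.card ↥(R : Subgroup (G ⧸ K)) = 7 := R.card_eq_pow (k := 1) (m := 24) hcard (by norm_num)
  have huR : u ∈ (R : Subgroup (G ⧸ K)) := hR (Subgroup.mem_zpowers u)
  have hu1 : u ≠ 1 := by
    intro h1
    have hall : ∀ g : G ⧸ K, g = 1 := hq.hom_eq_one_of_u (MonoidHom.id _) (hu' ▸ h1)
    have : Nat.card (G ⧸ K) = 1 := Nat.card_eq_one_iff_unique.mpr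
      ⟨⟨fun a b => (hall a).trans (hall b).symm⟩, inferInstance⟩
    omega
  have hZR : Subgroup.zpowers u = R := by
    refine Subgroup.eq_of_le_of_card_ge hR ?_
    rw [hRcard, Nat.card_zpowers]
    refine (orderOf_eq_prime ?_ hu1).ge
    rw [hu']; exact hq.u_pow
  -- The number of Sylow 7-subgroups divides 24, is 1 modulo 7 and is not 1, so it is 8.
  have hn : (Subgroup.normalizer (R : Set (G ⧸ K))).index = 8 := by
    rw [← R.card_eq_index_normalizer]
    have h1 := Subgroup.card_mul_index (R : Subgroup (G ⧸ K))
    rw [hcard, hRcard] at h1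
    have h2 := R.card_dvd_index
    rw [show (R : Subgroup (G ⧸ K)).index = 24 by omega] at h2
    have h3 : Nat.card (Sylow 7 (G ⧸ K)) % 7 = 1 := card_sylow_modEq_one 7 (G ⧸ K)
    have h4 : Nat.card (Sylow 7 (G ⧸ K)) ≠ 1 := by
      intro h4
      rw [R.card_eq_index_normalizer, Subgroup.index_eq_one] at h4
      have hRn : (R : Subgroup (G ⧸ K)).Normal := Subgroup.normalizer_eq_top_iff.mp h4
      have h5 := hq.eq_top_of_mem (R : Subgroup (G ⧸ K)) (Or.inr (Or.inr (hu' ▸ huR)))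
      rw [h5, Subgroup.card_top, hcard] at hRcard
      omega
    have h5 := Nat.le_of_dvd (by norm_num) h2
    interval_cases Nat.card (Sylow 7 (G ⧸ K)) <;> omega
  refine ⟨(Subgroup.normalizer (R : Set (G ⧸ K))).comap (QuotientGroup.mk' K), ?_, ?_, ?_⟩
  · intro k hk
    rw [Subgroup.mem_comap, show QuotientGroup.mk' K k = 1 from (QuotientGroup.eq_one_iff k).mpr hk]
    exact one_mem _
  · rw [Subgroup.index_comap_of_surjective _ (QuotientGroup.mk'_surjective K), hn]
  · intro g hg
    have h1 := (Subgroup.mem_normalizer_iff.mp hg u).mp huR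
    rw [← hZR, ← mem_powers_iff_mem_zpowers] at h1
    obtain ⟨i, hi⟩ := h1
    refine ⟨i, ((y * x) ^ i)⁻¹ * (g * (y * x) * g⁻¹), ?_, (mul_inv_cancel_left _ _).symm⟩
    rw [← QuotientGroup.eq]
    exact hi

/-- A subgroup of order eight of `K` that is normalized by `H`. -/
theorem exists_card_eight (h : IsHurwitzPair x y) {K H : Subgroup G} [K.Normal] (hK : Nat.card K = 16)
    (hH : ∀ g ∈ H, ∃ (i : ℕ), ∃ k ∈ K, g * (y * x) * g⁻¹ = (y * x) ^ i * k) :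
    ∃ L : Subgroup G, L ≤ K ∧ Nat.card L = 8 ∧ ∀ g ∈ H, ∀ l ∈ L, g * l * g⁻¹ ∈ L := by
  have : Fact (Nat.Prime 2) := ⟨by norm_num⟩
  have : Fact (Nat.Prime 7) := ⟨by norm_num⟩
  let σ : MulAut K := MulAut.conjNormal (y * x)
  have hσ7 : σ ^ 7 = 1 := by rw [← map_pow, h.u_pow, map_one]
  have hσapp : ∀ k : K, ((σ k : K) : G) = y * x * k * (y * x)⁻¹ := fun k => MulAut.conjNormal_apply _ k
  let C : Subgroup K := MonoidHom.eqLocus (σ : K →* K) (MonoidHom.id K)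
  have hC : ∀ k, k ∈ C ↔ σ k = k := fun k => Iff.rfl
  have hmod := card_modEq_fixedBy (X := K) σ (p := 7) hσ7
  have hCcard : (MulAction.fixedBy K σ).ncard = Nat.card C := (Nat.card_coe_set_eq (C : Set K)).symm
  rw [hCcard, hK] at hmod
  obtain ⟨j, hj, hCj⟩ := (Nat.dvd_prime_pow (m := 4) Nat.prime_two).mp
    (show Nat.card C ∣ 2 ^ 4 by
      rw [show 2 ^ 4 = 16 by norm_num, ← hK]
      exact Subgroup.card_subgroup_dvd_card C)
  -- The order of `C` is a power of two that is 2 modulo 7. If it is 16, then `K` is central and any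
  -- subgroup of order eight will do; if it is 2, `K` is elementary abelian and `L` is the subgroup
  -- of commutators of `y * x` with `K`.
  have hcases : Nat.card C = 16 ∨ Nat.card C = 2 := by
    rw [hCj] at hmod ⊢
    unfold Nat.ModEq at hmod
    interval_cases j <;> omega
  rcases hcases with h16 | h2
  · have htop : C = ⊤ := Subgroup.eq_top_of_card_eq _ (h16.trans hK.symm)
    have hc := h.le_center_of_commute K fun k hk => by
      have h1 : σ ⟨k, hk⟩ = ⟨k, hk⟩ := (hC _).mp (htop ▸ Subgroup.mem_top _)
      exact mul_inv_eq_iff_eq_mul.mp ((hσapp _).symm.trans (congrArg Subtype.val h1))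
    obtain ⟨L, hL⟩ := Sylow.exists_subgroup_card_pow_prime (G := K) 2 (n := 3) (by rw [hK]; norm_num)
    refine ⟨L.map K.subtype, Subgroup.map_subtype_le L, (Subgroup.card_subtype K L).trans hL, ?_⟩
    intro g _ l hl
    rwa [Subgroup.mem_center_iff.mp (hc (Subgroup.map_subtype_le L hl)) g, mul_inv_cancel_right]
  · obtain ⟨⟨t, htC⟩, htne⟩ : ∃ t : C, t ≠ 1 := by
      by_contra! hc
      have : Nat.card C = 1 := Nat.card_eq_one_iff_unique.mpr
        ⟨⟨fun a b => (hc a).trans (hc b).symm⟩, inferInstance⟩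
      omega
    have ht1 : t ≠ 1 := fun he => htne (Subtype.ext he)
    have ht2 : t * t = 1 := by
      have := pow_card_eq_one' (x := (⟨t, htC⟩ : C))
      rw [h2, pow_two] at this
      exact congrArg Subtype.val this
    have hpair : (C : Set K) = {1, t} := by
      refine (Set.eq_of_subset_of_ncard_le ?_ ?_ (Set.toFinite _)).symm
      · rintro k (rfl | rfl)
        exacts [one_mem C, htC]
      · rw [Set.ncard_pair ht1.symm, ← Nat.card_coe_set_eq]
        exact h2.le
    have hsq := sq_eq_one_of_automorphism hK σ hσ7 ht1 (fun a => by
      rw [← hC, ← SetLike.mem_coe, hpair]; rfl) ht2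
    have hcomm : ∀ a b : K, a * b = b * a := by
      intro a b
      have h1 : ∀ k : K, k⁻¹ = k := fun k => inv_eq_of_mul_eq_one_right (hsq k)
      rw [← h1 (a * b), mul_inv_rev, h1, h1]
    let δ := MulAut.displacement hcomm σ
    have hδ : ∀ k, δ k = σ k * k⁻¹ := fun k => rfl
    have hker : δ.ker = C := by
      ext k
      rw [MonoidHom.mem_ker, hδ, mul_inv_eq_one]
      rfl
    have hrange : Nat.card δ.range = 8 := by
      have h1 := Subgroup.card_mul_index δ.ker
      rw [Subgroup.index_ker, hker, h2, hK] at h1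
      omega
    have hpow : ∀ (i : ℕ) (k : K), (σ ^ i) k * k⁻¹ ∈ δ.range := by
      intro i
      induction i with
      | zero =>
        intro k
        rw [pow_zero, MulAut.one_apply, mul_inv_cancel]
        exact one_mem _
      | succ i ih =>
        intro k
        have h1 : (σ ^ (i + 1)) k * k⁻¹ = ((σ ^ i) (σ k) * (σ k)⁻¹) * (σ k * k⁻¹) := by
          rw [pow_succ, MulAut.mul_apply]; group
        rw [h1]
        exact mul_mem (ih _) ⟨k, rfl⟩
    refine ⟨δ.range.map K.subtype, Subgroup.map_subtype_le _, (Subgroup.card_subtype K _).trans hrange, ?_⟩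
    rintro g hg _ ⟨_, ⟨k, rfl⟩, rfl⟩
    obtain ⟨i, k', hk', hu⟩ := hH g hg
    let κ : K := MulAut.conjNormal g k
    have hκ : (κ : G) = g * k * g⁻¹ := MulAut.conjNormal_apply g k
    have hσi : (((σ ^ i) κ : K) : G) = (y * x) ^ i * κ * ((y * x) ^ i)⁻¹ := by
      rw [show σ ^ i = MulAut.conjNormal ((y * x) ^ i) from (map_pow _ _ _).symm, MulAut.conjNormal_apply]
    refine ⟨(σ ^ i) κ * κ⁻¹, hpow i κ, ?_⟩
    -- Conjugation by `g` turns the commutator of `y * x` and `k` into that of `(y * x) ^ i * k'`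
    -- and `κ`; since `K` is abelian, `k'` drops out.
    have h1 : k' * (κ : G) * k'⁻¹ = κ := by
      have := congrArg Subtype.val (hcomm ⟨k', hk'⟩ κ)
      rw [mul_inv_eq_iff_eq_mul]
      exact this
    have h2 : g * (y * x) * g⁻¹ * κ * (g * (y * x) * g⁻¹)⁻¹ * (κ : G)⁻¹ =
        g * (((y * x) * k * (y * x)⁻¹) * (k : G)⁻¹) * g⁻¹ := by
      rw [hκ]; group
    rw [hu] at h2
    have h3 : (y * x) ^ i * k' * κ * ((y * x) ^ i * k')⁻¹ * (κ : G)⁻¹ =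
        (y * x) ^ i * (k' * κ * k'⁻¹) * ((y * x) ^ i)⁻¹ * (κ : G)⁻¹ := by group
    rw [h3, h1, ← hσi] at h2
    exact h2.trans (by rw [hδ]; simp only [map_mul, Subgroup.coe_subtype, Subgroup.coe_inv, hσapp])

/-- Modulo `L`, the group `H` has order 42 and `K` becomes a normal subgroup of order 2. Its
complement, by Schur–Zassenhaus, pulls back to index 2 in `H`, hence to index 16 in `G`. -/
theorem card_ne_2688 (h : IsHurwitzPair x y) : Nat.card G ≠ 2688 := by
  intro hG
  obtain ⟨K, hKn, hK⟩ := h.exists_normal_card_sixteen hG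
  have hKi : K.index = 168 := by
    have h1 := Subgroup.card_mul_index K
    rw [hK, hG] at h1
    omega
  obtain ⟨H, hKH, hH8, hH⟩ := h.exists_index_eight hKi
  obtain ⟨L, hLK, hL8, hL⟩ := h.exists_card_eight hK hH
  have hLn : (L.subgroupOf H).Normal := ⟨fun l hl g => hL g g.2 l hl⟩
  have hKHn : (K.subgroupOf H).Normal := inferInstance
  have hle : L.subgroupOf H ≤ K.subgroupOf H := fun l hl => hLK hl
  let π := QuotientGroup.mk' (L.subgroupOf H)
  have hπ : Function.Surjective π := QuotientGroup.mk'_surjective _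
  let N := (K.subgroupOf H).map π
  have hNn : N.Normal := hKHn.map π hπ
  have hNindex : N.index = 21 := by
    rw [← Subgroup.index_comap_of_surjective N hπ, Subgroup.comap_map_eq, QuotientGroup.ker_mk', sup_eq_left.mpr hle]
    have h1 := Subgroup.relIndex_mul_index hKH
    rw [hH8, hKi] at h1
    change K.relIndex H = 21
    omega
  have hcard : Nat.card (H ⧸ L.subgroupOf H) = 42 := by
    have h1 := Subgroup.card_mul_index (L.subgroupOf H)
    rw [Nat.card_congr (Subgroup.subgroupOfEquivOfLe (hLK.trans hKH)).toEquiv, hL8] at h1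
    have h2 := Subgroup.card_mul_index H
    rw [hG, hH8] at h2
    change (L.subgroupOf H).index = 42
    omega
  have hN : Nat.card N = 2 := by
    have h1 := Subgroup.card_mul_index N
    rw [hNindex, hcard] at h1
    omega
  obtain ⟨C, hC⟩ := Subgroup.exists_right_complement'_of_coprime (N := N) (by rw [hN, hNindex]; norm_num)
  have hCi : C.index = 2 := hC.index_eq_card.trans hN
  refine h.index_ne_sixteen hG ((C.comap π).map H.subtype) ?_
  rw [Subgroup.index_map_subtype, Subgroup.index_comap_of_surjective C hπ, hCi, hH8]

end IsHurwitzPair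

/-! ### From the presentation to a Hurwitz pair -/

theorem isHurwitzPair_of_surjective {G : Type*} [Group G] (φ : PolygonalGroup ![2, 3, 7] →* G)
    (hφ : Function.Surjective φ) :
    IsHurwitzPair (φ (PresentedGroup.of 0)) (φ (PresentedGroup.of 1)) := by
  have hpow : ∀ i : Fin 3, φ (PresentedGroup.of i) ^ (![2, 3, 7] i) = 1 := by
    intro i
    rw [← map_pow]
    have h1 : PresentedGroup.mk (polygonalRels ![2, 3, 7]) (FreeGroup.of i ^ (![2, 3, 7] i)) = 1 :=
      PresentedGroup.one_of_mem (Or.inl ⟨i, rfl⟩)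
    rw [map_pow] at h1
    exact (congrArg φ h1).trans (map_one φ)
  have hprod : φ (PresentedGroup.of 0) * φ (PresentedGroup.of 1) * φ (PresentedGroup.of 2) = 1 := by
    rw [← map_mul, ← map_mul]
    have h1 : PresentedGroup.mk (polygonalRels ![2, 3, 7])
        (List.ofFn fun i : Fin 3 => FreeGroup.of i).prod = 1 :=
      PresentedGroup.one_of_mem (Or.inr rfl)
    simp only [List.ofFn_succ, List.ofFn_zero, List.prod_cons, List.prod_nil, mul_one, map_mul,
      ← mul_assoc] at h1
    exact (congrArg φ h1).trans (map_one φ)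
  set a := φ (PresentedGroup.of 0)
  set b := φ (PresentedGroup.of 1)
  set c := φ (PresentedGroup.of 2)
  have hc : c = (a * b)⁻¹ := eq_inv_of_mul_eq_one_right hprod
  refine ⟨hpow 0, hpow 1, ?_, ?_⟩
  · have h7 : c ^ 7 = 1 := hpow 2
    -- The product `b * a` is conjugate to `a * b = c⁻¹`.
    have h1 : b * a = a⁻¹ * (a * b) * a⁻¹⁻¹ := by group
    rw [h1, conj_pow, ← inv_inv (a * b), ← hc, inv_pow, h7, inv_one, mul_one, mul_inv_cancel]
  · rw [eq_top_iff]
    intro g _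
    obtain ⟨w, rfl⟩ := hφ g
    have hw : w ∈ Subgroup.closure (Set.range (PresentedGroup.of (rels := polygonalRels ![2, 3, 7]))) := by
      rw [PresentedGroup.closure_range_of]
      exact Subgroup.mem_top w
    have ha : a ∈ Subgroup.closure {a, b} := Subgroup.subset_closure (Or.inl rfl)
    have hb : b ∈ Subgroup.closure {a, b} := Subgroup.subset_closure (Or.inr rfl)
    have hle : Subgroup.closure (Set.range (PresentedGroup.of (rels := polygonalRels ![2, 3, 7]))) ≤
        (Subgroup.closure {a, b}).comap φ := by
      rw [Subgroup.closure_le]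
      rintro _ ⟨i, rfl⟩
      change φ (PresentedGroup.of i) ∈ Subgroup.closure {a, b}
      match i with
      | 0 => exact ha
      | 1 => exact hb
      | 2 => change c ∈ _; rw [hc]; exact inv_mem (mul_mem ha hb)
    exact hle hw

theorem mainTheorem6 {G : Type*} [Group G] [Finite G]
    (φ : PolygonalGroup ![2, 3, 7] →* G) (hφ : Function.Surjective φ) :
    Nat.card G ≠ 2520 ∧ Nat.card G ≠ 2688 ∧ Nat.card G ≠ 6048 := by
  have h := isHurwitzPair_of_surjective φ hφ
  exact ⟨h.card_ne_2520, h.card_ne_2688, h.card_ne_6048⟩
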